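/- Let $\mathbb T=(\mathbf C^*)^2$ with coordinates $x_1,x_2$, let $N=\mathbf Z^2$, $N_{\mathbf R}=\mathbf R^2$, let $\|\cdot\|$ be a norm on $N_{\mathbf R}$, and let $\operatorname{Log}:\mathbb T\to N_{\mathbf R}$, $\operatorname{Log}(p)=(-\log|x_1(p)|,-\log|x_2(p)|)$. Let $\hat{\mathbb T}^\circ$ be the toric limit surface: the complex manifold obtained from $\mathbb T$ by adjoining, for every rational ray $\tau\subset N_{\mathbf R}$, a pole $C_\tau\cong\mathbf C^*$. Concretely, for each basis $(v,u)$ of $N$ with $\det(v,u)=1$ and $v$ generating $\tau$, the isomorphism $(z,w)\mapsto (z^{v_1}w^{u_1},z^{v_2}w^{u_2})$ from $\mathbf C^*\times\mathbf C^*$ to $\mathbb T$ extends to a chart $\mathbf C\times\mathbf C^*\cong\mathbb T\cup C_\tau$ with $C_\tau=\{z=0\}$. Let $f=(f_1,f_2)$ be a toric map, i.e. a rational map with nonzero $f_1,f_2\in\mathbf C(x_1,x_2)$ such that $f^*\eta=\rho\,\eta$ for some constant $\rho\in\mathbf C^*$, where $\eta=\frac{dx_1\wedge dx_2}{x_1x_2}$.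 Regard $f$ as a meromorphic map $\hat{\mathbb T}^\circ\dashrightarrow\hat{\mathbb T}^\circ$, and for $p\in\hat{\mathbb T}^\circ$ let $f(p)\subset\hat{\mathbb T}^\circ$ be the fiber over $p$ of the closure of its graph. Let $\mathrm{Ind}(f)$ be the set of points near which $f$ does not extend holomorphically, let $\mathrm{Exc}(f)$ be the union of the (closed analytic) curves $C\subset\hat{\mathbb T}^\circ$ that $f$ contracts, i.e. for which $f(C\setminus\mathrm{Ind}(f))$ is a point, and let $f(\mathrm{Exc}(f))$ be the set of these points. Let $A_f:N_{\mathbf R}\to N_{\mathbf R}$ be the tropicalization of $f$: writing $f_i=P_i/Q_i$ with polynomials $P_i,Q_i$ and $\nu_w(P)=\min\{\langle m,w\rangle: x^m\text{ is a monomial of }P\}$, the $i$-th coordinate of $A_f(w)$ is $\nu_w(P_i)-\nu_w(Q_i)$. Let $U,U',V\subset\hat{\mathbb T}^\circ$ be neighborhoods of $\mathrm{Exc}(f)$, $\mathrm{Ind}(f)$ and $f(\mathrm{Exc}(f))$, respectively. Then there is a constant $C>0$ such that the following hold for all $p\in\mathbb T$. 1. If $p\notin U$, then $f(p)$ is a single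 point of $\mathbb T$ and $\|\operatorname{Log}(f(p))-A_f(\operatorname{Log}(p))\|\le C$. 2. If $p\notin U'$, then $\|\operatorname{Log}(f(p))\|\ge\|A_f(\operatorname{Log}(p))\|-C$ (where $\|\operatorname{Log}(f(p))\|$ is understood to be $+\infty$ if $f(p)\notin\mathbb T$). 3. For each $q\in f(p)$, unless $p\in U$ and $q\in V$, we have $q\in\mathbb T$ and $\|\operatorname{Log}(q)\|\le\|A_f(\operatorname{Log}(p))\|+C$. -/

import Mathlib

open Topology

namespace ToricSurface

noncomputable section

/-- The algebraic torus `𝕋 = (ℂ*)²`. -/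
abbrev Torus := Fin 2 → ℂˣ

/-- `Log : 𝕋 → N_ℝ = ℝ²`, `Log p = (-log |p₁|, -log |p₂|)`. -/
def Log (p : Torus) : Fin 2 → ℝ := fun i => -Real.log ‖(p i : ℂ)‖

/-- Primitive vectors of `N = ℤ²`; these are the generators of the rational rays of `N_ℝ`. -/
abbrev PrimVec := {v : Fin 2 → ℤ // IsCoprime (v 0) (v 1)}

/-- The points of the toric limit surface `𝕋̂°`: the torus, together with a pole `C_τ ≅ ℂ*` for each
rational ray `τ`. If `τ` is generated by `v = (v₁, v₂)`, the point `pole v c` of `C_τ` is the one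
at which the character `x₁ ^ (-v₂) x₂ ^ v₁` (which generates the characters that are
orthogonal to `v`) takes the value `c`. -/
inductive LimitSurface
  | torus (p : Torus)
  | pole (v : PrimVec) (c : ℂˣ)

/-- The first column of a matrix in `SL₂(ℤ)`, as a primitive vector. -/
def firstCol (B : Matrix.SpecialLinearGroup (Fin 2) ℤ) : PrimVec :=
  ⟨fun i => B.1 i 0, ⟨B.1 1 1, -B.1 0 1, by
    have h := B.2
    rw [Matrix.det_fin_two] at h
    linarith⟩⟩

/-- The inverse of the toric coordinate chart belonging to a positively oriented basis `(v, u)` of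
`N` (the columns of `B`). On `z ≠ 0` it is the parametrization `(z, w) ↦ z ^ v * w ^ u` of `𝕋`, and
it sends `{z = 0}` to the pole of the ray generated by `v`; its image is `𝕋 ∪ C_τ`. -/
def chart (B : Matrix.SpecialLinearGroup (Fin 2) ℤ) (y : ℂ × ℂˣ) : LimitSurface :=
  if h : y.1 = 0 then .pole (firstCol B) y.2
  else .torus fun i => Units.mk0 y.1 h ^ B.1 i 0 * y.2 ^ B.1 i 1

/-- The manifold topology of `𝕋̂°`: a set is open iff it is open in all the toric charts. -/
instance : TopologicalSpace LimitSurface :=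
  ⨆ B : Matrix.SpecialLinearGroup (Fin 2) ℤ, TopologicalSpace.coinduced (chart B) inferInstance

/-- A point of a chart domain `ℂ × ℂ*`, as a point of `ℂ²`. -/
def coords (y : ℂ × ℂˣ) : ℂ × ℂ := (y.1, (y.2 : ℂ))

/-- `g` is holomorphic near `x`: in suitable toric charts around `x` and `g x` it is given by a
holomorphic map `h` near the coordinates of `x`. -/
def HolomorphicNear (g : LimitSurface → LimitSurface) (x : LimitSurface) : Prop :=
  ∃ (B B' : Matrix.SpecialLinearGroup (Fin 2) ℤ) (y : ℂ × ℂˣ) (h : ℂ × ℂ → ℂ × ℂ),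
    chart B y = x ∧ AnalyticAt ℂ h (coords y) ∧
      ∀ᶠ y' in 𝓝 y, ∃ q : ℂ × ℂˣ, coords q = h (coords y') ∧ g (chart B y') = chart B' q

/-- Properly embedded (closed) complex analytic curves in `𝕋̂°`, possibly reducible: near every
point of `𝕋̂°` the set is, in a toric chart, the zero set of a holomorphic function that is not
identically zero. -/
def IsAnalyticCurve (C : Set LimitSurface) : Prop :=
  ∀ x : LimitSurface, ∃ (B : Matrix.SpecialLinearGroup (Fin 2) ℤ) (y : ℂ × ℂˣ) (h : ℂ × ℂ → ℂ),
    chart B y = x ∧ AnalyticAt ℂ h (coords y) ∧ (¬ ∀ᶠ a in 𝓝 (coords y), h a = 0) ∧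
      ∀ᶠ y' in 𝓝 y, (chart B y' ∈ C ↔ h (coords y') = 0)

/-- A rational map `f = (f₁, f₂)` given in the affine (torus) coordinates by two nonzero rational
functions `fᵢ = numᵢ / denᵢ ∈ ℂ(x₁, x₂)` in lowest terms. -/
structure RatMap where
  num : Fin 2 → MvPolynomial (Fin 2) ℂ
  den : Fin 2 → MvPolynomial (Fin 2) ℂ
  num_ne_zero : ∀ i, num i ≠ 0
  den_ne_zero : ∀ i, den i ≠ 0
  isRelPrime : ∀ i, IsRelPrime (num i) (den i)

/-- The weighted order `min {⟨m, w⟩ : m ∈ supp P}` of a nonzero polynomial `P`. For a primitive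
vector `w` of `N` it is the order of vanishing of `P` along the pole of the ray generated by `w`. -/
def tropPoly (P : MvPolynomial (Fin 2) ℂ) (hP : P ≠ 0) (w : Fin 2 → ℝ) : ℝ :=
  P.support.inf' (MvPolynomial.support_nonempty.mpr hP) fun m => ∑ i, (m i : ℝ) * w i

namespace RatMap

variable (f : RatMap)

/-- The value of the rational function `fᵢ`. -/
def val (i : Fin 2) (x : Fin 2 → ℂ) : ℂ :=
  MvPolynomial.eval x (f.num i) / MvPolynomial.eval x (f.den i)

/-- The dense open set of the `p ∈ 𝕋` at which `f₁`, `f₂` are finite and nonzero. -/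
def dom : Set Torus :=
  {p | ∀ i, MvPolynomial.eval (fun j => (p j : ℂ)) (f.num i) ≠ 0 ∧
    MvPolynomial.eval (fun j => (p j : ℂ)) (f.den i) ≠ 0}

/-- The map `f : dom f → 𝕋`. -/
def apply (p : Torus) (hp : p ∈ f.dom) : Torus := fun i =>
  Units.mk0 (f.val i fun j => (p j : ℂ)) (div_ne_zero (hp i).1 (hp i).2)

/-- `f^* η = ρ η` for some constant `ρ ≠ 0`, where `η = dx₁ ∧ dx₂ / (x₁ x₂)`. That is,
`det (∂fᵢ/∂xⱼ) / (f₁ f₂) = ρ / (x₁ x₂)`, here with the denominators cleared. -/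
def IsToric : Prop :=
  ∃ ρ : ℂ, ρ ≠ 0 ∧ ∀ p ∈ f.dom, ∀ x : Fin 2 → ℂ, (∀ j, x j = p j) →
    (Matrix.of fun i j : Fin 2 =>
        deriv (fun t : ℂ => f.val i (Function.update x j t)) (x j)).det * (x 0 * x 1)
      = ρ * (f.val 0 x * f.val 1 x)

/-- The graph of the meromorphic map `f : 𝕋̂° ⇢ 𝕋̂°`. -/
def graph : Set (LimitSurface × LimitSurface) :=
  closure {a | ∃ (p : Torus) (hp : p ∈ f.dom), a = (.torus p, .torus (f.apply p hp))}

/-- The image `f(x)` of a point: the fiber of the graph over `x` (a single point unless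
`x` is indeterminate). -/
def image (x : LimitSurface) : Set LimitSurface := {y | (x, y) ∈ f.graph}

/-- The indeterminacy set: the points near which `f` has no holomorphic extension. -/
def Ind : Set LimitSurface :=
  {x | ¬ ∃ g : LimitSurface → LimitSurface, HolomorphicNear g x ∧
    ∀ᶠ y in 𝓝 x, ∀ (p : Torus) (hp : p ∈ f.dom), y = .torus p → g y = .torus (f.apply p hp)}

/-- The curve `C` is contracted by `f`: `f` maps `C \ Ind f` to a single point. -/
def Contracts (C : Set LimitSurface) : Prop :=
  ∃ q, ∀ x ∈ C \ f.Ind, f.image x = {q}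

/-- The exceptional set: the union of the curves contracted by `f`. (An analytic curve is contracted
to a point only if all its irreducible components are, so it does not matter that reducible
curves are allowed here.) -/
def Exc : Set LimitSurface := ⋃₀ {C | IsAnalyticCurve C ∧ f.Contracts C}

/-- `f(Exc f)`: the set of the points to which curves are contracted. Here, as usual, the
image of a contracted curve `C` is that of `C \ Ind f`. -/
def excImage : Set LimitSurface := ⋃ x ∈ f.Exc \ f.Ind, f.image x

/-- The tropicalization `A_f : N_ℝ → N_ℝ`. It is positively homogeneous, continuous and piecewise
linear, and for a primitive vector `v` of `N` the coordinates of `A_f(v)` are the orders of `f₁` and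
`f₂` along the pole `C_τ` of the ray `τ` generated by `v`; that is, `A_f(v) = r v'` where
`f(C_τ) = C_τ'`, the ray `τ'` is generated by `v'`, and `r` is the ramification of `f`
along `C_τ`. -/
def trop (w : Fin 2 → ℝ) : Fin 2 → ℝ := fun i =>
  tropPoly (f.num i) (f.num_ne_zero i) w - tropPoly (f.den i) (f.den_ne_zero i) w

end RatMap

end

end ToricSurface

/-! ### Function fields of plane curves and algebraic dependence -/

namespace ToricSurface

open MvPolynomial

/-! If one of the estimates failed, it would fail along an ultrafilter of points of `𝕋`, so it is
enough to bound everything along one ultrafilter (`exists_bound_of_ultrafilter`). By `trichotomy`,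
the points then converge in `𝕋`, or converge to a point of a pole, or every nontrivial character has
unbounded logarithm. In the last case each polynomial is comparable to one of its monomials, and
`Log f` differs from `A_f` by a bounded amount. Only points of `𝕋` and points of poles need work.

The toric condition says that `dlog f₁ ∧ dlog f₂` is a constant multiple of `η`, which has no pole
inside `𝕋`. Taking the residue along a curve where some `fᵢ` has a zero or pole shows that the
character of `f` orthogonal to the vector of orders is constant on the curve; so the curve is
contracted to a point of a pole (`exists_contraction`) and belongs to `Exc f`. Off `Exc f`, each
`fᵢ` is therefore locally a unit times a power of the coordinate `z` of the pole, which is the first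
estimate. The residue along a pole itself shows that `f` maps every pole to a pole (`ord_ne_zero`),
and it relates the zeros of `f₁` and `f₂` on the pole (`ord_mul_eq`).

For the second estimate, let `f` be holomorphic at a point of a pole. Its first chart coordinate is
`O(|z| ^ r)` over a small circle in the pole that avoids the zeros of the `fᵢ`, where `r` is the
ramification, and the maximum principle extends this to the disc (`exists_norm_extension_le`).

The third estimate concerns points of indeterminacy. The first ingredient is that the limits of `f`
there are points of `𝕋`, the finitely many images of contracted curves, and at a pole one further
point of the image pole (`exists_isPoleValue`). This is a volume argument: in logarithmic
coordinates `f` has constant Jacobian, so the image of a set of small volume contains no large ball,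
and values of `f` in the set are close to values on its boundary (`exists_mem_frontier`). Near a
pole the set is a horn `|w - w₀| ^ N < |z|`, which is thin enough and on whose boundary the limits
of `f` are known. The second ingredient is a rate: moving along a fiber of the first coordinate of
`f` without decreasing `|z|`, one arrives, by the maximum principle, at a place where `f` is a unit
times `z ^ r` (`exists_neg_log_zc_map_le`). -/

/-- The function field of an irreducible plane curve has transcendence degree at most one. -/
theorem trdeg_functionField_le_one {P : MvPolynomial (Fin 2) ℂ} (hP : Prime P)
    (K : Type) [Field K] [Algebra ℂ K] (φ : MvPolynomial (Fin 2) ℂ →ₐ[ℂ] K)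
    (hker : ∀ Q, φ Q = 0 ↔ P ∣ Q)
    (hfrac : ∀ a : K, ∃ N M, φ M ≠ 0 ∧ a = φ N / φ M) :
    Algebra.trdeg ℂ K ≤ 1 := by
  set x : Fin 2 → K := fun i => φ (X i) with hx
  have hφ : φ = aeval x := by
    ext i; simp [hx]
  have hmem : ∀ Q, φ Q ∈ Algebra.adjoin ℂ (Set.range x) := by
    intro Q
    rw [Algebra.adjoin_range_eq_range_aeval, hφ]
    exact ⟨Q, rfl⟩
  have halg : Algebra.IsAlgebraic (Algebra.adjoin ℂ (Set.range x)) K := by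
    constructor
    intro a
    obtain ⟨N, M, hM, rfl⟩ := hfrac a
    have h1 : ∀ Q, IsAlgebraic (Algebra.adjoin ℂ (Set.range x)) (φ Q) := fun Q =>
      isAlgebraic_algebraMap (A := K) (⟨φ Q, hmem Q⟩ : Algebra.adjoin ℂ (Set.range x))
    rw [div_eq_mul_inv]
    exact (h1 N).mul (h1 M).inv
  by_contra hcon
  push Not at hcon
  have h2 : (2 : Cardinal) ≤ Algebra.trdeg ℂ K := by
    have := Cardinal.add_one_le_of_lt hcon
    rwa [one_add_one_eq_two] at this
  -- Were the degree at least two, the two coordinate functions, over which `K` is algebraic, would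
  -- be a transcendence basis; but they satisfy `P`.
  have hb := Algebra.IsAlgebraic.isTranscendenceBasis_of_le_trdeg_of_finite (R := ℂ) x (by simpa using h2)
  have hinj := hb.1
  rw [AlgebraicIndependent] at hinj
  have : P = 0 := hinj (by rw [map_zero, ← hφ]; exact (hker P).2 dvd_rfl)
  exact hP.ne_zero this

/-- A derivation of a ring that descends to a quotient domain gives a homomorphism from the field of
fractions of the quotient to its dual numbers. -/
theorem exists_dualNumber_lift {R A K : Type} [CommRing R] [CommRing A] [IsDomain A] [Field K]
    [Algebra A K] [IsFractionRing A K] (q : R →+* A) (hq : Function.Surjective q)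
    (d : R → R) (hd1 : d 1 = 0) (hd0 : d 0 = 0) (hadd : ∀ a b, d (a + b) = d a + d b)
    (hmul : ∀ a b, d (a * b) = a * d b + b * d a) (hqd : ∀ a, q a = 0 → q (d a) = 0) :
    ∃ Φ : K →+* TrivSqZeroExt K K, (∀ a, (Φ a).fst = a) ∧
      ∀ Q, (Φ (algebraMap A K (q Q))).snd = algebraMap A K (q (d Q)) := by
  -- The derivation is encoded as the ring homomorphism `Q ↦ Q + ε d Q`. Extending it to fractions
  -- is then the universal property of localization: a dual number is a unit when its first
  -- component is.
  let ψ : R →+* TrivSqZeroExt K K :=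
    { toFun := fun Q =>
        TrivSqZeroExt.inl (algebraMap A K (q Q)) + TrivSqZeroExt.inr (algebraMap A K (q (d Q)))
      map_one' := by ext <;> simp [hd1]
      map_zero' := by ext <;> simp [hd0]
      map_add' := fun a b => by ext <;> simp [hadd, Algebra.smul_def]
      map_mul' := fun a b => by
        ext
        · simp
        · simp only [TrivSqZeroExt.snd_mul, TrivSqZeroExt.fst_add, TrivSqZeroExt.snd_add,
            TrivSqZeroExt.fst_inl, TrivSqZeroExt.snd_inl, TrivSqZeroExt.fst_inr,
            TrivSqZeroExt.snd_inr, add_zero, zero_add, hmul, map_add, map_mul, smul_eq_mul,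
            MulOpposite.smul_eq_mul_unop, MulOpposite.unop_op]
          ring }
  have hψ1 : ∀ Q, (ψ Q).fst = algebraMap A K (q Q) := fun Q => by simp [ψ]
  have hψ2 : ∀ Q, (ψ Q).snd = algebraMap A K (q (d Q)) := fun Q => by
    change (TrivSqZeroExt.inl _ + TrivSqZeroExt.inr _ : TrivSqZeroExt K K).snd = _
    rw [TrivSqZeroExt.snd_add, TrivSqZeroExt.snd_inl, TrivSqZeroExt.snd_inr, zero_add]
  have hψI : ∀ a, q a = 0 → ψ a = 0 := by
    intro a ha
    ext
    · rw [hψ1, ha]; simp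
    · rw [hψ2, hqd a ha]; simp
  let ψ' : A →+* TrivSqZeroExt K K := RingHom.liftOfSurjective q hq ⟨ψ, fun a ha => hψI a ha⟩
  have hψ' : ∀ Q, ψ' (q Q) = ψ Q := fun Q =>
    RingHom.liftOfRightInverse_comp_apply q _ _ ⟨ψ, fun a ha => hψI a ha⟩ Q
  have hunit : ∀ y : nonZeroDivisors A, IsUnit (ψ' y) := by
    rintro ⟨y, hy⟩
    obtain ⟨Q, rfl⟩ := hq y
    rw [TrivSqZeroExt.isUnit_iff_isUnit_fst, isUnit_iff_ne_zero, hψ', hψ1]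
    simpa using nonZeroDivisors.ne_zero hy
  let Φ : K →+* TrivSqZeroExt K K := IsLocalization.lift (M := nonZeroDivisors A) hunit
  have hΦ : ∀ Q, Φ (algebraMap A K (q Q)) = ψ Q := by
    intro Q
    rw [← hψ']
    exact IsLocalization.lift_eq _ _
  refine ⟨Φ, ?_, ?_⟩
  · have : (TrivSqZeroExt.fstHom ℤ K K : TrivSqZeroExt K K →+* K).comp Φ = RingHom.id K := by
      apply IsLocalization.ringHom_ext (nonZeroDivisors A)
      ext1 y
      obtain ⟨Q, rfl⟩ := hq y
      simp [hΦ, hψ1]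
    exact fun a => congrArg (fun g : K →+* K => g a) this
  · intro Q
    rw [hΦ, hψ2]

/-- The function field of an irreducible plane curve, with the map to the dual numbers given by a
derivation that is tangent to the curve. -/
theorem exists_functionField {P : MvPolynomial (Fin 2) ℂ} (hP : Prime P)
    (d : Derivation ℂ (MvPolynomial (Fin 2) ℂ) (MvPolynomial (Fin 2) ℂ)) (hdP : P ∣ d P) :
    ∃ (K : Type) (_ : Field K) (_ : Algebra ℂ K) (φ : MvPolynomial (Fin 2) ℂ →ₐ[ℂ] K)
      (Φ : K →+* TrivSqZeroExt K K),
      (∀ Q, φ Q = 0 ↔ P ∣ Q) ∧ (∀ a : K, ∃ N M, φ M ≠ 0 ∧ a = φ N / φ M) ∧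
      (∀ a, (Φ a).fst = a) ∧ ∀ Q, (Φ (φ Q)).snd = φ (d Q) := by
  let I : Ideal (MvPolynomial (Fin 2) ℂ) := Ideal.span {P}
  have hI : I.IsPrime := (Ideal.span_singleton_prime hP.ne_zero).2 hP
  let φ : MvPolynomial (Fin 2) ℂ →ₐ[ℂ] FractionRing (MvPolynomial (Fin 2) ℂ ⧸ I) :=
    (IsScalarTower.toAlgHom ℂ (MvPolynomial (Fin 2) ℂ ⧸ I) _).comp (Ideal.Quotient.mkₐ ℂ I)
  have hmk : ∀ Q, Ideal.Quotient.mk I Q = 0 ↔ P ∣ Q := fun Q => by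
    rw [Ideal.Quotient.eq_zero_iff_mem, Ideal.mem_span_singleton]
  obtain ⟨Φ, h1, h2⟩ := exists_dualNumber_lift
    (K := FractionRing (MvPolynomial (Fin 2) ℂ ⧸ I)) (Ideal.Quotient.mk I)
    Ideal.Quotient.mk_surjective d (by simp) (by simp) (by simp) (by simp) (by
      intro a ha
      rw [hmk] at ha ⊢
      obtain ⟨b, rfl⟩ := ha
      rw [Derivation.leibniz, smul_eq_mul, smul_eq_mul]
      exact dvd_add (dvd_mul_right _ _) (hdP.mul_left _))
  have hφ : ∀ Q, φ Q = algebraMap _ (FractionRing (MvPolynomial (Fin 2) ℂ ⧸ I))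
    (Ideal.Quotient.mk I Q) := fun Q => rfl
  refine ⟨_, inferInstance, inferInstance, φ, Φ, ?_, ?_, h1, h2⟩
  · intro Q
    rw [hφ, FaithfulSMul.algebraMap_eq_zero_iff, hmk]
  · intro a
    obtain ⟨n, m, hm, rfl⟩ := IsFractionRing.div_surjective (A := MvPolynomial (Fin 2) ℂ ⧸ I) a
    obtain ⟨N, rfl⟩ := Ideal.Quotient.mk_surjective n
    obtain ⟨M, rfl⟩ := Ideal.Quotient.mk_surjective m
    refine ⟨N, M, ?_, rfl⟩
    rw [hφ]
    simpa using nonZeroDivisors.ne_zero hm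

/-- A rational function on an irreducible curve that is annihilated by a nontrivial vector field is
constant. -/
theorem exists_dvd_sub_C_mul {P N M : MvPolynomial (Fin 2) ℂ} (hP : Prime P)
    (d : Derivation ℂ (MvPolynomial (Fin 2) ℂ) (MvPolynomial (Fin 2) ℂ)) (hdP : P ∣ d P)
    (hd : ∃ j, ¬ P ∣ d (X j)) (hM : ¬ P ∣ M) (h : P ∣ d N * M - N * d M) :
    ∃ c : ℂ, P ∣ N - C c * M := by
  obtain ⟨K, _, _, φ, Φ, hker, hfrac, hfst, hsnd⟩ := exists_functionField hP d hdP
  have htr := trdeg_functionField_le_one hP K φ hker hfrac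
  have hM0 : φ M ≠ 0 := fun h0 => hM ((hker M).1 h0)
  set γ : K := φ N / φ M with hγ
  have hγM : γ * φ M = φ N := div_mul_cancel₀ _ hM0
  -- An element algebraic over the algebraically closed field `ℂ` is a constant.
  by_cases halg : IsAlgebraic ℂ γ
  · obtain ⟨c, hc⟩ : ∃ c : ℂ, algebraMap ℂ K c = γ := by
      have := (minpoly.mem_range_of_degree_eq_one ℂ γ
        (IsAlgClosed.degree_eq_one_of_irreducible ℂ (minpoly.irreducible halg.isIntegral)))
      exact this
    refine ⟨c, (hker _).1 ?_⟩
    have hC : φ (C c) = algebraMap ℂ K c := φ.commutes c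
    rw [map_sub, map_mul, hC, hc, hγM, sub_self]
  exfalso
  -- Otherwise `K` is algebraic over `F = ℂ(γ)`, hence separable and formally unramified. The
  -- derivation kills `F`, so `Φ` and `inl` are two `F`-algebra lifts of the identity of `K` to the
  -- dual numbers; they agree, the derivation is zero on `K`, and this contradicts `hd`.
  have hxi : AlgebraicIndependent ℂ (fun _ : Unit => γ) := by
    rw [algebraicIndependent_unique_type_iff]
    exact halg
  have hbasis := AlgebraicIndependent.isTranscendenceBasis_of_trdeg_le_of_finite hxi (by simpa using htr)
  have hFalg := hbasis.isAlgebraic_field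
  set F := IntermediateField.adjoin ℂ (Set.range fun _ : Unit => γ) with hF
  have hΦinl : ∀ a ∈ F, Φ a = TrivSqZeroExt.inl a := by
    have hfield : ∀ a, Φ a = TrivSqZeroExt.inl a ↔ (Φ a).snd = 0 := fun a =>
      ⟨fun h => by rw [h, TrivSqZeroExt.snd_inl], fun h => by ext <;> simp [hfst, h]⟩
    intro a ha
    induction ha using IntermediateField.adjoin_induction with
    | mem x hx =>
      obtain ⟨_, rfl⟩ := hx
      rw [hfield]
      have h1 := congrArg TrivSqZeroExt.snd (congrArg Φ hγM)
      rw [map_mul, TrivSqZeroExt.snd_mul, hsnd, hsnd, hfst, hfst] at h1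
      simp only [smul_eq_mul, MulOpposite.smul_eq_mul_unop, MulOpposite.unop_op] at h1
      have h2 : φ (d N) * φ M - φ N * φ (d M) = 0 := by
        rw [← map_mul, ← map_mul, ← map_sub, hker]; exact h
      have h3 : (Φ γ).snd * (φ M * φ M) = 0 := by
        linear_combination φ M * h1 + h2 - φ (d M) * hγM
      rcases mul_eq_zero.1 h3 with h4 | h4
      · exact h4
      · exact absurd h4 (mul_ne_zero hM0 hM0)
    | algebraMap x =>
      rw [hfield, ← φ.commutes, hsnd]
      simp
    | add x y _ _ hx hy => rw [map_add, hx, hy, TrivSqZeroExt.inl_add]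
    | mul x y _ _ hx hy => rw [map_mul, hx, hy, TrivSqZeroExt.inl_mul]
    | inv x _ hx =>
      rcases eq_or_ne x 0 with rfl | h0
      · simp
      · have h1 : Φ x⁻¹ * Φ x = 1 := by rw [← map_mul, inv_mul_cancel₀ h0, map_one]
        have h2 := congrArg TrivSqZeroExt.snd h1
        rw [TrivSqZeroExt.snd_mul, hx] at h2
        rw [hfield]
        simpa [h0] using h2
  let g₁ : K →ₐ[F] TrivSqZeroExt K K :=
    { Φ with commutes' := fun a => hΦinl a a.2 }
  let g₂ : K →ₐ[F] TrivSqZeroExt K K := TrivSqZeroExt.inlAlgHom F K K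
  have : Algebra.FormallyUnramified F K := Algebra.FormallyUnramified.of_isSeparable F K
  have hg : g₁ = g₂ := by
    refine Algebra.FormallyUnramified.ext (TrivSqZeroExt.kerIdeal K K)
      ⟨2, TrivSqZeroExt.kerIdeal_sq K K⟩ fun x => ?_
    rw [Ideal.Quotient.eq, TrivSqZeroExt.kerIdeal, RingHom.mem_ker, map_sub, sub_eq_zero]
    exact hfst x
  obtain ⟨j, hj⟩ := hd
  apply hj
  rw [← hker, ← hsnd]
  have : Φ (φ (X j)) = TrivSqZeroExt.inl (φ (X j)) := congrArg (fun g : K →ₐ[F] _ => g (φ (X j))) hg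
  rw [this, TrivSqZeroExt.snd_inl]

/-- If `a ≠ 0` and `x₀, x₁, …` are algebraically dependent elements of a domain, then some nonzero
polynomial in the `xᵢ` is a multiple of `a`. -/
theorem exists_aeval_eq_mul {n : ℕ} {A : Type} [CommRing A] [IsDomain A] [Algebra ℂ A]
    {a : A} {x : Fin n → A} (ha : a ≠ 0)
    (h : ¬ AlgebraicIndependent ℂ (Fin.cons a x : Fin (n + 1) → A)) :
    ∃ Φ : MvPolynomial (Fin n) ℂ, Φ ≠ 0 ∧ ∃ Ψ : MvPolynomial (Fin (n + 1)) ℂ,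
      aeval x Φ = a * aeval (Fin.cons a x : Fin (n + 1) → A) Ψ := by
  rw [algebraicIndependent_iff] at h
  push Not at h
  obtain ⟨R, hR0, hRne⟩ := h
  let e : Polynomial (MvPolynomial (Fin n) ℂ) →+* A :=
    Polynomial.eval₂RingHom (aeval x : MvPolynomial (Fin n) ℂ →ₐ[ℂ] A).toRingHom a
  have he : ∀ S, e (finSuccEquiv ℂ n S) = aeval (Fin.cons a x : Fin (n + 1) → A) S := by
    intro S
    have : (e.comp (finSuccEquiv ℂ n : MvPolynomial (Fin (n + 1)) ℂ →+* _)) =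
        (aeval (Fin.cons a x : Fin (n + 1) → A) : MvPolynomial (Fin (n + 1)) ℂ →ₐ[ℂ] A).toRingHom := by
      apply MvPolynomial.ringHom_ext
      · intro r
        simp [e, finSuccEquiv_apply]
      · intro i
        refine Fin.cases ?_ (fun i => ?_) i
        · simp [e, finSuccEquiv_X_zero]
        · simp [e, finSuccEquiv_X_succ]
    exact congrArg (fun g : MvPolynomial (Fin (n + 1)) ℂ →+* A => g S) this
  have hne : finSuccEquiv ℂ n R ≠ 0 := by simpa using hRne
  -- After division by the highest power of the variable that stands for `a`, the relation still
  -- holds because `a ≠ 0`, and its constant term is nonzero. This term is `Φ`.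
  obtain ⟨Q, hQ, hXQ⟩ := Polynomial.exists_eq_pow_rootMultiplicity_mul_and_not_dvd _ hne 0
  rw [map_zero, sub_zero] at hQ hXQ
  have heX : e Polynomial.X = a := by simp [e]
  have heQ : e Q = 0 := by
    have h1 := he R
    rw [hR0, hQ, map_mul, map_pow, heX] at h1
    exact (mul_eq_zero.1 h1).resolve_left (pow_ne_zero _ ha)
  refine ⟨Q.coeff 0, fun h0 => hXQ (Polynomial.X_dvd_iff.2 h0),
    (finSuccEquiv ℂ n).symm (-Q.divX), ?_⟩
  rw [← he, AlgEquiv.apply_symm_apply, map_neg]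
  have h2 := congrArg e (Polynomial.divX_mul_X_add Q)
  rw [heQ, map_add, map_mul, heX] at h2
  have h3 : e (Polynomial.C (Q.coeff 0)) = aeval x (Q.coeff 0) := by simp [e]
  rw [h3] at h2
  linear_combination h2

/-- A polynomial that does not vanish identically on an irreducible curve has a nonzero multiple on
the curve that depends on a single coordinate. -/
theorem exists_polynomial_dvd {P H : MvPolynomial (Fin 2) ℂ} (hP : Prime P) (hH : ¬ P ∣ H)
    (j : Fin 2) : ∃ D : Polynomial ℂ, D ≠ 0 ∧
      ∃ a b, Polynomial.aeval (X j : MvPolynomial (Fin 2) ℂ) D = a * P + b * H := by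
  obtain ⟨K, _, _, φ, -, hker, hfrac, -, -⟩ := exists_functionField hP 0 (by simp)
  have htr := trdeg_functionField_le_one hP K φ hker hfrac
  -- On the curve, `H` and `X j` are two elements of a field of transcendence degree at most one.
  have hnot : ¬ AlgebraicIndependent ℂ
      (Fin.cons (φ H) (fun _ : Fin 1 => φ (X j)) : Fin 2 → K) := by
    intro hind
    have := hind.cardinalMk_le_trdeg.trans htr
    norm_num at this
  obtain ⟨Φ, hΦ, Ψ, hΨ⟩ := exists_aeval_eq_mul (fun h0 => hH ((hker H).1 h0)) hnot
  have hmap : ∀ Q : MvPolynomial (Fin 1) ℂ, φ (Polynomial.aeval (X j : MvPolynomial (Fin 2) ℂ)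
      (uniqueAlgEquiv ℂ (Fin 1) Q)) = aeval (fun _ : Fin 1 => φ (X j)) Q := by
    intro Q
    have : (φ.comp (Polynomial.aeval (X j : MvPolynomial (Fin 2) ℂ))).comp
        (uniqueAlgEquiv ℂ (Fin 1) : MvPolynomial (Fin 1) ℂ →ₐ[ℂ] Polynomial ℂ) =
        aeval (fun _ : Fin 1 => φ (X j)) := by
      ext i
      simp
    exact congrArg (fun g : MvPolynomial (Fin 1) ℂ →ₐ[ℂ] K => g Q) this
  refine ⟨uniqueAlgEquiv ℂ (Fin 1) Φ, (map_ne_zero_iff _ (uniqueAlgEquiv ℂ (Fin 1)).injective).2 hΦ, ?_⟩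
  set S := Polynomial.aeval (X j : MvPolynomial (Fin 2) ℂ) (uniqueAlgEquiv ℂ (Fin 1) Φ)
  set b := aeval (Fin.cons H (fun _ : Fin 1 => X j) : Fin 2 → MvPolynomial (Fin 2) ℂ) Ψ
  have hb : φ b = aeval (Fin.cons (φ H) (fun _ : Fin 1 => φ (X j)) : Fin 2 → K) Ψ := by
    have h1 : (Fin.cons (φ H) (fun _ : Fin 1 => φ (X j)) : Fin 2 → K) =
        fun i => φ ((Fin.cons H (fun _ : Fin 1 => X j) : Fin 2 → MvPolynomial (Fin 2) ℂ) i) := by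
      funext i
      exact Fin.cases rfl (fun _ => rfl) i
    rw [h1]
    exact MvPolynomial.comp_aeval_apply _ φ Ψ
  have hdvd : P ∣ S - H * b := by
    rw [← hker, map_sub, map_mul, hmap, hΨ, hb, sub_self]
  obtain ⟨a, ha⟩ := hdvd
  exact ⟨a, b, by linear_combination ha⟩

/-- Two plane curves without common component meet in finitely many points. -/
theorem finite_common_zeros {P H : MvPolynomial (Fin 2) ℂ} (hP : Prime P) (hH : ¬ P ∣ H) :
    {x : Fin 2 → ℂ | eval x P = 0 ∧ eval x H = 0}.Finite := by
  choose D hD a b hab using exists_polynomial_dvd hP hH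
  refine (Set.Finite.pi' (fun j => (D j).roots.toFinset.finite_toSet)).subset ?_
  rintro x ⟨h1, h2⟩ j
  have := congrArg (eval x) (hab j)
  simp only [map_add, map_mul, h1, h2, mul_zero, add_zero] at this
  have h3 : eval x (Polynomial.aeval (X j : MvPolynomial (Fin 2) ℂ) (D j)) = (D j).eval (x j) := by
    have := Polynomial.aeval_algHom_apply (aeval x) (X j : MvPolynomial (Fin 2) ℂ) (D j)
    simpa [MvPolynomial.coe_aeval_eq_eval, Polynomial.coe_aeval_eq_eval] using this.symm
  rw [h3] at this
  simpa [hD j] using this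

theorem exists_eval_ne_zero {H : MvPolynomial (Fin 2) ℂ} (hH : H ≠ 0) :
    ∃ x : Fin 2 → ℂ, eval x H ≠ 0 := by
  by_contra hcon
  push Not at hcon
  exact hH (MvPolynomial.funext fun x => by simpa using hcon x)

/-- Three rational functions of two variables are algebraically dependent. -/
theorem not_algebraicIndependent_three {A : Type} [CommRing A] [IsDomain A]
    [Algebra (MvPolynomial (Fin 2) ℂ) A] [Algebra ℂ A]
    [IsScalarTower ℂ (MvPolynomial (Fin 2) ℂ) A] (D : MvPolynomial (Fin 2) ℂ) (hD : D ≠ 0)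
    [IsLocalization.Away D A] (x : Fin 3 → A) : ¬ AlgebraicIndependent ℂ x := by
  intro hx
  let s : Set A := Set.range fun i : Fin 2 => algebraMap (MvPolynomial (Fin 2) ℂ) A (X i)
  have hmem : ∀ Q, algebraMap (MvPolynomial (Fin 2) ℂ) A Q ∈ Algebra.adjoin ℂ s := by
    intro Q
    rw [Algebra.adjoin_range_eq_range_aeval]
    refine ⟨Q, ?_⟩
    have : aeval (fun i : Fin 2 => algebraMap (MvPolynomial (Fin 2) ℂ) A (X i)) =
        IsScalarTower.toAlgHom ℂ (MvPolynomial (Fin 2) ℂ) A := by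
      ext i; simp
    change aeval (fun i : Fin 2 => algebraMap (MvPolynomial (Fin 2) ℂ) A (X i)) Q = _
    rw [this]; rfl
  have hinj : Function.Injective (algebraMap (MvPolynomial (Fin 2) ℂ) A) :=
    IsLocalization.injective (M := Submonoid.powers D) A
      (powers_le_nonZeroDivisors_of_noZeroDivisors hD)
  have halg : Algebra.IsAlgebraic (Algebra.adjoin ℂ s) A := by
    constructor
    intro a
    obtain ⟨n, b, hb⟩ := IsLocalization.Away.surj D a
    let d : Algebra.adjoin ℂ s := ⟨_, hmem (D ^ n)⟩
    let r : Algebra.adjoin ℂ s := ⟨_, hmem b⟩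
    have hd : (d : A) ≠ 0 := by
      change algebraMap (MvPolynomial (Fin 2) ℂ) A (D ^ n) ≠ 0
      exact (map_ne_zero_iff _ hinj).2 (pow_ne_zero _ hD)
    refine ⟨Polynomial.C d * Polynomial.X - Polynomial.C r, fun h0 => hd ?_, ?_⟩
    · have := congrArg (fun p => ((p.coeff 1 : Algebra.adjoin ℂ s) : A)) h0
      simpa using this
    · have h1 : Algebra.algebraMap (R := Algebra.adjoin ℂ s) (A := A) d * a = algebraMap _ A r := by
        change algebraMap (MvPolynomial (Fin 2) ℂ) A (D ^ n) * a = algebraMap _ A b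
        rw [map_pow, mul_comm]; exact hb
      simp only [map_sub, map_mul, Polynomial.aeval_C, Polynomial.aeval_X, sub_eq_zero]
      exact h1
  have h1 := hx.cardinalMk_le_trdeg.trans (Algebra.IsAlgebraic.trdeg_le_cardinalMk ℂ s)
  have h2 : Cardinal.mk s ≤ Cardinal.mk (Fin 2) := Cardinal.mk_range_le
  have h3 := h1.trans h2
  simp only [Cardinal.mk_fin, Nat.cast_le] at h3
  omega

open Filter in
/-- The values of a rational map that are approached when a given rational function `N / M` tends to
zero lie on a curve. -/
theorem RatMap.exists_fiber_polynomial (f : RatMap) {N M : MvPolynomial (Fin 2) ℂ}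
    (hN : N ≠ 0) (hM : M ≠ 0) : ∃ Φ : MvPolynomial (Fin 2) ℂ, Φ ≠ 0 ∧
      ∀ {ι : Type} (l : Filter ι) [NeBot l] (p : ι → Fin 2 → ℂ) (t : Fin 2 → ℂ),
        (∀ᶠ n in l, eval (p n) M ≠ 0 ∧ ∀ i, eval (p n) (f.den i) ≠ 0) →
        Tendsto (fun n => eval (p n) N / eval (p n) M) l (𝓝 0) →
        Tendsto (fun n i => f.val i (p n)) l (𝓝 t) → eval t Φ = 0 := by
  -- Inverting `D` puts `N / M`, `f₁` and `f₂` into one `ℂ`-algebra that can be evaluated wherever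
  -- the denominators do not vanish.
  set D := M * (f.den 0 * f.den 1) with hDdef
  have hD : D ≠ 0 := mul_ne_zero hM (mul_ne_zero (f.den_ne_zero 0) (f.den_ne_zero 1))
  have hdom : IsDomain (Localization.Away D) :=
    IsLocalization.isDomain_localization (powers_le_nonZeroDivisors_of_noZeroDivisors hD)
  have hinj : Function.Injective (algebraMap (MvPolynomial (Fin 2) ℂ) (Localization.Away D)) :=
    IsLocalization.injective (M := Submonoid.powers D) _
      (powers_le_nonZeroDivisors_of_noZeroDivisors hD)
  have hdvd : ∀ Q, Q ∣ D → IsUnit (algebraMap _ (Localization.Away D) Q) := fun Q hQ =>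
    isUnit_of_dvd_unit (map_dvd _ hQ) (IsLocalization.Away.algebraMap_isUnit D)
  have hden : ∀ i, f.den i ∣ D := fun i => by
    fin_cases i
    · exact (dvd_mul_right _ _).mul_left _
    · exact (dvd_mul_left _ _).mul_left _
  obtain ⟨m, hm⟩ := hdvd M (dvd_mul_right _ _)
  choose q hq using fun i => hdvd (f.den i) (hden i)
  set a : Localization.Away D := algebraMap _ _ N * ↑m⁻¹ with ha
  set x : Fin 2 → Localization.Away D := fun i => algebraMap _ _ (f.num i) * ↑(q i)⁻¹ with hx
  have ha0 : a ≠ 0 := mul_ne_zero ((map_ne_zero_iff _ hinj).2 hN) (Units.ne_zero _)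
  -- The dependence takes the form `Φ(f₁, f₂) = (N / M) * Ψ(N / M, f₁, f₂)`. In the limit `N / M →
  -- 0` the right side tends to zero.
  obtain ⟨Φ, hΦ, Ψ, hΨ⟩ := exists_aeval_eq_mul (x := x) ha0
    (not_algebraicIndependent_three D hD _)
  refine ⟨Φ, hΦ, ?_⟩
  intro ι l _ p t hp hlim hft
  have hev : ∀ᶠ n in l, eval (fun i => f.val i (p n)) Φ =
      eval (p n) N / eval (p n) M *
        eval (Fin.cons (eval (p n) N / eval (p n) M) (fun i => f.val i (p n)) : Fin 3 → ℂ) Ψ := by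
    filter_upwards [hp] with n hn
    have hDn : IsUnit (eval (p n) D) := by
      rw [isUnit_iff_ne_zero, hDdef, map_mul, map_mul]
      exact mul_ne_zero hn.1 (mul_ne_zero (hn.2 0) (hn.2 1))
    let E : Localization.Away D →+* ℂ := IsLocalization.Away.lift D hDn
    have hE : ∀ Q, E (algebraMap _ _ Q) = eval (p n) Q := fun Q =>
      IsLocalization.Away.lift_eq D hDn Q
    have hEC : ∀ c : ℂ, E (algebraMap ℂ _ c) = c := fun c => by
      rw [IsScalarTower.algebraMap_apply ℂ (MvPolynomial (Fin 2) ℂ), hE]; simp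
    let E' : Localization.Away D →ₐ[ℂ] ℂ := { E with commutes' := hEC }
    have hE' : ∀ Q, E' (algebraMap _ _ Q) = eval (p n) Q := hE
    have hEa : E' a = eval (p n) N / eval (p n) M := by
      rw [eq_div_iff hn.1, ← hE' M, ← map_mul, ha, mul_assoc, ← hm, Units.inv_mul, mul_one, hE']
    have hEx : ∀ i, E' (x i) = f.val i (p n) := by
      intro i
      rw [RatMap.val, eq_div_iff (hn.2 i), ← hE' (f.den i), ← map_mul, hx]
      simp only []
      rw [mul_assoc, ← hq, Units.inv_mul, mul_one, hE']
    have h1 := congrArg E' hΨ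
    rw [map_mul, hEa, MvPolynomial.comp_aeval_apply, MvPolynomial.comp_aeval_apply] at h1
    have h2 : (fun i => E' ((Fin.cons a x : Fin 3 → Localization.Away D) i)) =
        (Fin.cons (eval (p n) N / eval (p n) M) (fun i => f.val i (p n)) : Fin 3 → ℂ) := by
      funext i
      refine Fin.cases ?_ (fun i => ?_) i
      · simp [hEa]
      · simp [hEx]
    rw [h2] at h1
    simp only [hEx] at h1
    simpa [MvPolynomial.coe_aeval_eq_eval] using h1
  have h1 : Tendsto (fun n => eval (fun i => f.val i (p n)) Φ) l (𝓝 (eval t Φ)) :=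
    ((MvPolynomial.continuous_eval Φ).tendsto t).comp hft
  have h2 : Tendsto (fun n => (Fin.cons (eval (p n) N / eval (p n) M)
      (fun i => f.val i (p n)) : Fin 3 → ℂ)) l (𝓝 (Fin.cons 0 t : Fin 3 → ℂ)) := by
    rw [tendsto_pi_nhds] at hft ⊢
    intro i
    refine Fin.cases ?_ (fun i => ?_) i
    · simpa using hlim
    · simpa using hft i
  have h3 := hlim.mul (((MvPolynomial.continuous_eval Ψ).tendsto _).comp h2)
  rw [zero_mul] at h3
  exact tendsto_nhds_unique (h1.congr' hev) h3

end ToricSurface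

/-! ### The toric condition, and contraction of the curves of zeros and poles -/

namespace ToricSurface

open MvPolynomial

/-- The Euler derivation `x_j ∂/∂x_j`. -/
noncomputable def euler (j : Fin 2) :
    Derivation ℂ (MvPolynomial (Fin 2) ℂ) (MvPolynomial (Fin 2) ℂ) :=
  (X j : MvPolynomial (Fin 2) ℂ) • pderiv j

theorem euler_apply (j : Fin 2) (P : MvPolynomial (Fin 2) ℂ) : euler j P = X j * pderiv j P := rfl

theorem euler_monomial (j : Fin 2) (m : Fin 2 →₀ ℕ) (c : ℂ) :
    euler j (monomial m c) = monomial m ((m j : ℂ) * c) := by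
  rw [euler_apply, X_mul_pderiv_monomial, smul_monomial, nsmul_eq_mul]

theorem coeff_euler (j : Fin 2) (P : MvPolynomial (Fin 2) ℂ) (m : Fin 2 →₀ ℕ) :
    coeff m (euler j P) = m j * coeff m P := by
  induction P using MvPolynomial.induction_on' with
  | monomial u a =>
    rw [euler_monomial, coeff_monomial, coeff_monomial]
    split_ifs with h
    · rw [h]
    · simp
  | add p q hp hq => rw [map_add, coeff_add, hp, hq, coeff_add, mul_add]

theorem eval_euler (j : Fin 2) (P : MvPolynomial (Fin 2) ℂ) (x : Fin 2 → ℂ) :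
    eval x (euler j P) = ∑ m ∈ P.support, (m j : ℂ) * (coeff m P * ∏ i, x i ^ m i) := by
  rw [eval_eq']
  rw [Finset.sum_subset (s₂ := P.support)]
  · exact Finset.sum_congr rfl fun m _ => by rw [coeff_euler, mul_assoc]
  · intro m hm
    rw [mem_support_iff, coeff_euler] at hm
    exact mem_support_iff.2 (right_ne_zero_of_mul hm)
  · intro m _ hm
    rw [notMem_support_iff.1 hm, zero_mul]

/-- A polynomial is differentiable, with the derivative given by its formal derivatives. -/
theorem hasStrictFDerivAt_eval (P : MvPolynomial (Fin 2) ℂ) (x : Fin 2 → ℂ) :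
    HasStrictFDerivAt (fun y => eval y P)
      (∑ j, eval x (pderiv j P) • ContinuousLinearMap.proj (R := ℂ) (φ := fun _ : Fin 2 => ℂ) j) x := by
  induction P using MvPolynomial.induction_on with
  | C a =>
    simp only [eval_C]
    refine (hasStrictFDerivAt_const (𝕜 := ℂ) a x).congr_fderiv ?_
    ext v
    simp
  | add p q hp hq =>
    simp only [map_add]
    refine (hp.add hq).congr_fderiv ?_
    rw [← Finset.sum_add_distrib]
    exact Finset.sum_congr rfl fun j _ => (add_smul _ _ _).symm
  | mul_X p i hp =>
    have h1 : HasStrictFDerivAt (fun y : Fin 2 → ℂ => y i)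
        (ContinuousLinearMap.proj (R := ℂ) (φ := fun _ : Fin 2 => ℂ) i) x :=
      (ContinuousLinearMap.proj (R := ℂ) (φ := fun _ : Fin 2 => ℂ) i).hasStrictFDerivAt
    have h2 := hp.mul h1
    simp only [map_mul, eval_X]
    refine h2.congr_fderiv ?_
    ext v
    simp [Derivation.leibniz, pderiv_X, Fin.sum_univ_two]
    fin_cases i <;> simp <;> ring

theorem hasDerivAt_eval_update (P : MvPolynomial (Fin 2) ℂ) (x : Fin 2 → ℂ) (j : Fin 2) :
    HasDerivAt (fun t => eval (Function.update x j t) P) (eval x (pderiv j P)) (x j) := by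
  have h1 := (hasStrictFDerivAt_eval P x).hasFDerivAt
  have h2 := hasDerivAt_update x j (x j)
  have h3 : HasFDerivAt (fun y => eval y P)
      (∑ j, eval x (pderiv j P) • ContinuousLinearMap.proj (R := ℂ) (φ := fun _ : Fin 2 => ℂ) j)
      (Function.update x j (x j)) := by rwa [Function.update_eq_self]
  have h4 := h3.comp_hasDerivAt (x j) h2
  refine h4.congr_deriv ?_
  fin_cases j <;> simp [Fin.sum_univ_two]

/-- The numerator of the logarithmic derivative of `fᵢ` along `x_j ∂/∂x_j`. -/
noncomputable def RatMap.wron (f : RatMap) (j i : Fin 2) : MvPolynomial (Fin 2) ℂ :=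
  euler j (f.num i) * f.den i - f.num i * euler j (f.den i)

theorem RatMap.hasDerivAt_val (f : RatMap) (x : Fin 2 → ℂ) (i j : Fin 2)
    (hx : eval x (f.den i) ≠ 0) :
    HasDerivAt (fun t => f.val i (Function.update x j t))
      ((eval x (pderiv j (f.num i)) * eval x (f.den i) -
        eval x (f.num i) * eval x (pderiv j (f.den i))) / eval x (f.den i) ^ 2) (x j) := by
  have h := (hasDerivAt_eval_update (f.num i) x j).div (hasDerivAt_eval_update (f.den i) x j)
    (by simpa using hx)
  simp only [Function.update_eq_self] at h
  exact h

/-- The toric condition as an identity between polynomials. -/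
theorem RatMap.IsToric.exists_identity {f : RatMap} (hf : f.IsToric) : ∃ ρ : ℂ, ρ ≠ 0 ∧
    f.wron 0 0 * f.wron 1 1 - f.wron 1 0 * f.wron 0 1 =
      C ρ * (f.num 0 * f.den 0 * (f.num 1 * f.den 1)) := by
  obtain ⟨ρ, hρ, h⟩ := hf
  refine ⟨ρ, hρ, ?_⟩
  have hne : (X 0 * X 1 * (f.num 0 * f.den 0 * (f.num 1 * f.den 1)) : MvPolynomial (Fin 2) ℂ) ≠ 0 :=
    mul_ne_zero (mul_ne_zero (X_ne_zero _) (X_ne_zero _))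
      (mul_ne_zero (mul_ne_zero (f.num_ne_zero 0) (f.den_ne_zero 0))
        (mul_ne_zero (f.num_ne_zero 1) (f.den_ne_zero 1)))
  -- Multiplication by the product of the coordinates, numerators and denominators makes the
  -- identity trivial at the points where the toric condition says nothing.
  refine mul_left_cancel₀ hne (MvPolynomial.funext fun x => ?_)
  by_cases hx : eval x (X 0 * X 1 * (f.num 0 * f.den 0 * (f.num 1 * f.den 1)) :
      MvPolynomial (Fin 2) ℂ) = 0
  · rw [map_mul, map_mul _ (X 0 * X 1 * (f.num 0 * f.den 0 * (f.num 1 * f.den 1))), hx]; simp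
  have hx' := hx
  simp only [map_mul, eval_X, mul_ne_zero_iff] at hx'
  obtain ⟨⟨h0, h1⟩, ⟨hn0, hd0⟩, hn1, hd1⟩ := hx'
  have hdom : (fun i => if hi : x i = 0 then 1 else Units.mk0 (x i) hi : Torus) ∈ f.dom := by
    have : (fun j => (((fun i => if hi : x i = 0 then 1 else Units.mk0 (x i) hi : Torus) j : ℂˣ) : ℂ))
        = x := by
      funext j; fin_cases j <;> simp [h0, h1]
    intro i
    rw [this]
    fin_cases i
    · exact ⟨hn0, hd0⟩
    · exact ⟨hn1, hd1⟩
  have h2 := h _ hdom x (fun j => by fin_cases j <;> simp [h0, h1])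
  rw [Matrix.det_fin_two] at h2
  simp only [Matrix.of_apply] at h2
  rw [(f.hasDerivAt_val x 0 0 hd0).deriv, (f.hasDerivAt_val x 0 1 hd0).deriv,
    (f.hasDerivAt_val x 1 0 hd1).deriv, (f.hasDerivAt_val x 1 1 hd1).deriv] at h2
  simp only [RatMap.val] at h2
  field_simp at h2
  simp only [RatMap.wron, euler_apply, map_mul, map_sub, eval_X, eval_C]
  linear_combination (x 0 * x 1 * (eval x (f.num 0)) * (eval x (f.den 0)) *
    (eval x (f.num 1)) * (eval x (f.den 1))) * h2

/-- Here `r` is the gcd of the coordinates, and Bézout completes the primitive vector to a basis.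
Applied to a vector of orders of `f₁`, `f₂`, it produces the ray and the multiplicity. -/
theorem exists_specialLinear_of_ne_zero {a : Fin 2 → ℤ} (ha : a ≠ 0) :
    ∃ (B : Matrix.SpecialLinearGroup (Fin 2) ℤ) (r : ℕ), 0 < r ∧ ∀ i, a i = r * B.1 i 0 := by
  have hg : 0 < Int.gcd (a 0) (a 1) := by
    rw [Int.gcd_pos_iff]
    by_contra h
    push Not at h
    exact ha (funext fun i => by fin_cases i; exacts [h.1, h.2])
  obtain ⟨x, y, hc, hx, hy⟩ := Int.exists_gcd_one hg
  obtain ⟨s, t, hst⟩ := Int.isCoprime_iff_gcd_eq_one.2 hc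
  refine ⟨⟨!![x, -t; y, s], ?_⟩, _, hg, ?_⟩
  · rw [Matrix.det_fin_two]; simp; linarith
  · intro i
    fin_cases i
    · simp; linarith
    · simp; linarith

/-- The Hamiltonian vector field of `P` for the Poisson structure dual to `η`. -/
noncomputable def hamiltonian (P : MvPolynomial (Fin 2) ℂ) :
    Derivation ℂ (MvPolynomial (Fin 2) ℂ) (MvPolynomial (Fin 2) ℂ) :=
  euler 0 P • euler 1 - euler 1 P • euler 0

theorem hamiltonian_apply (P Q : MvPolynomial (Fin 2) ℂ) :
    hamiltonian P Q = euler 0 P * euler 1 Q - euler 1 P * euler 0 Q := rfl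

/-- The Euler derivation does not raise the total degree, so the quotient is a constant, and
comparison of coefficients identifies it with the exponent of every monomial. -/
theorem exists_eq_C_mul_of_dvd_euler {P : MvPolynomial (Fin 2) ℂ} (hP : P ≠ 0) {j : Fin 2}
    (h : P ∣ euler j P) : ∃ κ : ℂ, ∀ m ∈ P.support, (m j : ℂ) = κ := by
  obtain ⟨Q, hQ⟩ := h
  have hsupp : (euler j P).support ⊆ P.support := by
    intro m hm
    rw [mem_support_iff, coeff_euler] at hm
    exact mem_support_iff.2 (right_ne_zero_of_mul hm)
  have hdeg : (euler j P).totalDegree ≤ P.totalDegree := Finset.sup_mono hsupp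
  have hQdeg : Q.totalDegree = 0 := by
    rcases eq_or_ne Q 0 with rfl | hQ0
    · simp
    rw [hQ, totalDegree_mul_of_isDomain hP hQ0] at hdeg
    omega
  rw [totalDegree_eq_zero_iff_eq_C] at hQdeg
  refine ⟨coeff 0 Q, fun m hm => ?_⟩
  have h1 := congrArg (coeff m) hQ
  rw [coeff_euler, hQdeg, mul_comm P, coeff_C_mul] at h1
  exact mul_right_cancel₀ (mem_support_iff.1 hm) h1

/-- If the tangent field `hamiltonian P` vanished along the curve, `P` would divide both its Euler
derivatives. It would then be a single monomial, hence a unit or a prime that divides a coordinate.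
-/
theorem exists_not_dvd_hamiltonian {P : MvPolynomial (Fin 2) ℂ} (hP : Prime P)
    (hX : ∀ j, ¬ P ∣ X j) : ∃ j, ¬ P ∣ hamiltonian P (X j) := by
  by_contra hcon
  push Not at hcon
  have hdvd : ∀ j, P ∣ euler j P := by
    intro j
    fin_cases j
    · have := hcon 1
      rw [hamiltonian_apply, euler_apply 1 (X 1), euler_apply 0 (X 1)] at this
      simp only [pderiv_X_self, mul_one] at this
      rw [pderiv_X_of_ne (by decide)] at this
      simp only [mul_zero, sub_zero] at this
      exact (hP.dvd_or_dvd this).resolve_right (hX 1)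
    · have := hcon 0
      rw [hamiltonian_apply, euler_apply 1 (X 0), euler_apply 0 (X 0)] at this
      simp only [pderiv_X_self, mul_one] at this
      rw [pderiv_X_of_ne (by decide)] at this
      simp only [mul_zero, zero_sub, dvd_neg] at this
      exact (hP.dvd_or_dvd this).resolve_right (hX 0)
  choose κ hκ using fun j => exists_eq_C_mul_of_dvd_euler hP.ne_zero (hdvd j)
  obtain ⟨m, hm⟩ := support_nonempty.2 hP.ne_zero
  have hmon : P = monomial m (coeff m P) := by
    have h1 : P.support = {m} := by
      refine Finset.eq_singleton_iff_unique_mem.2 ⟨hm, fun m' hm' => ?_⟩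
      ext j
      exact_mod_cast (hκ j m' hm').trans (hκ j m hm).symm
    conv_lhs => rw [P.as_sum, h1, Finset.sum_singleton]
  rcases eq_or_ne m 0 with rfl | hm0
  · refine hP.not_isUnit ?_
    rw [hmon]
    exact (isUnit_iff_ne_zero.2 (mem_support_iff.1 hm)).map C
  · have hdvdP : P ∣ ∏ i, (X i : MvPolynomial (Fin 2) ℂ) ^ m i := by
      have h2 : (∏ i, (X i : MvPolynomial (Fin 2) ℂ) ^ m i) = C (coeff m P)⁻¹ * P := by
        conv_rhs => rw [hmon]
        rw [C_mul_monomial]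
        simp only [coeff_monomial, if_true]
        rw [inv_mul_cancel₀ (mem_support_iff.1 hm), monomial_eq, C_1, one_mul,
          Finsupp.prod_fintype _ _ (by simp)]
      rw [h2]
      exact dvd_mul_left _ _
    obtain ⟨i, -, hi⟩ := (hP.dvd_finsetProd_iff _).1 hdvdP
    exact hX i (hP.dvd_of_dvd_pow hi)

/-- The extra factor `P` avoids the exponent `n - 1`, so that `n = 0` is no exception. -/
theorem derivation_pow_mul (d : Derivation ℂ (MvPolynomial (Fin 2) ℂ) (MvPolynomial (Fin 2) ℂ))
    (P : MvPolynomial (Fin 2) ℂ) (n : ℕ) : P * d (P ^ n) = (n : MvPolynomial (Fin 2) ℂ) * P ^ n * d P := by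
  rw [Derivation.leibniz_pow]
  rcases n with _ | n
  · simp
  · simp only [Nat.add_sub_cancel, smul_eq_mul, nsmul_eq_mul]
    ring

/-- The behaviour of `f` along an irreducible curve `P = 0` of `𝕋` on which some `fᵢ` has a zero or a
pole: with `fᵢ = P ^ (αᵢ - βᵢ) * Gᵢ / Hᵢ`, the vector `α - β` is a positive multiple of a primitive
vector `v`, and the character that is orthogonal to `v` has a constant value on the image. -/
structure RatMap.Contraction (f : RatMap) (P : MvPolynomial (Fin 2) ℂ) where
  B : Matrix.SpecialLinearGroup (Fin 2) ℤ
  r : ℕ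
  c : ℂˣ
  α : Fin 2 → ℕ
  β : Fin 2 → ℕ
  G : Fin 2 → MvPolynomial (Fin 2) ℂ
  H : Fin 2 → MvPolynomial (Fin 2) ℂ
  r_pos : 0 < r
  num_eq : ∀ i, f.num i = P ^ α i * G i
  den_eq : ∀ i, f.den i = P ^ β i * H i
  not_dvd_G : ∀ i, ¬ P ∣ G i
  not_dvd_H : ∀ i, ¬ P ∣ H i
  ord_eq : ∀ i, (α i : ℤ) - β i = r * B.1 i 0
  const : ∀ x, eval x P = 0 → (∀ i, eval x (G i) ≠ 0) → (∀ i, eval x (H i) ≠ 0) →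
    (eval x (G 0) / eval x (H 0)) ^ (-B.1 1 0) * (eval x (G 1) / eval x (H 1)) ^ B.1 0 0 = c

/-- One of `m.toNat` and `(-m).toNat` is zero; writing both turns a character evaluated at quotients
into one quotient of polynomials. -/
theorem zpow_div_eq_pow_mul_pow {g h : ℂ} (hg : g ≠ 0) (hh : h ≠ 0) (m : ℤ) :
    (g / h) ^ m = (g ^ m.toNat * h ^ (-m).toNat) / (g ^ (-m).toNat * h ^ m.toNat) := by
  have hm : m = (m.toNat : ℤ) - ((-m).toNat : ℤ) := (Int.toNat_sub_toNat_neg m).symm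
  rw [eq_div_iff (mul_ne_zero (pow_ne_zero _ hg) (pow_ne_zero _ hh))]
  generalize m.toNat = a at hm ⊢
  generalize (-m).toNat = b at hm ⊢
  rw [hm, zpow_sub₀ (div_ne_zero hg hh), zpow_natCast, zpow_natCast, div_pow, div_pow]
  field_simp

/-- This is a residue computation. Since `dlog fᵢ = (αᵢ - βᵢ) dlog P + dlog (Gᵢ / Hᵢ)`, the residue
of `dlog f₁ ∧ dlog f₂` along `P = 0` is the displayed combination, up to unit factors, and it
vanishes on the curve because `η` has no pole there. Differentiation by `hamiltonian P` is the wedge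
product with `dP`. -/
theorem RatMap.IsToric.dvd_wronskian {f : RatMap} (hf : f.IsToric) {P : MvPolynomial (Fin 2) ℂ}
    (hP : Prime P) {α β : Fin 2 → ℕ} {G H : Fin 2 → MvPolynomial (Fin 2) ℂ}
    (hα : ∀ i, f.num i = P ^ α i * G i) (hβ : ∀ i, f.den i = P ^ β i * H i) :
    P ∣ (α 0 - β 0 : MvPolynomial (Fin 2) ℂ) * (G 0 * H 0) *
        (hamiltonian P (G 1) * H 1 - G 1 * hamiltonian P (H 1)) -
      (α 1 - β 1 : MvPolynomial (Fin 2) ℂ) * (G 1 * H 1) *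
        (hamiltonian P (G 0) * H 0 - G 0 * hamiltonian P (H 0)) := by
  obtain ⟨ρ, -, hid⟩ := hf.exists_identity
  have hW : ∀ j i, P * f.wron j i = P ^ (α i + β i) *
      ((α i - β i : MvPolynomial (Fin 2) ℂ) * euler j P * (G i * H i) +
        P * (euler j (G i) * H i - G i * euler j (H i))) := by
    intro j i
    have h1 := derivation_pow_mul (euler j) P (α i)
    have h2 := derivation_pow_mul (euler j) P (β i)
    rw [RatMap.wron, hα, hβ, Derivation.leibniz, Derivation.leibniz]
    simp only [smul_eq_mul]
    rw [pow_add]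
    linear_combination (G i * P ^ β i * H i) * h1 - (P ^ α i * G i * H i) * h2
  -- In the determinant the terms with two factors `euler j P` cancel, so a further power of `P` can
  -- be removed.
  have hne : P * P ^ (α 0 + β 0 + (α 1 + β 1)) ≠ 0 :=
    mul_ne_zero hP.ne_zero (pow_ne_zero _ hP.ne_zero)
  refine ⟨C ρ * (G 0 * H 0 * (G 1 * H 1)) -
    ((euler 0 (G 0) * H 0 - G 0 * euler 0 (H 0)) * (euler 1 (G 1) * H 1 - G 1 * euler 1 (H 1)) -
      (euler 1 (G 0) * H 0 - G 0 * euler 1 (H 0)) * (euler 0 (G 1) * H 1 - G 1 * euler 0 (H 1))),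
    mul_left_cancel₀ hne ?_⟩
  have e1 : P * f.wron 0 0 * (P * f.wron 1 1) - P * f.wron 1 0 * (P * f.wron 0 1) =
      P ^ 2 * (C ρ * (P ^ α 0 * G 0 * (P ^ β 0 * H 0) * (P ^ α 1 * G 1 * (P ^ β 1 * H 1)))) := by
    rw [← hα, ← hβ, ← hα, ← hβ, ← hid]; ring
  rw [hW, hW, hW, hW] at e1
  simp only [hamiltonian_apply]
  rw [pow_add, pow_add, pow_add]
  rw [pow_add, pow_add] at e1
  linear_combination e1

/-- The vanishing residue says that the character of `(Gᵢ / Hᵢ)` orthogonal to the vector of orders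
has zero derivative along the curve, so it is constant there by `exists_dvd_sub_C_mul`. -/
theorem RatMap.IsToric.exists_contraction {f : RatMap} (hf : f.IsToric)
    {P : MvPolynomial (Fin 2) ℂ} (hP : Prime P) (hX : ∀ j, ¬ P ∣ X j)
    (hdvd : ∃ i, P ∣ f.num i ∨ P ∣ f.den i) : Nonempty (f.Contraction P) := by
  have hfin : ∀ Q, Q ≠ 0 → ∃ (n : ℕ) (R : MvPolynomial (Fin 2) ℂ), Q = P ^ n * R ∧ ¬ P ∣ R := fun Q hQ =>
    ⟨_, (FiniteMultiplicity.of_not_isUnit hP.not_isUnit hQ).exists_eq_pow_mul_and_not_dvd⟩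
  choose α G hα hG using fun i => hfin _ (f.num_ne_zero i)
  choose β H hβ hH using fun i => hfin _ (f.den_ne_zero i)
  -- Equal nonzero exponents would make `P` a common factor of a numerator and denominator in lowest
  -- terms.
  have ha : (fun i => (α i : ℤ) - β i) ≠ 0 := by
    obtain ⟨i, hi⟩ := hdvd
    intro h0
    have h1 : α i = β i := by
      have := congrFun h0 i
      simp only [Pi.zero_apply] at this
      omega
    have hpos : α i ≠ 0 := by
      intro h2
      rcases hi with hi | hi
      · rw [hα, h2, pow_zero, one_mul] at hi; exact hG i hi
      · rw [hβ, ← h1, h2, pow_zero, one_mul] at hi; exact hH i hi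
    refine hP.not_isUnit (f.isRelPrime i ?_ ?_)
    · rw [hα]; exact (dvd_pow_self P hpos).mul_right _
    · rw [hβ, ← h1]; exact (dvd_pow_self P hpos).mul_right _
  obtain ⟨B, r, hr, hB⟩ := exists_specialLinear_of_ne_zero ha
  -- The exponent `(m₀, m₁)` generates the characters orthogonal to `v`, so the powers of `P` cancel
  -- in it. With exponents split into positive and negative parts, its value is `N / M`.
  set m₀ : ℤ := -B.1 1 0
  set m₁ : ℤ := B.1 0 0
  set a₀ := m₀.toNat
  set b₀ := (-m₀).toNat
  set a₁ := m₁.toNat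
  set b₁ := (-m₁).toNat
  have hm₀ : m₀ = (a₀ : ℤ) - b₀ := (Int.toNat_sub_toNat_neg m₀).symm
  have hm₁ : m₁ = (a₁ : ℤ) - b₁ := (Int.toNat_sub_toNat_neg m₁).symm
  set N := G 0 ^ a₀ * H 0 ^ b₀ * (G 1 ^ a₁ * H 1 ^ b₁) with hN
  set M := G 0 ^ b₀ * H 0 ^ a₀ * (G 1 ^ b₁ * H 1 ^ a₁) with hM
  have hpow : ∀ Q : MvPolynomial (Fin 2) ℂ, ¬ P ∣ Q → ∀ n, ¬ P ∣ Q ^ n := fun Q hQ n h =>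
    hQ (hP.dvd_of_dvd_pow h)
  have hmul : ∀ Q R : MvPolynomial (Fin 2) ℂ, ¬ P ∣ Q → ¬ P ∣ R → ¬ P ∣ Q * R := fun Q R hQ hR h =>
    (hP.dvd_or_dvd h).elim hQ hR
  have hNP : ¬ P ∣ N := hmul _ _ (hmul _ _ (hpow _ (hG 0) _) (hpow _ (hH 0) _))
    (hmul _ _ (hpow _ (hG 1) _) (hpow _ (hH 1) _))
  have hMP : ¬ P ∣ M := hmul _ _ (hmul _ _ (hpow _ (hG 0) _) (hpow _ (hH 0) _))
    (hmul _ _ (hpow _ (hG 1) _) (hpow _ (hH 1) _))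
  set d := hamiltonian P with hd
  have hdP : P ∣ d P := by
    rw [hd, hamiltonian_apply, mul_comm, sub_self]; exact dvd_zero _
  have hGH : ¬ P ∣ (r : MvPolynomial (Fin 2) ℂ) * (G 0 * H 0 * (G 1 * H 1)) := by
    refine hmul _ _ ?_ (hmul _ _ (hmul _ _ (hG 0) (hH 0)) (hmul _ _ (hG 1) (hH 1)))
    intro h
    refine hP.not_isUnit (isUnit_of_dvd_unit h ?_)
    rw [← map_natCast (C : ℂ →+* MvPolynomial (Fin 2) ℂ)]
    exact (isUnit_iff_ne_zero.2 (Nat.cast_ne_zero.2 hr.ne')).map C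
  have hkey : P ∣ d N * M - N * d M := by
    have h1 := hf.dvd_wronskian hP hα hβ
    refine (hP.dvd_or_dvd (?_ : P ∣ ((r : MvPolynomial (Fin 2) ℂ) * (G 0 * H 0 * (G 1 * H 1))) *
      (d N * M - N * d M))).resolve_left hGH
    have e0 : (α 0 - β 0 : MvPolynomial (Fin 2) ℂ) = r * (a₁ - b₁) := by
      have := hB 0
      change (α 0 : ℤ) - β 0 = r * m₁ at this
      rw [hm₁] at this
      exact_mod_cast congrArg (fun n : ℤ => (n : MvPolynomial (Fin 2) ℂ)) this
    have e1 : (α 1 - β 1 : MvPolynomial (Fin 2) ℂ) = -(r * (a₀ - b₀)) := by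
      have := hB 1
      have h2 : (α 1 : ℤ) - β 1 = -(r * m₀) := by rw [this]; simp [m₀]
      rw [hm₀] at h2
      exact_mod_cast congrArg (fun n : ℤ => (n : MvPolynomial (Fin 2) ℂ)) h2
    rw [e0, e1] at h1
    -- The residue equals `r * (G 0 * H 0 * (G 1 * H 1))` times the logarithmic derivative of `N /
    -- M`.
    refine (h1.mul_left (N * M)).trans (dvd_of_eq ?_)
    rw [hN, hM]
    simp only [Derivation.leibniz, smul_eq_mul]
    have g0 := derivation_pow_mul d (G 0)
    have g1 := derivation_pow_mul d (G 1)
    have k0 := derivation_pow_mul d (H 0)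
    have k1 := derivation_pow_mul d (H 1)
    clear_value a₀ b₀ a₁ b₁
    linear_combination
      -(r * H 0 * G 1 * H 1 * (H 0 ^ b₀ * (G 1 ^ a₁ * H 1 ^ b₁)) *
          (G 0 ^ b₀ * H 0 ^ a₀ * (G 1 ^ b₁ * H 1 ^ a₁))) * g0 a₀
      - (r * G 0 * G 1 * H 1 * (G 0 ^ a₀ * (G 1 ^ a₁ * H 1 ^ b₁)) *
          (G 0 ^ b₀ * H 0 ^ a₀ * (G 1 ^ b₁ * H 1 ^ a₁))) * k0 b₀
      - (r * G 0 * H 0 * H 1 * (G 0 ^ a₀ * H 0 ^ b₀ * H 1 ^ b₁) *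
          (G 0 ^ b₀ * H 0 ^ a₀ * (G 1 ^ b₁ * H 1 ^ a₁))) * g1 a₁
      - (r * G 0 * H 0 * G 1 * (G 0 ^ a₀ * H 0 ^ b₀ * G 1 ^ a₁) *
          (G 0 ^ b₀ * H 0 ^ a₀ * (G 1 ^ b₁ * H 1 ^ a₁))) * k1 b₁
      + (r * H 0 * G 1 * H 1 * (H 0 ^ a₀ * (G 1 ^ b₁ * H 1 ^ a₁)) *
          (G 0 ^ a₀ * H 0 ^ b₀ * (G 1 ^ a₁ * H 1 ^ b₁))) * g0 b₀
      + (r * G 0 * G 1 * H 1 * (G 0 ^ b₀ * (G 1 ^ b₁ * H 1 ^ a₁)) *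
          (G 0 ^ a₀ * H 0 ^ b₀ * (G 1 ^ a₁ * H 1 ^ b₁))) * k0 a₀
      + (r * G 0 * H 0 * H 1 * (G 0 ^ b₀ * H 0 ^ a₀ * H 1 ^ a₁) *
          (G 0 ^ a₀ * H 0 ^ b₀ * (G 1 ^ a₁ * H 1 ^ b₁))) * g1 b₁
      + (r * G 0 * H 0 * G 1 * (G 0 ^ b₀ * H 0 ^ a₀ * G 1 ^ b₁) *
          (G 0 ^ a₀ * H 0 ^ b₀ * (G 1 ^ a₁ * H 1 ^ b₁))) * k1 a₁
  obtain ⟨c, hc⟩ := exists_dvd_sub_C_mul hP d hdP (exists_not_dvd_hamiltonian hP hX) hMP hkey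
  have hc0 : c ≠ 0 := by
    rintro rfl
    rw [map_zero, zero_mul, sub_zero] at hc
    exact hNP hc
  refine ⟨⟨B, r, Units.mk0 c hc0, α, β, G, H, hr, hα, hβ, hG, hH, hB, ?_⟩⟩
  intro x hx hGx hHx
  obtain ⟨Q, hQ⟩ := hc
  have h1 := congrArg (eval x) hQ
  simp only [hN, hM, map_sub, map_mul, map_pow, eval_C, hx, zero_mul] at h1
  rw [zpow_div_eq_pow_mul_pow (hGx 0) (hHx 0), zpow_div_eq_pow_mul_pow (hGx 1) (hHx 1),
    div_mul_div_comm, Units.val_mk0, div_eq_iff (by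
      have := hGx 0; have := hGx 1; have := hHx 0; have := hHx 1; positivity)]
  exact sub_eq_zero.1 h1

end ToricSurface

/-! ### Topology of the toric limit surface -/

namespace ToricSurface

open Filter

/-- The point of `𝕋` with toric coordinates `(z, w)`. -/
def tor (B : Matrix.SpecialLinearGroup (Fin 2) ℤ) (z w : ℂˣ) : Torus :=
  fun i => z ^ B.1 i 0 * w ^ B.1 i 1

/-- The first toric coordinate of a point of `𝕋`. -/
def zc (B : Matrix.SpecialLinearGroup (Fin 2) ℤ) (t : Torus) : ℂˣ :=
  t 0 ^ B.1 1 1 * t 1 ^ (-B.1 0 1)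

/-- The second toric coordinate of a point of `𝕋`. -/
def wc (B : Matrix.SpecialLinearGroup (Fin 2) ℤ) (t : Torus) : ℂˣ :=
  t 0 ^ (-B.1 1 0) * t 1 ^ B.1 0 0

theorem det_eq_one (B : Matrix.SpecialLinearGroup (Fin 2) ℤ) :
    B.1 0 0 * B.1 1 1 - B.1 0 1 * B.1 1 0 = 1 := by
  rw [← Matrix.det_fin_two]; exact B.2

theorem zpow_four_mul (t u : ℂˣ) (a b c d e g : ℤ) :
    (t ^ a * u ^ b) ^ e * (t ^ c * u ^ d) ^ g = t ^ (a * e + c * g) * u ^ (b * e + d * g) := by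
  rw [mul_zpow, mul_zpow, ← zpow_mul, ← zpow_mul, ← zpow_mul, ← zpow_mul, zpow_add, zpow_add]
  exact mul_mul_mul_comm _ _ _ _

theorem tor_zc_wc (B : Matrix.SpecialLinearGroup (Fin 2) ℤ) (t : Torus) :
    tor B (zc B t) (wc B t) = t := by
  have h := det_eq_one B
  refine funext (Fin.forall_fin_two.2 ⟨?_, ?_⟩) <;> simp only [tor, zc, wc, zpow_four_mul]
  · rw [show B.1 1 1 * B.1 0 0 + -B.1 1 0 * B.1 0 1 = 1 by linarith,
      show -B.1 0 1 * B.1 0 0 + B.1 0 0 * B.1 0 1 = 0 by ring]; simp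
  · rw [show B.1 1 1 * B.1 1 0 + -B.1 1 0 * B.1 1 1 = 0 by ring,
      show -B.1 0 1 * B.1 1 0 + B.1 0 0 * B.1 1 1 = 1 by linarith]; simp

theorem zc_tor (B : Matrix.SpecialLinearGroup (Fin 2) ℤ) (z w : ℂˣ) : zc B (tor B z w) = z := by
  have h := det_eq_one B
  simp only [tor, zc, zpow_four_mul]
  rw [show B.1 0 0 * B.1 1 1 + B.1 1 0 * -B.1 0 1 = 1 by linarith,
      show B.1 0 1 * B.1 1 1 + B.1 1 1 * -B.1 0 1 = 0 by ring]; simp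

theorem wc_tor (B : Matrix.SpecialLinearGroup (Fin 2) ℤ) (z w : ℂˣ) : wc B (tor B z w) = w := by
  have h := det_eq_one B
  simp only [tor, wc, zpow_four_mul]
  rw [show B.1 0 0 * -B.1 1 0 + B.1 1 0 * B.1 0 0 = 0 by ring,
      show B.1 0 1 * -B.1 1 0 + B.1 1 1 * B.1 0 0 = 1 by linarith]; simp

theorem continuous_zc (B : Matrix.SpecialLinearGroup (Fin 2) ℤ) : Continuous (zc B) := by
  unfold zc; fun_prop

theorem continuous_wc (B : Matrix.SpecialLinearGroup (Fin 2) ℤ) : Continuous (wc B) := by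
  unfold wc; fun_prop

theorem continuous_tor (B : Matrix.SpecialLinearGroup (Fin 2) ℤ) :
    Continuous fun y : ℂˣ × ℂˣ => tor B y.1 y.2 := by
  unfold tor; fun_prop

theorem chart_coe (B : Matrix.SpecialLinearGroup (Fin 2) ℤ) (z w : ℂˣ) :
    chart B ((z : ℂ), w) = .torus (tor B z w) := by
  simp only [chart, z.ne_zero, dif_neg, not_false_eq_true]
  congr 1
  funext i
  simp [tor]

theorem chart_zero (B : Matrix.SpecialLinearGroup (Fin 2) ℤ) (w : ℂˣ) :
    chart B (0, w) = .pole (firstCol B) w := by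
  simp [chart]

theorem chart_zc_wc (B : Matrix.SpecialLinearGroup (Fin 2) ℤ) (t : Torus) :
    chart B ((zc B t : ℂ), wc B t) = .torus t := by
  rw [chart_coe, tor_zc_wc]

theorem chart_cases (y : ℂ × ℂˣ) : (∃ w, y = (0, w)) ∨ ∃ z w : ℂˣ, y = ((z : ℂ), w) := by
  obtain ⟨z, w⟩ := y
  by_cases h : z = 0
  · exact .inl ⟨w, by rw [h]⟩
  · exact .inr ⟨Units.mk0 z h, w, rfl⟩

theorem chart_injective (B : Matrix.SpecialLinearGroup (Fin 2) ℤ) :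
    Function.Injective (chart B) := by
  intro y y' h
  rcases chart_cases y with ⟨w, rfl⟩ | ⟨z, w, rfl⟩ <;>
    rcases chart_cases y' with ⟨w', rfl⟩ | ⟨z', w', rfl⟩
  · rw [chart_zero, chart_zero] at h
    injection h with _ h2
    rw [h2]
  · rw [chart_zero, chart_coe] at h; cases h
  · rw [chart_zero, chart_coe] at h; cases h
  · rw [chart_coe, chart_coe] at h
    injection h with h
    have h1 := congrArg (zc B) h
    have h2 := congrArg (wc B) h
    rw [zc_tor, zc_tor] at h1
    rw [wc_tor, wc_tor] at h2
    rw [h1, h2]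

theorem isOpen_iff_chart {s : Set LimitSurface} :
    IsOpen s ↔ ∀ B, IsOpen (chart B ⁻¹' s) := by
  change IsOpen[⨆ B, TopologicalSpace.coinduced (chart B) inferInstance] s ↔ _
  rw [isOpen_iSup_iff]
  rfl

theorem continuous_chart (B : Matrix.SpecialLinearGroup (Fin 2) ℤ) : Continuous (chart B) :=
  continuous_def.2 fun _ hs => isOpen_iff_chart.1 hs B

theorem isOpenMap_torus : IsOpenMap LimitSurface.torus := by
  intro O hO
  rw [isOpen_iff_chart]
  intro B
  have : chart B ⁻¹' (LimitSurface.torus '' O) =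
      (Prod.map ((↑) : ℂˣ → ℂ) (id : ℂˣ → ℂˣ)) '' {y | tor B y.1 y.2 ∈ O} := by
    ext y
    constructor
    · rintro ⟨t, ht, hty⟩
      rcases chart_cases y with ⟨w, rfl⟩ | ⟨z, w, rfl⟩
      · rw [chart_zero] at hty; cases hty
      · rw [chart_coe] at hty
        injection hty with hty
        exact ⟨(z, w), by simpa [← hty] using ht, rfl⟩
    · rintro ⟨⟨z, w⟩, hzw, rfl⟩
      exact ⟨_, hzw, (chart_coe B z w).symm⟩
  rw [this]
  exact (Units.isOpenEmbedding_val.isOpenMap.prodMap IsOpenMap.id) _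
    (hO.preimage (continuous_tor B))

/-- Two bases with the same first vector give charts that differ by a shear. -/
theorem exists_chart_eq_of_firstCol_eq {B B' : Matrix.SpecialLinearGroup (Fin 2) ℤ}
    (h : firstCol B = firstCol B') :
    ∃ k : ℤ, (∀ i, B'.1 i 1 = B.1 i 1 + k * B.1 i 0) ∧
      ∀ (z : ℂ) (w : ℂˣ), chart B' (z, w) = chart B (z * ((w ^ k : ℂˣ) : ℂ), w) := by
  have h0 : B.1 0 0 = B'.1 0 0 := congrFun (congrArg Subtype.val h) 0
  have h1 : B.1 1 0 = B'.1 1 0 := congrFun (congrArg Subtype.val h) 1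
  have d := det_eq_one B
  have d' := det_eq_one B'
  rw [← h0, ← h1] at d'
  have hi : ∀ i, B'.1 i 1 =
      B.1 i 1 + (B.1 1 1 * B'.1 0 1 - B.1 0 1 * B'.1 1 1) * B.1 i 0 := by
    refine Fin.forall_fin_two.2 ⟨?_, ?_⟩
    · linear_combination -(B'.1 0 1) * d + B.1 0 1 * d'
    · linear_combination -(B'.1 1 1) * d + B.1 1 1 * d'
  refine ⟨_, hi, ?_⟩
  intro z w
  by_cases hz : z = 0
  · rw [hz, zero_mul, chart_zero, chart_zero, h]
  · lift z to ℂˣ using isUnit_iff_ne_zero.2 hz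
    rw [← Units.val_mul, chart_coe, chart_coe]
    congr 1
    funext i
    have hi0 : B'.1 i 0 = B.1 i 0 := by fin_cases i; exacts [h0.symm, h1.symm]
    simp only [tor]
    rw [hi, hi0, zpow_add, mul_zpow, zpow_mul, mul_assoc, mul_comm (w ^ B.1 i 1)]

/-- Charts at the same pole differ by the homeomorphism `(z, w) ↦ (z * w ^ k, w)`; charts at
different poles meet only in the torus, where openness is known. -/
theorem isOpenMap_chart (B : Matrix.SpecialLinearGroup (Fin 2) ℤ) : IsOpenMap (chart B) := by
  intro O hO
  rw [isOpen_iff_chart]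
  intro B'
  by_cases h : firstCol B = firstCol B'
  · obtain ⟨k, -, hk⟩ := exists_chart_eq_of_firstCol_eq h
    have : chart B' ⁻¹' (chart B '' O) =
        (fun y : ℂ × ℂˣ => (y.1 * ((y.2 ^ k : ℂˣ) : ℂ), y.2)) ⁻¹' O := by
      ext ⟨z, w⟩
      simp only [Set.mem_preimage, hk]
      exact (chart_injective B).mem_set_image
    rw [this]
    refine hO.preimage ?_
    have : Continuous fun y : ℂ × ℂˣ => ((y.2 ^ k : ℂˣ) : ℂ) :=
      Units.continuous_val.comp (continuous_snd.zpow k)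
    fun_prop
  · have : chart B' ⁻¹' (chart B '' O) = chart B' ⁻¹'
        (LimitSurface.torus '' {t | ((zc B t : ℂ), wc B t) ∈ O}) := by
      ext y
      rcases chart_cases y with ⟨w, rfl⟩ | ⟨z, w, rfl⟩
      · simp only [Set.mem_preimage, chart_zero]
        constructor
        · rintro ⟨y, hy, hy'⟩
          rcases chart_cases y with ⟨w', rfl⟩ | ⟨z', w', rfl⟩
          · rw [chart_zero] at hy'
            injection hy' with hy'
            exact absurd hy' h
          · rw [chart_coe] at hy'; cases hy'
        · rintro ⟨t, -, ht⟩; cases ht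
      · simp only [Set.mem_preimage, chart_coe]
        rw [← chart_zc_wc B, (chart_injective B).mem_set_image, chart_zc_wc,
          Function.Injective.mem_set_image (fun a b hab => by injection hab)]
        rfl
    rw [this]
    refine isOpen_iff_chart.1 (isOpenMap_torus _ (hO.preimage ?_)) B'
    exact (Units.continuous_val.comp (continuous_zc B)).prodMk (continuous_wc B)

theorem isOpenEmbedding_chart (B : Matrix.SpecialLinearGroup (Fin 2) ℤ) :
    IsOpenEmbedding (chart B) :=
  .of_continuous_injective_isOpenMap (continuous_chart B) (chart_injective B) (isOpenMap_chart B)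

theorem continuous_torus : Continuous LimitSurface.torus := by
  have : LimitSurface.torus = fun t => chart 1 ((zc 1 t : ℂ), wc 1 t) :=
    funext fun t => (chart_zc_wc 1 t).symm
  rw [this]
  exact (continuous_chart 1).comp
    ((Units.continuous_val.comp (continuous_zc 1)).prodMk (continuous_wc 1))

theorem torus_injective : Function.Injective LimitSurface.torus := fun a b hab => by injection hab

theorem isOpenEmbedding_torus : IsOpenEmbedding LimitSurface.torus :=
  .of_continuous_injective_isOpenMap continuous_torus torus_injective isOpenMap_torus

theorem tendsto_torus_pole_iff {ι : Type*} {l : Filter ι} {t : ι → Torus}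
    {B : Matrix.SpecialLinearGroup (Fin 2) ℤ} {c : ℂˣ} :
    Tendsto (fun n => LimitSurface.torus (t n)) l (𝓝 (.pole (firstCol B) c)) ↔
      Tendsto (fun n => (zc B (t n) : ℂ)) l (𝓝 0) ∧ Tendsto (fun n => wc B (t n)) l (𝓝 c) := by
  rw [← chart_zero]
  simp only [← chart_zc_wc B]
  have := (isOpenEmbedding_chart B).tendsto_nhds_iff (f := fun n => ((zc B (t n) : ℂ), wc B (t n)))
    (l := l) (y := ((0 : ℂ), c))
  rw [nhds_prod_eq, tendsto_prod_iff'] at this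
  exact this.symm

theorem tendsto_torus_iff {ι : Type*} {l : Filter ι} {t : ι → Torus} {t₀ : Torus} :
    Tendsto (fun n => LimitSurface.torus (t n)) l (𝓝 (.torus t₀)) ↔ Tendsto t l (𝓝 t₀) :=
  isOpenEmbedding_torus.tendsto_nhds_iff.symm

theorem Log_tor (B : Matrix.SpecialLinearGroup (Fin 2) ℤ) (z w : ℂˣ) (i : Fin 2) :
    Log (tor B z w) i = -Real.log ‖(z : ℂ)‖ * B.1 i 0 + -Real.log ‖(w : ℂ)‖ * B.1 i 1 := by
  have hz : ‖(z : ℂ)‖ ≠ 0 := norm_ne_zero_iff.2 z.ne_zero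
  have hw : ‖(w : ℂ)‖ ≠ 0 := norm_ne_zero_iff.2 w.ne_zero
  simp only [Log, tor, Units.val_mul, Units.val_zpow_eq_zpow_val, norm_mul, norm_zpow]
  rw [Real.log_mul (zpow_ne_zero _ hz) (zpow_ne_zero _ hw), Real.log_zpow, Real.log_zpow]
  ring

theorem Log_eq (B : Matrix.SpecialLinearGroup (Fin 2) ℤ) (t : Torus) (i : Fin 2) :
    Log t i = -Real.log ‖(zc B t : ℂ)‖ * B.1 i 0 + -Real.log ‖(wc B t : ℂ)‖ * B.1 i 1 := by
  conv_lhs => rw [← tor_zc_wc B t]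
  exact Log_tor B _ _ i

theorem neg_log_zc (B : Matrix.SpecialLinearGroup (Fin 2) ℤ) (t : Torus) :
    -Real.log ‖(zc B t : ℂ)‖ = B.1 1 1 * Log t 0 - B.1 0 1 * Log t 1 := by
  have h : (B.1 0 0 * B.1 1 1 - B.1 0 1 * B.1 1 0 : ℝ) = 1 := by exact_mod_cast det_eq_one B
  rw [Log_eq B t 0, Log_eq B t 1]
  linear_combination Real.log ‖(zc B t : ℂ)‖ * h

theorem neg_log_wc (B : Matrix.SpecialLinearGroup (Fin 2) ℤ) (t : Torus) :
    -Real.log ‖(wc B t : ℂ)‖ = -B.1 1 0 * Log t 0 + B.1 0 0 * Log t 1 := by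
  have h : (B.1 0 0 * B.1 1 1 - B.1 0 1 * B.1 1 0 : ℝ) = 1 := by exact_mod_cast det_eq_one B
  rw [Log_eq B t 0, Log_eq B t 1]
  linear_combination Real.log ‖(wc B t : ℂ)‖ * h

theorem tendsto_neg_log_norm_atTop {ι : Type*} {l : Filter ι} {z : ι → ℂˣ}
    (h : Tendsto (fun n => (z n : ℂ)) l (𝓝 0)) :
    Tendsto (fun n => -Real.log ‖(z n : ℂ)‖) l atTop := by
  rw [tendsto_neg_atTop_iff]
  refine Real.tendsto_log_nhdsGT_zero.comp (tendsto_nhdsWithin_iff.2 ⟨by simpa using h.norm, ?_⟩)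
  exact Eventually.of_forall fun n => norm_pos_iff.2 (z n).ne_zero

theorem tendsto_neg_log_norm {ι : Type*} {l : Filter ι} {w : ι → ℂˣ} {c : ℂˣ}
    (h : Tendsto w l (𝓝 c)) :
    Tendsto (fun n => -Real.log ‖(w n : ℂ)‖) l (𝓝 (-Real.log ‖(c : ℂ)‖)) := by
  have h1 : Tendsto (fun n => ‖(w n : ℂ)‖) l (𝓝 ‖(c : ℂ)‖) :=
    ((Units.continuous_val.tendsto c).comp h).norm
  exact (h1.log (norm_ne_zero_iff.2 c.ne_zero)).neg

/-- A net in `𝕋` does not converge to points of two different poles. -/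
theorem firstCol_eq_of_tendsto {ι : Type*} {l : Filter ι} [NeBot l] {t : ι → Torus}
    {B B' : Matrix.SpecialLinearGroup (Fin 2) ℤ} {c c' : ℂˣ}
    (hz : Tendsto (fun n => (zc B (t n) : ℂ)) l (𝓝 0)) (hw : Tendsto (fun n => wc B (t n)) l (𝓝 c))
    (hz' : Tendsto (fun n => (zc B' (t n) : ℂ)) l (𝓝 0))
    (hw' : Tendsto (fun n => wc B' (t n)) l (𝓝 c')) : firstCol B = firstCol B' := by
  have s := tendsto_neg_log_norm_atTop hz
  have s' := tendsto_neg_log_norm_atTop hz'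
  have τ := tendsto_neg_log_norm hw
  have τ' := tendsto_neg_log_norm hw'
  -- As `-log |z|` tends to infinity while `log |w|` converges, a convergent combination of the two
  -- cannot involve the first.
  have hconst : ∀ a b : ℝ, Tendsto (fun n => a * -Real.log ‖(zc B (t n) : ℂ)‖ +
      b * -Real.log ‖(wc B (t n) : ℂ)‖) l (𝓝 (-Real.log ‖(c' : ℂ)‖)) → a = 0 := by
    intro a b h
    by_contra ha
    have h2 := ((h.sub (τ.const_mul b)).const_mul a⁻¹).congr
      (fun n => show _ = -Real.log ‖(zc B (t n) : ℂ)‖ by field_simp; ring)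
    exact not_tendsto_nhds_of_tendsto_atTop s _ h2
  -- Convergence of the second coordinate in `B'` makes the two first columns parallel; `hκ` fixes
  -- the direction, and primitivity then forces the factor `κ = 1`.
  have hΔ : (-B'.1 1 0 * B.1 0 0 + B'.1 0 0 * B.1 1 0 : ℝ) = 0 := by
    refine hconst _ (-B'.1 1 0 * B.1 0 1 + B'.1 0 0 * B.1 1 1) (τ'.congr fun n => ?_)
    rw [neg_log_wc, Log_eq B (t n) 0, Log_eq B (t n) 1]; ring
  have hκ : (0 : ℝ) < B'.1 1 1 * B.1 0 0 - B'.1 0 1 * B.1 1 0 := by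
    by_contra hle
    push Not at hle
    have h1 : ∀ᶠ n in l, -Real.log ‖(zc B' (t n) : ℂ)‖ ≤
        (B'.1 1 1 * B.1 0 1 - B'.1 0 1 * B.1 1 1) * -Real.log ‖(wc B (t n) : ℂ)‖ := by
      filter_upwards [s.eventually_ge_atTop 0] with n hn
      rw [neg_log_zc, Log_eq B (t n) 0, Log_eq B (t n) 1]
      nlinarith
    exact not_tendsto_nhds_of_tendsto_atTop (tendsto_atTop_mono' l h1 s') _ (τ.const_mul _)
  have hΔ' : -B'.1 1 0 * B.1 0 0 + B'.1 0 0 * B.1 1 0 = 0 := by exact_mod_cast hΔ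
  have hκ' : 0 < B'.1 1 1 * B.1 0 0 - B'.1 0 1 * B.1 1 0 := by exact_mod_cast hκ
  set κ := B'.1 1 1 * B.1 0 0 - B'.1 0 1 * B.1 1 0 with hκdef
  have d := det_eq_one B
  have d' := det_eq_one B'
  have e0 : B.1 0 0 = κ * B'.1 0 0 := by
    rw [hκdef]; linear_combination -(B.1 0 0) * d' + B'.1 0 1 * hΔ'
  have e1 : B.1 1 0 = κ * B'.1 1 0 := by
    rw [hκdef]; linear_combination -(B.1 1 0) * d' + B'.1 1 1 * hΔ'
  have hκ1 : κ = 1 := by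
    have : κ ∣ 1 := ⟨B'.1 0 0 * B.1 1 1 - B.1 0 1 * B'.1 1 0, by
      linear_combination -d + B.1 1 1 * e0 - B.1 0 1 * e1⟩
    have := Int.le_of_dvd one_pos this
    omega
  refine Subtype.ext (funext (Fin.forall_fin_two.2 ⟨?_, ?_⟩))
  · change B.1 0 0 = B'.1 0 0
    rw [e0, hκ1, one_mul]
  · change B.1 1 0 = B'.1 1 0
    rw [e1, hκ1, one_mul]

theorem exists_firstCol_eq (v : PrimVec) : ∃ B, firstCol B = v := by
  obtain ⟨v, s, t, hst⟩ := v
  refine ⟨⟨!![v 0, -t; v 1, s], by rw [Matrix.det_fin_two]; simp; linarith⟩, ?_⟩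
  refine Subtype.ext (funext (Fin.forall_fin_two.2 ⟨?_, ?_⟩)) <;> simp [firstCol]

/-- Any two points lie in a common chart, unless they belong to different poles. In that case an
ultrafilter that converges to both lives on the torus, and `firstCol_eq_of_tendsto` excludes it. -/
instance : T2Space LimitSurface := by
  have hsame : ∀ (B : Matrix.SpecialLinearGroup (Fin 2) ℤ) (y y' : ℂ × ℂˣ)
      (F : Ultrafilter LimitSurface), ↑F ≤ 𝓝 (chart B y) → ↑F ≤ 𝓝 (chart B y') → y = y' := by
    intro B y y' F h h'
    by_contra hne
    rw [← (isOpenEmbedding_chart B).map_nhds_eq] at h h'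
    have := (Filter.disjoint_map (chart_injective B)).2 (disjoint_nhds_nhds.2 hne)
    exact F.neBot.ne (le_bot_iff.1 (this h h'))
  rw [t2_iff_ultrafilter]
  intro x x' F h h'
  rcases x with t | ⟨v, c⟩
  · rcases x' with t' | ⟨v', c'⟩
    · rw [← chart_zc_wc 1] at h
      rw [← chart_zc_wc 1] at h'
      rw [← chart_zc_wc 1, ← chart_zc_wc 1, hsame _ _ _ F h h']
    · obtain ⟨B, rfl⟩ := exists_firstCol_eq v'
      rw [← chart_zc_wc B] at h
      rw [← chart_zero] at h'
      rw [← chart_zc_wc B, ← chart_zero, hsame _ _ _ F h h']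
  · obtain ⟨B, rfl⟩ := exists_firstCol_eq v
    rcases x' with t' | ⟨v', c'⟩
    · rw [← chart_zc_wc B] at h'
      rw [← chart_zero] at h
      rw [← chart_zc_wc B, ← chart_zero, hsame _ _ _ F h h']
    · obtain ⟨B', rfl⟩ := exists_firstCol_eq v'
      by_cases hB : firstCol B = firstCol B'
      · rw [← hB, ← chart_zero] at h'
        rw [← chart_zero] at h
        rw [← hB, ← chart_zero, ← chart_zero, hsame _ _ _ F h h']
      exfalso
      have hmem : Set.range LimitSurface.torus ∈ F := by
        have h1 : Set.range (chart B) ∈ F := h ((isOpenEmbedding_chart B).isOpen_range.mem_nhds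
          ⟨_, chart_zero B c⟩)
        have h2 : Set.range (chart B') ∈ F := h' ((isOpenEmbedding_chart B').isOpen_range.mem_nhds
          ⟨_, chart_zero B' c'⟩)
        filter_upwards [h1, h2]
        rintro x ⟨y, rfl⟩ ⟨y', hy'⟩
        rcases chart_cases y with ⟨w, rfl⟩ | ⟨z, w, rfl⟩
        · rcases chart_cases y' with ⟨w', rfl⟩ | ⟨z', w', rfl⟩
          · rw [chart_zero, chart_zero] at hy'
            injection hy' with hy'
            exact absurd hy'.symm hB
          · rw [chart_zero, chart_coe] at hy'; cases hy'
        · exact ⟨_, (chart_coe B z w).symm⟩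
      have hmap : Tendsto LimitSurface.torus (Filter.comap LimitSurface.torus F) F := tendsto_comap
      have hne : NeBot (Filter.comap LimitSurface.torus (F : Filter LimitSurface)) :=
        F.neBot.comap_of_range_mem hmem
      have h1 := tendsto_torus_pole_iff.1 (hmap.mono_right h)
      have h2 := tendsto_torus_pole_iff.1 (hmap.mono_right h')
      exact hB (firstCol_eq_of_tendsto h1.1 h1.2 h2.1 h2.2)

end ToricSurface

/-! ### The map on the torus, its graph and its points of determinacy -/

namespace ToricSurface

open Filter MvPolynomial

/-- The coordinates of a point of `𝕋` as complex numbers. -/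
def cv (p : Torus) : Fin 2 → ℂ := fun j => (p j : ℂ)

theorem continuous_cv : Continuous cv :=
  continuous_pi fun j => Units.continuous_val.comp (continuous_apply j)

theorem isOpenEmbedding_cv : IsOpenEmbedding cv :=
  IsOpenEmbedding.piMap fun _ => Units.isOpenEmbedding_val

open Classical in
/-- The map `f : dom f → 𝕋`, extended to all of `𝕋` by the value `1`. -/
noncomputable def RatMap.map (f : RatMap) (p : Torus) : Torus :=
  if hp : p ∈ f.dom then f.apply p hp else 1

variable (f : RatMap)

theorem RatMap.map_eq_apply {p : Torus} (hp : p ∈ f.dom) : f.map p = f.apply p hp := dif_pos hp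

theorem RatMap.coe_map {p : Torus} (hp : p ∈ f.dom) (i : Fin 2) :
    (f.map p i : ℂ) = f.val i (cv p) := by
  rw [f.map_eq_apply hp]; rfl

theorem RatMap.mem_dom_iff {p : Torus} :
    p ∈ f.dom ↔ ∀ i, eval (cv p) (f.num i) ≠ 0 ∧ eval (cv p) (f.den i) ≠ 0 := Iff.rfl

theorem continuous_eval_cv (P : MvPolynomial (Fin 2) ℂ) : Continuous fun p => eval (cv p) P :=
  (MvPolynomial.continuous_eval P).comp continuous_cv

theorem RatMap.isOpen_dom : IsOpen f.dom := by
  have : f.dom = ⋂ i, {p | eval (cv p) (f.num i) ≠ 0} ∩ {p | eval (cv p) (f.den i) ≠ 0} := by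
    ext p; simp [f.mem_dom_iff]
  rw [this]
  exact isOpen_iInter_of_finite fun i =>
    (isOpen_ne_fun (continuous_eval_cv _) continuous_const).inter
      (isOpen_ne_fun (continuous_eval_cv _) continuous_const)

theorem tendsto_torus_of_coe {ι : Type*} {l : Filter ι} {t : ι → Torus} {t₀ : Torus}
    (h : ∀ i, Tendsto (fun n => (t n i : ℂ)) l (𝓝 (t₀ i : ℂ))) : Tendsto t l (𝓝 t₀) :=
  isOpenEmbedding_cv.tendsto_nhds_iff.2 (tendsto_pi_nhds.2 h)

theorem RatMap.continuousAt_map {p : Torus} (hp : p ∈ f.dom) : ContinuousAt f.map p := by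
  refine tendsto_torus_of_coe fun i => ?_
  rw [f.coe_map hp]
  have h1 : ContinuousAt (fun p => f.val i (cv p)) p :=
    (continuous_eval_cv (f.num i)).continuousAt.div (continuous_eval_cv (f.den i)).continuousAt
      (hp i).2
  refine Tendsto.congr' ?_ h1
  filter_upwards [f.isOpen_dom.mem_nhds hp] with q hq
  rw [f.coe_map hq]

/-- Closure points of the graph become limits along ultrafilters on `dom f`. Every later statement
about values of the meromorphic map is handled in this form. -/
theorem RatMap.mem_image_iff {x q : LimitSurface} : q ∈ f.image x ↔
    ∃ F : Ultrafilter Torus, f.dom ∈ F ∧ Tendsto LimitSurface.torus F (𝓝 x) ∧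
      Tendsto (fun p => LimitSurface.torus (f.map p)) F (𝓝 q) := by
  set g : Torus → LimitSurface × LimitSurface := fun p => (.torus p, .torus (f.map p)) with hg
  have hset : {a : LimitSurface × LimitSurface |
      ∃ (p : Torus) (hp : p ∈ f.dom), a = (.torus p, .torus (f.apply p hp))} = g '' f.dom := by
    ext a
    constructor
    · rintro ⟨p, hp, rfl⟩
      exact ⟨p, hp, by rw [hg]; simp only [f.map_eq_apply hp]⟩
    · rintro ⟨p, hp, rfl⟩
      exact ⟨p, hp, by rw [hg]; simp only [f.map_eq_apply hp]⟩
  change (x, q) ∈ closure _ ↔ _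
  rw [hset]
  constructor
  · intro h
    have h1 : NeBot (𝓝 (x, q) ⊓ 𝓟 (g '' f.dom)) := mem_closure_iff_clusterPt.1 h
    have h2 : NeBot (comap g (𝓝 (x, q) ⊓ 𝓟 (g '' f.dom)) ⊓ 𝓟 f.dom) :=
      comap_inf_principal_neBot_of_image_mem h1 (mem_inf_of_right (mem_principal_self _))
    have hle := Ultrafilter.of_le (comap g (𝓝 (x, q) ⊓ 𝓟 (g '' f.dom)) ⊓ 𝓟 f.dom)
    have h3 : Tendsto g (Ultrafilter.of (comap g (𝓝 (x, q) ⊓ 𝓟 (g '' f.dom)) ⊓ 𝓟 f.dom) :)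
        (𝓝 (x, q)) :=
      (tendsto_comap.mono_left (hle.trans inf_le_left)).mono_right inf_le_left
    exact ⟨_, hle (mem_inf_of_right (mem_principal_self _)),
      (continuous_fst.tendsto _).comp h3, (continuous_snd.tendsto _).comp h3⟩
  · rintro ⟨F, hF, h1, h2⟩
    refine mem_closure_of_tendsto (f := g) (b := (F : Filter Torus)) ?_ ?_
    · rw [nhds_prod_eq]; exact h1.prodMk h2
    · filter_upwards [hF] with p hp using ⟨p, hp, rfl⟩

theorem RatMap.mem_image_of_tendsto {ι : Type*} {l : Filter ι} [NeBot l] {p : ι → Torus}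
    {x q : LimitSurface} (hp : ∀ᶠ n in l, p n ∈ f.dom)
    (hx : Tendsto (fun n => LimitSurface.torus (p n)) l (𝓝 x))
    (hq : Tendsto (fun n => LimitSurface.torus (f.map (p n))) l (𝓝 q)) : q ∈ f.image x := by
  rw [f.mem_image_iff]
  have hle := Ultrafilter.of_le (Filter.map p l)
  exact ⟨Ultrafilter.of (Filter.map p l), hle hp, Tendsto.mono_left (tendsto_map'_iff.2 hx) hle,
    Tendsto.mono_left (tendsto_map'_iff.2 hq) hle⟩

theorem RatMap.image_torus_of_mem_dom {p : Torus} (hp : p ∈ f.dom) :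
    f.image (.torus p) = {.torus (f.map p)} := by
  ext q
  rw [Set.mem_singleton_iff]
  constructor
  · rw [f.mem_image_iff]
    rintro ⟨F, -, h1, h2⟩
    have h3 : Tendsto id (F : Filter Torus) (𝓝 p) := tendsto_torus_iff.1 h1
    exact tendsto_nhds_unique h2
      (tendsto_torus_iff.2 ((f.continuousAt_map hp).tendsto.comp h3))
  · rintro rfl
    exact f.mem_image_of_tendsto (l := pure ()) (p := fun _ : Unit => p)
      (by simpa using hp) (tendsto_const_nhds) (tendsto_const_nhds)

theorem isEmbedding_coords : IsEmbedding coords :=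
  IsEmbedding.id.prodMap Units.isOpenEmbedding_val.isEmbedding

/-- Near a point of determinacy, `f` is given in toric charts by a holomorphic map. -/
theorem RatMap.exists_analyticAt_of_notMem_Ind {x : LimitSurface} (hx : x ∉ f.Ind) :
    ∃ (B B' : Matrix.SpecialLinearGroup (Fin 2) ℤ) (y q₀ : ℂ × ℂˣ) (h : ℂ × ℂ → ℂ × ℂ),
      chart B y = x ∧ AnalyticAt ℂ h (coords y) ∧ coords q₀ = h (coords y) ∧
      (∀ᶠ y' in 𝓝 y, ∃ q, coords q = h (coords y') ∧
        ∀ p ∈ f.dom, chart B y' = .torus p → .torus (f.map p) = chart B' q) ∧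
      f.image x ⊆ {chart B' q₀} := by
  rw [RatMap.Ind, Set.mem_ofPred_eq, not_not] at hx
  obtain ⟨g, ⟨B, B', y, h, rfl, hh, hg⟩, hgf⟩ := hx
  have hgf' : ∀ᶠ y' in 𝓝 y, ∀ (p : Torus) (hp : p ∈ f.dom), chart B y' = .torus p →
      g (chart B y') = .torus (f.apply p hp) := (continuous_chart B).continuousAt.eventually hgf
  have hall : ∀ᶠ y' in 𝓝 y, ∃ q, coords q = h (coords y') ∧
        ∀ p ∈ f.dom, chart B y' = .torus p → .torus (f.map p) = chart B' q := by
    filter_upwards [hg, hgf'] with y' h1 h2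
    obtain ⟨q, hq, hgq⟩ := h1
    refine ⟨q, hq, fun p hp hyp => ?_⟩
    rw [← hgq, h2 p hp hyp, f.map_eq_apply hp]
  obtain ⟨q₀, hq₀, -⟩ := hall.self_of_nhds
  refine ⟨B, B', y, q₀, h, rfl, hh, hq₀, hall, ?_⟩
  intro q hq
  rw [f.mem_image_iff] at hq
  obtain ⟨F, hF, h1, h2⟩ := hq
  -- A value at `x` is a limit of points whose coordinates are values of `h`, and continuity of `h`
  -- leaves only `chart B' q₀`.
  have h3 : Tendsto (fun p => ((zc B p : ℂ), wc B p)) (F : Filter Torus) (𝓝 y) := by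
    rw [(isOpenEmbedding_chart B).tendsto_nhds_iff]
    exact h1.congr fun p => (chart_zc_wc B p).symm
  have h4 : ∀ᶠ p in (F : Filter Torus), ∃ q, coords q = h (coords ((zc B p : ℂ), wc B p)) ∧
      .torus (f.map p) = chart B' q := by
    filter_upwards [h3.eventually hall, hF] with p hp hpd
    obtain ⟨q, hq, hq'⟩ := hp
    exact ⟨q, hq, hq' p hpd (chart_zc_wc B p)⟩
  choose! Q hQ using fun p (hp : ∃ q, coords q = h (coords ((zc B p : ℂ), wc B p)) ∧
      .torus (f.map p) = chart B' q) => hp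
  have h5 : Tendsto Q (F : Filter Torus) (𝓝 q₀) := by
    rw [isEmbedding_coords.tendsto_nhds_iff, hq₀]
    have h6 : Tendsto (fun p => h (coords ((zc B p : ℂ), wc B p))) (F : Filter Torus)
        (𝓝 (h (coords y))) :=
      hh.continuousAt.tendsto.comp ((isEmbedding_coords.continuous.tendsto y).comp h3)
    exact h6.congr' (h4.mono fun p hp => (hQ p hp).1.symm)
  have h7 : Tendsto (fun p => LimitSurface.torus (f.map p)) (F : Filter Torus)
      (𝓝 (chart B' q₀)) :=
    (((continuous_chart B').tendsto q₀).comp h5).congr' (h4.mono fun p hp => (hQ p hp).2.symm)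
  exact tendsto_nhds_unique h2 h7

end ToricSurface

/-! ### Polynomials in toric charts and closures of plane curves -/

namespace ToricSurface

open Filter MvPolynomial

/-- The pairing of an exponent with the `k`-th vector of a basis. -/
def pr (B : Matrix.SpecialLinearGroup (Fin 2) ℤ) (k : Fin 2) (m : Fin 2 →₀ ℕ) : ℤ :=
  m 0 * B.1 0 k + m 1 * B.1 1 k

/-- The order of vanishing of a polynomial along the pole of the first vector of a basis. -/
noncomputable def ordB (B : Matrix.SpecialLinearGroup (Fin 2) ℤ) (P : MvPolynomial (Fin 2) ℂ) : ℤ :=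
  if h : P.support.Nonempty then P.support.inf' h (pr B 0) else 0

/-- The polynomial `∑ φ(m) c_m x^m`, where `P = ∑ c_m x^m`, in a toric chart and divided by the power
of `z` that divides `P`. -/
noncomputable def redW (B : Matrix.SpecialLinearGroup (Fin 2) ℤ) (P : MvPolynomial (Fin 2) ℂ)
    (φ : (Fin 2 →₀ ℕ) → ℂ) (z w : ℂ) : ℂ :=
  ∑ m ∈ P.support, φ m * (coeff m P * (z ^ (pr B 0 m - ordB B P).toNat * w ^ pr B 1 m))

/-- A polynomial in a toric chart, divided by the power of `z` that divides it. -/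
noncomputable def redP (B : Matrix.SpecialLinearGroup (Fin 2) ℤ) (P : MvPolynomial (Fin 2) ℂ)
    (z w : ℂ) : ℂ := redW B P 1 z w

variable {B : Matrix.SpecialLinearGroup (Fin 2) ℤ} {P : MvPolynomial (Fin 2) ℂ}

theorem ordB_le {m : Fin 2 →₀ ℕ} (hm : m ∈ P.support) : ordB B P ≤ pr B 0 m := by
  rw [ordB, dif_pos ⟨m, hm⟩]
  exact Finset.inf'_le _ hm

theorem exists_pr_eq_ordB (B : Matrix.SpecialLinearGroup (Fin 2) ℤ) (hP : P ≠ 0) :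
    ∃ m ∈ P.support, pr B 0 m = ordB B P := by
  rw [ordB, dif_pos (support_nonempty.2 hP)]
  obtain ⟨m, hm, h⟩ := Finset.exists_mem_eq_inf' (support_nonempty.2 hP) (pr B 0)
  exact ⟨m, hm, h.symm⟩

theorem eq_of_pr_eq {m m' : Fin 2 →₀ ℕ} (h0 : pr B 0 m = pr B 0 m') (h1 : pr B 1 m = pr B 1 m') :
    m = m' := by
  have d := det_eq_one B
  simp only [pr] at h0 h1
  ext i
  fin_cases i
  · have : (m 0 : ℤ) = m' 0 := by
      linear_combination B.1 1 1 * h0 - B.1 1 0 * h1 - ((m 0 : ℤ) - m' 0) * d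
    exact_mod_cast this
  · have : (m 1 : ℤ) = m' 1 := by
      linear_combination -B.1 0 1 * h0 + B.1 0 0 * h1 - ((m 1 : ℤ) - m' 1) * d
    exact_mod_cast this

theorem prod_cv_tor (z w : ℂˣ) (m : Fin 2 →₀ ℕ) :
    ∏ i, cv (tor B z w) i ^ m i = (z : ℂ) ^ pr B 0 m * (w : ℂ) ^ pr B 1 m := by
  rw [Fin.prod_univ_two]
  simp only [cv, tor, pr]
  have : ((z ^ B.1 0 0 * w ^ B.1 0 1) ^ (m 0 : ℤ) * (z ^ B.1 1 0 * w ^ B.1 1 1) ^ (m 1 : ℤ) : ℂˣ) =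
      z ^ (m 0 * B.1 0 0 + m 1 * B.1 1 0 : ℤ) * w ^ (m 0 * B.1 0 1 + m 1 * B.1 1 1 : ℤ) := by
    rw [zpow_four_mul]; congr 2 <;> ring
  have h2 := congrArg (Units.val) this
  simpa [zpow_natCast] using h2

/-- The weight `φ = 1` gives `P`, and `φ m = m j` gives `euler j P`. Both are divided by the power
of `z` that belongs to `P`, which lets the powers cancel in logarithmic derivatives. -/
theorem sum_eq_zpow_mul_redW (φ : (Fin 2 →₀ ℕ) → ℂ) (z w : ℂˣ) :
    ∑ m ∈ P.support, φ m * (coeff m P * ∏ i, cv (tor B z w) i ^ m i) =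
      (z : ℂ) ^ ordB B P * redW B P φ z w := by
  rw [redW, Finset.mul_sum]
  refine Finset.sum_congr rfl fun m hm => ?_
  have h1 : (z : ℂ) ^ pr B 0 m = (z : ℂ) ^ ordB B P * (z : ℂ) ^ (pr B 0 m - ordB B P).toNat := by
    rw [← zpow_natCast, Int.toNat_of_nonneg (sub_nonneg.2 (ordB_le hm)), ← zpow_add₀ z.ne_zero]
    congr 1; ring
  rw [prod_cv_tor, h1]; ring

theorem eval_tor (P : MvPolynomial (Fin 2) ℂ) (z w : ℂˣ) :
    eval (cv (tor B z w)) P = (z : ℂ) ^ ordB B P * redP B P z w := by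
  rw [redP, ← sum_eq_zpow_mul_redW, eval_eq']
  simp

theorem redP_eq_zero_iff (z w : ℂˣ) : redP B P z w = 0 ↔ eval (cv (tor B z w)) P = 0 := by
  rw [eval_tor, mul_eq_zero, or_iff_right (zpow_ne_zero _ z.ne_zero)]

theorem analyticAt_redW (φ : (Fin 2 →₀ ℕ) → ℂ) {y : ℂ × ℂ} (hy : y.2 ≠ 0) :
    AnalyticAt ℂ (fun y : ℂ × ℂ => redW B P φ y.1 y.2) y := by
  unfold redW
  refine Finset.analyticAt_fun_sum _ fun m _ => ?_
  refine analyticAt_const.mul (analyticAt_const.mul ((analyticAt_fst.pow _).mul ?_))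
  exact analyticAt_snd.zpow hy

theorem analyticAt_redP {y : ℂ × ℂ} (hy : y.2 ≠ 0) :
    AnalyticAt ℂ (fun y : ℂ × ℂ => redP B P y.1 y.2) y := analyticAt_redW 1 hy

theorem tendsto_redW {ι : Type*} {l : Filter ι} {z w : ι → ℂ} {z₀ w₀ : ℂ}
    (φ : (Fin 2 →₀ ℕ) → ℂ) (hw₀ : w₀ ≠ 0) (hz : Tendsto z l (𝓝 z₀)) (hw : Tendsto w l (𝓝 w₀)) :
    Tendsto (fun n => redW B P φ (z n) (w n)) l (𝓝 (redW B P φ z₀ w₀)) := by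
  unfold redW
  refine tendsto_finsetSum _ fun m _ => ?_
  exact tendsto_const_nhds.mul (tendsto_const_nhds.mul ((hz.pow _).mul (hw.zpow₀ _ (.inl hw₀))))

/-- Along the pole, a polynomial is a nonzero Laurent polynomial in the other coordinate. -/
theorem exists_redP_zero_eq (B : Matrix.SpecialLinearGroup (Fin 2) ℤ) (hP : P ≠ 0) {w₀ : ℂ}
    (hw₀ : w₀ ≠ 0) : ∃ (k : ℕ) (e : ℂ → ℂ), (∀ w, w ≠ 0 → AnalyticAt ℂ e w) ∧ e w₀ ≠ 0 ∧
      ∀ w, w ≠ 0 → redP B P 0 w = (w - w₀) ^ k * e w := by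
  obtain ⟨m₀, hm₀, hm₀'⟩ := exists_pr_eq_ordB B hP
  -- A shift by `N` turns the Laurent polynomial on the pole into a polynomial `q`. Monomials with
  -- the same minimal `pr B 0` have different `pr B 1`, so nothing cancels and `q ≠ 0`.
  obtain ⟨N, hN⟩ : ∃ N : ℤ, ∀ m ∈ P.support, 0 ≤ pr B 1 m + N := by
    refine ⟨∑ m ∈ P.support, |pr B 1 m|, fun m hm => ?_⟩
    have := Finset.single_le_sum (f := fun m => |pr B 1 m|) (fun _ _ => abs_nonneg _) hm
    have := neg_abs_le (pr B 1 m)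
    linarith
  let q : Polynomial ℂ := ∑ m ∈ P.support.filter (fun m => pr B 0 m = ordB B P),
    Polynomial.C (coeff m P) * Polynomial.X ^ (pr B 1 m + N).toNat
  have hq0 : q ≠ 0 := by
    intro h0
    have h1 := congrArg (fun r => Polynomial.coeff r (pr B 1 m₀ + N).toNat) h0
    simp only [q, Polynomial.finsetSum_coeff, Polynomial.coeff_C_mul, Polynomial.coeff_X_pow,
      Polynomial.coeff_zero] at h1
    rw [Finset.sum_eq_single m₀] at h1
    · simp only [if_true, mul_one] at h1
      exact mem_support_iff.1 hm₀ h1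
    · intro m hm hne
      rw [Finset.mem_filter] at hm
      rw [if_neg, mul_zero]
      intro h2
      have h3 := hN m hm.1
      have h4 := hN m₀ hm₀
      exact hne (eq_of_pr_eq (hm.2.trans hm₀'.symm) (by omega))
    · intro h2
      exact absurd (Finset.mem_filter.2 ⟨hm₀, hm₀'⟩) h2
  have hq : ∀ w, w ≠ 0 → redP B P 0 w = w ^ (-N) * q.eval w := by
    intro w hw
    simp only [q, Polynomial.eval_finsetSum, Polynomial.eval_mul, Polynomial.eval_C,
      Polynomial.eval_pow, Polynomial.eval_X]
    rw [redP, redW, Finset.sum_filter, Finset.mul_sum]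
    refine Finset.sum_congr rfl fun m hm => ?_
    split_ifs with h
    · rw [h, sub_self, Int.toNat_zero, pow_zero, ← zpow_natCast, Int.toNat_of_nonneg (hN m hm),
        zpow_add₀ hw, zpow_neg]
      have := zpow_ne_zero N hw
      simp only [Pi.one_apply]
      field_simp
    · have h1 := ordB_le (B := B) hm
      rw [zero_pow (by omega)]
      simp
  obtain ⟨q₁, hq₁, hdvd⟩ := Polynomial.exists_eq_pow_rootMultiplicity_mul_and_not_dvd q hq0 w₀
  refine ⟨q.rootMultiplicity w₀, fun w => w ^ (-N) * q₁.eval w, ?_, ?_, ?_⟩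
  · intro w hw
    exact (analyticAt_id.zpow hw).mul (q₁.differentiable.analyticAt w)
  · refine mul_ne_zero (zpow_ne_zero _ hw₀) fun h => hdvd (Polynomial.dvd_iff_isRoot.2 h)
  · intro w hw
    rw [hq w hw]
    conv_lhs => rw [hq₁]
    simp only [Polynomial.eval_mul, Polynomial.eval_pow, Polynomial.eval_sub, Polynomial.eval_X,
      Polynomial.eval_C]
    ring

/-- The closure in `𝕋̂°` of the curve `P = 0` of `𝕋`. -/
def curve (P : MvPolynomial (Fin 2) ℂ) : Set LimitSurface :=
  {x | ∃ (B : Matrix.SpecialLinearGroup (Fin 2) ℤ) (y : ℂ × ℂˣ), chart B y = x ∧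
    redP B P y.1 y.2 = 0}

/-- Membership does not depend on the chart: on a pole, a change of basis multiplies `redP` by a
power of `w`, and in the torus the condition is `P = 0`. -/
theorem chart_mem_curve_iff (B : Matrix.SpecialLinearGroup (Fin 2) ℤ)
    (P : MvPolynomial (Fin 2) ℂ) (y : ℂ × ℂˣ) : chart B y ∈ curve P ↔ redP B P y.1 y.2 = 0 := by
  refine ⟨?_, fun h => ⟨B, y, rfl, h⟩⟩
  rintro ⟨B', y', hyy, h⟩
  rcases chart_cases y with ⟨w, rfl⟩ | ⟨z, w, rfl⟩ <;>
    rcases chart_cases y' with ⟨w', rfl⟩ | ⟨z', w', rfl⟩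
  · rw [chart_zero, chart_zero] at hyy
    injection hyy with h1 h2
    subst h2
    obtain ⟨k, hk, -⟩ := exists_chart_eq_of_firstCol_eq h1
    have hpr0 : ∀ m, pr B' 0 m = pr B 0 m := by
      intro m
      have e0 : B'.1 0 0 = B.1 0 0 := congrFun (congrArg Subtype.val h1) 0
      have e1 : B'.1 1 0 = B.1 1 0 := congrFun (congrArg Subtype.val h1) 1
      simp only [pr, e0, e1]
    have hpr1 : ∀ m, pr B 1 m = pr B' 1 m + k * pr B 0 m := by
      intro m
      rw [← hpr0]
      simp only [pr, hk]; ring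
    have hord : ordB B' P = ordB B P := by
      simp only [ordB, show pr B' 0 = pr B 0 from funext hpr0]
    have : redP B P 0 w' = (w' : ℂ) ^ (k * ordB B P) * redP B' P 0 w' := by
      simp only [redP, redW, Finset.mul_sum]
      refine Finset.sum_congr rfl fun m hm => ?_
      rw [hpr0, hord, hpr1]
      by_cases hm0 : pr B 0 m = ordB B P
      · rw [hm0, zpow_add₀ w'.ne_zero]; ring
      · have h1 := ordB_le (B := B) hm
        rw [zero_pow (by omega)]; simp
    simp only at h ⊢
    rw [this, h, mul_zero]
  · rw [chart_zero, chart_coe] at hyy; cases hyy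
  · rw [chart_zero, chart_coe] at hyy; cases hyy
  · rw [chart_coe, chart_coe] at hyy
    injection hyy with hyy
    rw [redP_eq_zero_iff] at h ⊢
    rwa [← hyy]

theorem torus_mem_curve_iff (P : MvPolynomial (Fin 2) ℂ) (t : Torus) :
    .torus t ∈ curve P ↔ eval (cv t) P = 0 := by
  rw [← chart_zc_wc 1 t, chart_mem_curve_iff, redP_eq_zero_iff, tor_zc_wc]

theorem exists_chart_eq (x : LimitSurface) :
    ∃ (B : Matrix.SpecialLinearGroup (Fin 2) ℤ) (y : ℂ × ℂˣ), chart B y = x := by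
  rcases x with t | ⟨v, c⟩
  · exact ⟨1, _, chart_zc_wc 1 t⟩
  · obtain ⟨B, rfl⟩ := exists_firstCol_eq v
    exact ⟨B, _, chart_zero B c⟩

/-- By the identity theorem on the connected set `ℂ × ℂ*`, local vanishing would spread to the pole
`z = 0`, where `redP` is a nonzero Laurent polynomial. -/
theorem not_eventually_redP_eq_zero (hP : P ≠ 0) (z : ℂ) {w : ℂ} (hw : w ≠ 0) :
    ¬ ∀ᶠ a in 𝓝 (z, w), redP B P a.1 a.2 = 0 := by
  intro h
  have han : AnalyticOnNhd ℂ (fun y : ℂ × ℂ => redP B P y.1 y.2) (Set.univ ×ˢ {0}ᶜ) :=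
    fun y hy => analyticAt_redP hy.2
  have hconn : IsPreconnected ((Set.univ : Set ℂ) ×ˢ ({0}ᶜ : Set ℂ)) :=
    isPreconnected_univ.prod
      (isConnected_compl_singleton_of_one_lt_rank (by simp) 0).isPreconnected
  have hz := han.eqOn_zero_of_preconnected_of_eventuallyEq_zero hconn (z₀ := (z, w))
    ⟨trivial, hw⟩ h
  obtain ⟨k, e, he, he0, hk⟩ := exists_redP_zero_eq B hP (one_ne_zero (α := ℂ))
  have h1 : ∀ᶠ u in 𝓝[≠] (1 : ℂ), (u - 1) ^ k * e u ≠ 0 := by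
    have h2 : ∀ᶠ u in 𝓝[≠] (1 : ℂ), e u ≠ 0 :=
      ((he 1 one_ne_zero).continuousAt.eventually_ne he0).filter_mono nhdsWithin_le_nhds
    filter_upwards [h2, self_mem_nhdsWithin] with u hu hu1
    exact mul_ne_zero (pow_ne_zero _ (sub_ne_zero.2 hu1)) hu
  have h3 : ∀ᶠ u in 𝓝[≠] (1 : ℂ), u ≠ 0 :=
    (eventually_ne_nhds one_ne_zero).filter_mono nhdsWithin_le_nhds
  obtain ⟨u, hu, hu0⟩ := (h1.and h3).exists
  rw [← hk u hu0] at hu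
  exact hu (hz (x := (0, u)) ⟨trivial, hu0⟩)

theorem isAnalyticCurve_curve (hP : P ≠ 0) : IsAnalyticCurve (curve P) := by
  intro x
  obtain ⟨B, y, rfl⟩ := exists_chart_eq x
  refine ⟨B, y, fun a => redP B P a.1 a.2, rfl, analyticAt_redP y.2.ne_zero,
    not_eventually_redP_eq_zero hP _ y.2.ne_zero, Eventually.of_forall fun y' => ?_⟩
  exact chart_mem_curve_iff B P y'

/-- Zeros of a holomorphic function of `w` persist under perturbations. -/
theorem exists_zero_near {F : ℂ → ℂ → ℂ} {z₀ w₀ : ℂ}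
    (hF : ∀ᶠ y : ℂ × ℂ in 𝓝 (z₀, w₀), AnalyticAt ℂ (fun y : ℂ × ℂ => F y.1 y.2) y)
    (h0 : F z₀ w₀ = 0) (hne : ¬ ∀ᶠ w in 𝓝 w₀, F z₀ w = 0) {ε : ℝ} (hε : 0 < ε) :
    ∀ᶠ z in 𝓝 z₀, ∃ w, dist w w₀ < ε ∧ F z w = 0 := by
  rw [Metric.eventually_nhds_iff] at hF
  obtain ⟨δ, hδ, hF⟩ := hF
  have hslice : ∀ z w, dist z z₀ < δ → dist w w₀ < δ → AnalyticAt ℂ (F z) w := by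
    intro z w hz hw
    have h1 : AnalyticAt ℂ (fun y : ℂ × ℂ => F y.1 y.2) (z, w) :=
      hF (by rw [Prod.dist_eq]; exact max_lt hz hw)
    exact h1.comp₂ analyticAt_const analyticAt_id
  have hz0 := (hslice z₀ w₀ (by simpa using hδ) (by simpa using hδ)).eventually_eq_zero_or_eventually_ne_zero
  have hz1 := hz0.resolve_left hne
  rw [eventually_nhdsWithin_iff, Metric.eventually_nhds_iff] at hz1
  obtain ⟨δ₁, hδ₁, hz1⟩ := hz1
  -- The circle of radius `r` carries no zero of `F z₀`, so `|F z₀ ·|` has a positive minimum `M` on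
  -- it.
  set r := min (min ε δ) δ₁ / 2 with hr
  have hmin : 0 < min (min ε δ) δ₁ := lt_min (lt_min hε hδ) hδ₁
  have hr0 : 0 < r := half_pos hmin
  have hrlt : r < min (min ε δ) δ₁ := half_lt_self hmin
  have hrε : r < ε := hrlt.trans_le ((min_le_left _ _).trans (min_le_left _ _))
  have hrδ : r < δ := hrlt.trans_le ((min_le_left _ _).trans (min_le_right _ _))
  have hrδ₁ : r < δ₁ := hrlt.trans_le (min_le_right _ _)
  have hcont : ∀ w, dist w w₀ ≤ r → ContinuousAt (fun y : ℂ × ℂ => F y.1 y.2) (z₀, w) := fun w hw =>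
    (hF (by rw [Prod.dist_eq]; exact max_lt (by simpa using hδ) (hw.trans_lt hrδ))).continuousAt
  obtain ⟨w₁, hw₁, hmin₁⟩ := (isCompact_sphere w₀ r).exists_isMinOn
    (NormedSpace.sphere_nonempty.2 hr0.le) (f := fun w => ‖F z₀ w‖) (fun w hw =>
      ((hslice z₀ w (by simpa using hδ) (by rw [Metric.mem_sphere.1 hw]; exact hrδ)).continuousAt.norm).continuousWithinAt)
  set M := ‖F z₀ w₁‖ with hM
  have hM0 : 0 < M := norm_pos_iff.2 (hz1 (by rw [Metric.mem_sphere.1 hw₁]; exact hrδ₁) (by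
    rintro rfl
    simp at hw₁
    exact hr0.ne hw₁))
  have hev1 : ∀ᶠ z in 𝓝 z₀, ∀ w ∈ Metric.sphere w₀ r, M / 2 < ‖F z w‖ := by
    refine (isCompact_sphere w₀ r).eventually_forall_of_forall_eventually fun w hw => ?_
    have h1 := (hcont w (le_of_eq (Metric.mem_sphere.1 hw))).norm
    refine h1.eventually (lt_mem_nhds ?_)
    have := hmin₁ hw
    simp only [Set.mem_ofPred_eq] at this
    linarith
  have hev2 : ∀ᶠ z in 𝓝 z₀, ‖F z w₀‖ < M / 2 := by
    have h1 : ContinuousAt (fun z => F z w₀) z₀ :=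
      ContinuousAt.comp (f := fun z => (z, w₀)) (g := fun y : ℂ × ℂ => F y.1 y.2)
        (hcont w₀ (by simpa using hr0.le)) (by fun_prop)
    refine h1.norm.eventually (gt_mem_nhds ?_)
    simp only [h0, norm_zero]
    exact half_pos hM0
  have hev3 : ∀ᶠ z in 𝓝 z₀, dist z z₀ < δ := Metric.ball_mem_nhds z₀ hδ
  filter_upwards [hev1, hev2, hev3] with z h1 h2 h3
  by_contra hcon
  push Not at hcon
  -- Without a zero, the maximum principle for `1 / F z` would give `|F z w₀| ≥ M / 2`, contrary to
  -- `h2`.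
  have hnz : ∀ w ∈ Metric.closedBall w₀ r, F z w ≠ 0 := fun w hw =>
    hcon w ((Metric.mem_closedBall.1 hw).trans_lt hrε)
  have hd : DiffContOnCl ℂ (fun w => (F z w)⁻¹) (Metric.ball w₀ r) := by
    refine DifferentiableOn.diffContOnCl fun w hw => ?_
    rw [closure_ball w₀ hr0.ne'] at hw
    exact ((hslice z w h3 ((Metric.mem_closedBall.1 hw).trans_lt hrδ)).differentiableAt.inv
      (hnz w hw)).differentiableWithinAt
  have hle := Complex.norm_le_of_forall_mem_frontier_norm_le Metric.isBounded_ball hd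
    (C := (M / 2)⁻¹) (by
      intro w hw
      rw [frontier_ball w₀ hr0.ne'] at hw
      rw [norm_inv]
      exact inv_anti₀ (half_pos hM0) (h1 w hw).le) (z := w₀)
    (subset_closure (Metric.mem_ball_self hr0))
  rw [norm_inv] at hle
  have := (inv_le_inv₀ (norm_pos_iff.2 (hnz w₀ (Metric.mem_closedBall_self hr0.le)))
    (half_pos hM0)).1 hle
  linarith

end ToricSurface

/-! ### Factorization in charts and zeros near a given point -/

namespace ToricSurface

open Filter MvPolynomial

variable {B : Matrix.SpecialLinearGroup (Fin 2) ℤ} {P Q : MvPolynomial (Fin 2) ℂ}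

theorem tendsto_redP {ι : Type*} {l : Filter ι} {z w : ι → ℂ} {z₀ w₀ : ℂ}
    (hw₀ : w₀ ≠ 0) (hz : Tendsto z l (𝓝 z₀)) (hw : Tendsto w l (𝓝 w₀)) :
    Tendsto (fun n => redP B P (z n) (w n)) l (𝓝 (redP B P z₀ w₀)) :=
  tendsto_redW 1 hw₀ hz hw

theorem eventually_redP_zero_ne_zero (B : Matrix.SpecialLinearGroup (Fin 2) ℤ) (hP : P ≠ 0) {w₀ : ℂ}
    (hw₀ : w₀ ≠ 0) : ∀ᶠ w in 𝓝[≠] w₀, redP B P 0 w ≠ 0 := by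
  obtain ⟨k, e, he, he0, hk⟩ := exists_redP_zero_eq B hP hw₀
  have h2 : ∀ᶠ u in 𝓝[≠] w₀, e u ≠ 0 :=
    ((he w₀ hw₀).continuousAt.eventually_ne he0).filter_mono nhdsWithin_le_nhds
  have h3 : ∀ᶠ u in 𝓝[≠] w₀, u ≠ 0 := (eventually_ne_nhds hw₀).filter_mono nhdsWithin_le_nhds
  filter_upwards [h2, h3, self_mem_nhdsWithin] with u hu hu0 hu1
  rw [hk u hu0]
  exact mul_ne_zero (pow_ne_zero _ (sub_ne_zero.2 hu1)) hu

/-- Two expressions for `P * Q` are compared as `z → 0` at a `w` where all three restrictions to the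
pole are nonzero; unequal powers of `z` would force one of these values to be zero. -/
theorem ordB_mul (B : Matrix.SpecialLinearGroup (Fin 2) ℤ) (hP : P ≠ 0) (hQ : Q ≠ 0) :
    ordB B (P * Q) = ordB B P + ordB B Q := by
  obtain ⟨w, ⟨⟨h1, h2⟩, h3⟩, hw0⟩ := (((eventually_redP_zero_ne_zero B hP one_ne_zero).and
    (eventually_redP_zero_ne_zero B hQ one_ne_zero)).and
    (eventually_redP_zero_ne_zero B (mul_ne_zero hP hQ) one_ne_zero) |>.and
    ((eventually_ne_nhds (one_ne_zero (α := ℂ))).filter_mono nhdsWithin_le_nhds)).exists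
  have hid : Tendsto (fun z : ℂ => z) (𝓝[≠] 0) (𝓝 0) := tendsto_nhdsWithin_of_tendsto_nhds tendsto_id
  have t1 := (tendsto_redP (B := B) (P := P) hw0 hid tendsto_const_nhds).mul
    (tendsto_redP (B := B) (P := Q) hw0 hid tendsto_const_nhds)
  have t2 := tendsto_redP (B := B) (P := P * Q) hw0 hid tendsto_const_nhds
  have key : ∀ z : ℂ, z ≠ 0 → z ^ ordB B (P * Q) * redP B (P * Q) z w =
      z ^ (ordB B P + ordB B Q) * (redP B P z w * redP B Q z w) := by
    intro z hz
    have e1 := eval_tor (B := B) P (Units.mk0 z hz) (Units.mk0 w hw0)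
    have e2 := eval_tor (B := B) Q (Units.mk0 z hz) (Units.mk0 w hw0)
    have e3 := eval_tor (B := B) (P * Q) (Units.mk0 z hz) (Units.mk0 w hw0)
    rw [map_mul, e1, e2] at e3
    simp only [Units.val_mk0] at e3
    rw [← e3, zpow_add₀ hz]; ring
  rcases lt_trichotomy (ordB B (P * Q)) (ordB B P + ordB B Q) with h | h | h
  · exfalso
    obtain ⟨n, hn⟩ := Int.le.dest h.le
    have hn0 : n ≠ 0 := by omega
    have t3 : Tendsto (fun z : ℂ => z ^ n * (redP B P z w * redP B Q z w)) (𝓝[≠] 0)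
        (𝓝 (0 ^ n * (redP B P 0 w * redP B Q 0 w))) := (hid.pow n).mul t1
    rw [zero_pow hn0, zero_mul] at t3
    refine h3 (tendsto_nhds_unique t2 (t3.congr' ?_))
    filter_upwards [self_mem_nhdsWithin] with z hz
    have := key z hz
    rw [← hn, zpow_add₀ hz, zpow_natCast, mul_assoc] at this
    exact (mul_left_cancel₀ (zpow_ne_zero _ hz) this).symm
  · exact h
  · exfalso
    obtain ⟨n, hn⟩ := Int.le.dest h.le
    have hn0 : n ≠ 0 := by omega
    have t3 : Tendsto (fun z : ℂ => z ^ n * (redP B (P * Q) z w)) (𝓝[≠] 0)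
        (𝓝 (0 ^ n * (redP B (P * Q) 0 w))) := (hid.pow n).mul t2
    rw [zero_pow hn0, zero_mul] at t3
    refine mul_ne_zero h1 h2 (tendsto_nhds_unique t1 (t3.congr' ?_))
    filter_upwards [self_mem_nhdsWithin] with z hz
    have := key z hz
    rw [← hn, zpow_add₀ hz, zpow_natCast, mul_assoc] at this
    exact mul_left_cancel₀ (zpow_ne_zero _ hz) this

theorem redP_mul (B : Matrix.SpecialLinearGroup (Fin 2) ℤ) (hP : P ≠ 0) (hQ : Q ≠ 0) (z : ℂ) {w : ℂ}
    (hw : w ≠ 0) : redP B (P * Q) z w = redP B P z w * redP B Q z w := by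
  have key : ∀ z : ℂ, z ≠ 0 → redP B (P * Q) z w = redP B P z w * redP B Q z w := by
    intro z hz
    have e1 := eval_tor (B := B) P (Units.mk0 z hz) (Units.mk0 w hw)
    have e2 := eval_tor (B := B) Q (Units.mk0 z hz) (Units.mk0 w hw)
    have e3 := eval_tor (B := B) (P * Q) (Units.mk0 z hz) (Units.mk0 w hw)
    rw [map_mul, e1, e2, ordB_mul B hP hQ] at e3
    simp only [Units.val_mk0] at e3
    rw [zpow_add₀ hz] at e3
    refine (mul_left_cancel₀ (mul_ne_zero (zpow_ne_zero (ordB B P) hz)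
      (zpow_ne_zero (ordB B Q) hz)) ?_).symm
    rw [← e3]; ring
  by_cases hz : z = 0
  · subst hz
    have hid : Tendsto (fun z : ℂ => z) (𝓝[≠] 0) (𝓝 0) :=
      tendsto_nhdsWithin_of_tendsto_nhds tendsto_id
    refine tendsto_nhds_unique (tendsto_redP (B := B) (P := P * Q) hw hid tendsto_const_nhds)
      (((tendsto_redP (B := B) (P := P) hw hid tendsto_const_nhds).mul
        (tendsto_redP (B := B) (P := Q) hw hid tendsto_const_nhds)).congr' ?_)
    filter_upwards [self_mem_nhdsWithin] with z hz using (key z hz).symm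
  · exact key z hz

theorem mem_curve_mul_iff (hP : P ≠ 0) (hQ : Q ≠ 0) {x : LimitSurface} :
    x ∈ curve (P * Q) ↔ x ∈ curve P ∨ x ∈ curve Q := by
  obtain ⟨B, y, rfl⟩ := exists_chart_eq x
  rw [chart_mem_curve_iff, chart_mem_curve_iff, chart_mem_curve_iff, redP_mul B hP hQ _ y.2.ne_zero,
    mul_eq_zero]

/-- The reduction of a coordinate is a power of `w`. Hence prime factors that are monomials
contribute nothing to the closed curves. -/
theorem notMem_curve_X (j : Fin 2) (x : LimitSurface) : x ∉ curve (X j) := by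
  obtain ⟨B, y, rfl⟩ := exists_chart_eq x
  rw [chart_mem_curve_iff]
  simp [redP, redW, support_X, ordB]
  exact zpow_ne_zero _ y.2.ne_zero

theorem notMem_curve_of_isUnit (hP : IsUnit P) (x : LimitSurface) : x ∉ curve P := by
  intro hx
  obtain ⟨Q, hQ⟩ := hP.dvd (a := X 0)
  have h0 : (X 0 : MvPolynomial (Fin 2) ℂ) ≠ 0 := X_ne_zero 0
  rw [hQ] at h0
  refine notMem_curve_X 0 x ?_
  rw [hQ]
  exact (mem_curve_mul_iff (left_ne_zero_of_mul h0) (right_ne_zero_of_mul h0)).2 (.inl hx)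

theorem exists_prime_factor_mem_curve (hP : P ≠ 0) {x : LimitSurface} (hx : x ∈ curve P) :
    ∃ π ∈ UniqueFactorizationMonoid.factors P, Prime π ∧ (∀ j, ¬ π ∣ X j) ∧ π ∣ P ∧ x ∈ curve π := by
  have hmain : ∀ s : Multiset (MvPolynomial (Fin 2) ℂ), (∀ π ∈ s, Prime π) → x ∈ curve s.prod →
      ∃ π ∈ s, x ∈ curve π := by
    intro s
    induction s using Multiset.induction with
    | empty => intro _ h; exact absurd h (notMem_curve_of_isUnit (by simp) x)
    | cons a s ih =>
      intro hs h
      rw [Multiset.prod_cons] at h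
      have hs' : ∀ π ∈ s, Prime π := fun π hπ => hs π (Multiset.mem_cons_of_mem hπ)
      have hne : s.prod ≠ 0 := fun h0 => (hs' 0 (Multiset.prod_eq_zero_iff.1 h0)).ne_zero rfl
      rcases (mem_curve_mul_iff (hs a (Multiset.mem_cons_self a s)).ne_zero hne).1 h with h | h
      · exact ⟨a, Multiset.mem_cons_self a s, h⟩
      · obtain ⟨π, hπ, hx⟩ := ih hs' h
        exact ⟨π, Multiset.mem_cons_of_mem hπ, hx⟩
  have hprime : ∀ π ∈ UniqueFactorizationMonoid.factors P, Prime π :=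
    fun π hπ => UniqueFactorizationMonoid.prime_of_factor π hπ
  obtain ⟨u, hu⟩ := UniqueFactorizationMonoid.factors_prod hP
  have hne : (UniqueFactorizationMonoid.factors P).prod ≠ 0 := by
    intro h; rw [h, zero_mul] at hu; exact hP hu.symm
  rw [← hu] at hx
  have hx' := ((mem_curve_mul_iff hne u.ne_zero).1 hx).resolve_right
    (notMem_curve_of_isUnit u.isUnit x)
  obtain ⟨π, hπ, hxπ⟩ := hmain _ hprime hx'
  refine ⟨π, hπ, hprime π hπ, fun j hj => ?_, UniqueFactorizationMonoid.dvd_of_mem_factors hπ, hxπ⟩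
  obtain ⟨Q, hQ⟩ := hj
  refine notMem_curve_X j x ?_
  have h0 : (X j : MvPolynomial (Fin 2) ℂ) ≠ 0 := X_ne_zero j
  rw [hQ] at h0 ⊢
  exact (mem_curve_mul_iff (left_ne_zero_of_mul h0) (right_ne_zero_of_mul h0)).2 (.inl hxπ)

theorem exists_eval_ne_zero_of_isOpen (hP : P ≠ 0) {O : Set Torus} (hO : IsOpen O)
    (hne : O.Nonempty) : ∃ t ∈ O, eval (cv t) P ≠ 0 := by
  obtain ⟨t, ht⟩ := hne
  by_contra! hcon
  refine not_eventually_redP_eq_zero (B := 1) hP (zc 1 t) (wc 1 t).ne_zero ?_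
  have h1 : Tendsto (fun a : ℂˣ × ℂˣ => tor 1 a.1 a.2) (𝓝 (zc 1 t, wc 1 t)) (𝓝 t) := by
    have := (continuous_tor 1).tendsto (zc 1 t, wc 1 t)
    simpa only [tor_zc_wc] using this
  have h2 : ∀ᶠ a : ℂˣ × ℂˣ in 𝓝 (zc 1 t, wc 1 t), redP 1 P a.1 a.2 = 0 := by
    filter_upwards [h1 (hO.mem_nhds ht)] with a ha
    rw [redP_eq_zero_iff]
    exact hcon _ ha
  have h3 : IsOpenEmbedding (Prod.map ((↑) : ℂˣ → ℂ) ((↑) : ℂˣ → ℂ)) :=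
    Units.isOpenEmbedding_val.prodMap Units.isOpenEmbedding_val
  have h4 := h3.map_nhds_eq (zc 1 t, wc 1 t)
  simp only [Prod.map_apply] at h4
  rw [← h4]
  exact h2

/-- Even at a point of a pole the curve is approached by infinitely many points of `𝕋`, so finitely
many exceptions can always be avoided. -/
theorem infinite_zeros_near (hP : P ≠ 0) {x : LimitSurface} (hx : x ∈ curve P)
    {O : Set LimitSurface} (hO : IsOpen O) (hxO : x ∈ O) :
    {t : Torus | .torus t ∈ O ∧ eval (cv t) P = 0}.Infinite := by
  obtain ⟨B, ⟨z₀, w₀⟩, rfl⟩ := exists_chart_eq x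
  rw [chart_mem_curve_iff] at hx
  simp only at hx
  have hO' : {y : ℂ × ℂ | ∃ h : y.2 ≠ 0, chart B (y.1, Units.mk0 y.2 h) ∈ O} ∈ 𝓝 (z₀, (w₀ : ℂ)) := by
    have h3 : IsOpenEmbedding (Prod.map (id : ℂ → ℂ) ((↑) : ℂˣ → ℂ)) :=
      IsOpenEmbedding.id.prodMap Units.isOpenEmbedding_val
    have h4 := h3.map_nhds_eq (z₀, w₀)
    simp only [Prod.map_apply, id] at h4
    rw [← h4, mem_map]
    filter_upwards [(continuous_chart B).continuousAt.preimage_mem_nhds (hO.mem_nhds hxO)] with y hy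
    exact ⟨y.2.ne_zero, by simpa using hy⟩
  obtain ⟨ε, hε, hball⟩ := Metric.mem_nhds_iff.1 hO'
  have hmem : ∀ z w : ℂ, dist z z₀ < ε → dist w w₀ < ε → z ≠ 0 → redP B P z w = 0 →
      ∃ (z' w' : ℂˣ), (z' : ℂ) = z ∧ (w' : ℂ) = w ∧
        tor B z' w' ∈ {t : Torus | .torus t ∈ O ∧ eval (cv t) P = 0} := by
    intro z w hz hw hz0 h0
    obtain ⟨hw0, hin⟩ := hball (show (z, w) ∈ Metric.ball (z₀, (w₀ : ℂ)) ε by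
      rw [Metric.mem_ball, Prod.dist_eq]; exact max_lt hz hw)
    refine ⟨Units.mk0 z hz0, Units.mk0 w hw0, rfl, rfl, ?_, ?_⟩
    · rw [← chart_coe]; exact hin
    · rw [← redP_eq_zero_iff]; exact h0
  have hninf : ∀ a : ℂ, ∀ s : Set ℂ, (∀ᶠ z in 𝓝[≠] a, z ∈ s) → s.Infinite := by
    intro a s hs hfin
    have h1 : ∀ᶠ z in 𝓝[≠] a, z ∉ s := by
      have : (s \ {a})ᶜ ∈ 𝓝 a := (hfin.subset Set.sdiff_subset).isClosed.isOpen_compl.mem_nhds (by simp)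
      filter_upwards [nhdsWithin_le_nhds this, self_mem_nhdsWithin] with z hz hza hzs
      exact hz ⟨hzs, hza⟩
    obtain ⟨z, hz, hz'⟩ := (hs.and h1).exists
    exact hz' hz
  have hna : ∀ᶠ y : ℂ × ℂ in 𝓝 (z₀, (w₀ : ℂ)), AnalyticAt ℂ (fun y : ℂ × ℂ => redP B P y.1 y.2) y := by
    exact (analyticAt_redP w₀.ne_zero).eventually_analyticAt
  -- Either the line `z = z₀` is locally part of the zero set, and then `z₀ ≠ 0` and `w` varies; or
  -- zeros persist for all `z` near `z₀` by `exists_zero_near`, and `z` varies.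
  by_cases hcase : ∀ᶠ w in 𝓝 (w₀ : ℂ), redP B P z₀ w = 0
  · have hz0 : z₀ ≠ 0 := by
      rintro rfl
      obtain ⟨w, hw, hw'⟩ := ((eventually_redP_zero_ne_zero B hP w₀.ne_zero).and
        (hcase.filter_mono nhdsWithin_le_nhds)).exists
      exact hw hw'
    intro hfin
    refine hninf (w₀ : ℂ) _ ?_ (hfin.image fun t => (wc B t : ℂ))
    filter_upwards [nhdsWithin_le_nhds hcase, nhdsWithin_le_nhds (Metric.ball_mem_nhds _ hε)] with w h1 h2
    obtain ⟨z', w', -, rfl, h⟩ := hmem z₀ w (by simpa using hε) h2 hz0 h1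
    exact ⟨_, h, by simp only [wc_tor]⟩
  · intro hfin
    refine hninf z₀ _ ?_ (hfin.image fun t => (zc B t : ℂ))
    have hz0 : ∀ᶠ z in 𝓝[≠] z₀, z ≠ 0 := by
      by_cases h : z₀ = 0
      · subst h; exact self_mem_nhdsWithin
      · exact (eventually_ne_nhds h).filter_mono nhdsWithin_le_nhds
    filter_upwards [nhdsWithin_le_nhds (exists_zero_near hna hx hcase hε), hz0,
      nhdsWithin_le_nhds (Metric.ball_mem_nhds _ hε)] with z h1 h2 h3
    obtain ⟨w, hw, hw'⟩ := h1
    obtain ⟨z', w', rfl, -, h⟩ := hmem z w h3 hw h2 hw'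
    exact ⟨_, h, by simp only [zc_tor]⟩

end ToricSurface

/-! ### The contracted curves, their image points and the exceptional set -/

namespace ToricSurface

open Filter MvPolynomial

variable {f : RatMap} {P : MvPolynomial (Fin 2) ℂ}

theorem coe_zc (B : Matrix.SpecialLinearGroup (Fin 2) ℤ) (t : Torus) :
    (zc B t : ℂ) = (t 0 : ℂ) ^ B.1 1 1 * (t 1 : ℂ) ^ (-B.1 0 1) := by
  simp [zc]

theorem coe_wc (B : Matrix.SpecialLinearGroup (Fin 2) ℤ) (t : Torus) :
    (wc B t : ℂ) = (t 0 : ℂ) ^ (-B.1 1 0) * (t 1 : ℂ) ^ B.1 0 0 := by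
  simp [wc]

namespace RatMap.Contraction

variable (K : f.Contraction P)

/-- The point to which the curve is contracted. -/
def point : LimitSurface := .pole (firstCol K.B) K.c

/-- The points of the curve at which the other factors of the `fᵢ` are units. -/
def IsGood (x : Fin 2 → ℂ) : Prop :=
  eval x P = 0 ∧ ∀ i, eval x (K.G i) ≠ 0 ∧ eval x (K.H i) ≠ 0

/-- The first coordinate of `f` in a chart at the point of contraction. -/
noncomputable def zExt (x : Fin 2 → ℂ) : ℂ :=
  eval x P ^ K.r * ((eval x (K.G 0) / eval x (K.H 0)) ^ K.B.1 1 1 *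
    (eval x (K.G 1) / eval x (K.H 1)) ^ (-K.B.1 0 1))

/-- The second coordinate of `f` in a chart at the point of contraction. -/
noncomputable def wExt (x : Fin 2 → ℂ) : ℂ :=
  (eval x (K.G 0) / eval x (K.H 0)) ^ (-K.B.1 1 0) *
    (eval x (K.G 1) / eval x (K.H 1)) ^ K.B.1 0 0

theorem val_eq {p : Torus} (hp : p ∈ f.dom) (i : Fin 2) :
    eval (cv p) (K.G i) ≠ 0 ∧ eval (cv p) (K.H i) ≠ 0 ∧ (f.map p i : ℂ) =
      (eval (cv p) P) ^ (K.r * K.B.1 i 0) * (eval (cv p) (K.G i) / eval (cv p) (K.H i)) := by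
  have h := (f.mem_dom_iff.1 hp) i
  rw [K.num_eq, K.den_eq, map_mul, map_mul, map_pow, map_pow] at h
  have hG := right_ne_zero_of_mul h.1
  have hH := right_ne_zero_of_mul h.2
  refine ⟨hG, hH, ?_⟩
  rw [f.coe_map hp, RatMap.val, K.num_eq, K.den_eq, map_mul, map_mul, map_pow, map_pow,
    ← K.ord_eq, mul_div_mul_comm]
  congr 1
  by_cases hP : eval (cv p) P = 0
  · have ha : K.α i = 0 := by
      by_contra h0; exact left_ne_zero_of_mul h.1 (by rw [hP, zero_pow h0])
    have hb : K.β i = 0 := by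
      by_contra h0; exact left_ne_zero_of_mul h.2 (by rw [hP, zero_pow h0])
    simp [ha, hb]
  · rw [zpow_sub₀ hP, zpow_natCast, zpow_natCast]

/-- The orders `α - β` are not both zero, so `P` divides some numerator or denominator, and `dom f`
avoids the curve. -/
theorem eval_ne_zero (K : f.Contraction P) {p : Torus} (hp : p ∈ f.dom) : eval (cv p) P ≠ 0 := by
  intro h0
  have d := det_eq_one K.B
  have hz : ∀ i, K.B.1 i 0 = 0 := by
    intro i
    have h := (f.mem_dom_iff.1 hp) i
    rw [K.num_eq, K.den_eq, map_mul, map_mul, map_pow, map_pow] at h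
    have ha : K.α i = 0 := by
      by_contra h1; exact left_ne_zero_of_mul h.1 (by rw [h0, zero_pow h1])
    have hb : K.β i = 0 := by
      by_contra h1; exact left_ne_zero_of_mul h.2 (by rw [h0, zero_pow h1])
    have := K.ord_eq i
    rw [ha, hb] at this
    have hr := K.r_pos
    simp only [Nat.cast_zero, sub_zero] at this
    rcases mul_eq_zero.1 this.symm with h | h
    · omega
    · exact h
  rw [hz 0, hz 1] at d
  simp at d

theorem coe_zc_map {p : Torus} (hp : p ∈ f.dom) : (zc K.B (f.map p) : ℂ) = K.zExt (cv p) := by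
  obtain ⟨hG0, hH0, h0⟩ := K.val_eq hp 0
  obtain ⟨hG1, hH1, h1⟩ := K.val_eq hp 1
  have hP := K.eval_ne_zero hp
  rw [coe_zc, h0, h1, zExt, mul_zpow, mul_zpow, ← zpow_mul, ← zpow_mul, mul_mul_mul_comm,
    ← zpow_add₀ hP, ← zpow_natCast]
  congr 2
  linear_combination (K.r : ℤ) * det_eq_one K.B

theorem coe_wc_map {p : Torus} (hp : p ∈ f.dom) : (wc K.B (f.map p) : ℂ) = K.wExt (cv p) := by
  obtain ⟨hG0, hH0, h0⟩ := K.val_eq hp 0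
  obtain ⟨hG1, hH1, h1⟩ := K.val_eq hp 1
  have hP := K.eval_ne_zero hp
  rw [coe_wc, h0, h1, wExt, mul_zpow, mul_zpow, ← zpow_mul, ← zpow_mul, mul_mul_mul_comm,
    ← zpow_add₀ hP, show K.r * K.B.1 0 0 * -K.B.1 1 0 + K.r * K.B.1 1 0 * K.B.1 0 0 = 0 by ring,
    zpow_zero, one_mul]

variable {K}

theorem analyticAt_eval_vec (Q : MvPolynomial (Fin 2) ℂ) (y : ℂ × ℂ) :
    AnalyticAt ℂ (fun a : ℂ × ℂ => eval ![a.1, a.2] Q) y := by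
  simp only [eval_eq']
  refine Finset.analyticAt_fun_sum _ fun m _ => analyticAt_const.mul ?_
  simp only [Fin.prod_univ_two, Matrix.cons_val_zero, Matrix.cons_val_one]
  exact (analyticAt_fst.pow _).mul (analyticAt_snd.pow _)

theorem IsGood.analyticAt_zpow {y : ℂ × ℂ} (h : K.IsGood ![y.1, y.2]) (i : Fin 2) (m : ℤ) :
    AnalyticAt ℂ
      (fun a : ℂ × ℂ => (eval ![a.1, a.2] (K.G i) / eval ![a.1, a.2] (K.H i)) ^ m) y :=
  ((analyticAt_eval_vec _ _).div (analyticAt_eval_vec _ _) (h.2 i).2).zpow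
    (div_ne_zero (h.2 i).1 (h.2 i).2)

theorem IsGood.analyticAt_wExt {y : ℂ × ℂ} (h : K.IsGood ![y.1, y.2]) :
    AnalyticAt ℂ (fun a : ℂ × ℂ => K.wExt ![a.1, a.2]) y :=
  (h.analyticAt_zpow 0 _).mul (h.analyticAt_zpow 1 _)

theorem IsGood.analyticAt_zExt {y : ℂ × ℂ} (h : K.IsGood ![y.1, y.2]) :
    AnalyticAt ℂ (fun a : ℂ × ℂ => K.zExt ![a.1, a.2]) y :=
  ((analyticAt_eval_vec P y).pow _).mul ((h.analyticAt_zpow 0 _).mul (h.analyticAt_zpow 1 _))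

theorem IsGood.analyticAt_ext {y : ℂ × ℂ} (h : K.IsGood ![y.1, y.2]) :
    AnalyticAt ℂ (fun a : ℂ × ℂ => (K.zExt ![a.1, a.2], K.wExt ![a.1, a.2])) y :=
  h.analyticAt_zExt.prod h.analyticAt_wExt

theorem IsGood.zExt_eq {x : Fin 2 → ℂ} (h : K.IsGood x) : K.zExt x = 0 := by
  rw [zExt, h.1, zero_pow K.r_pos.ne', zero_mul]

theorem IsGood.wExt_eq {x : Fin 2 → ℂ} (h : K.IsGood x) : K.wExt x = K.c :=
  K.const x h.1 (fun i => (h.2 i).1) fun i => (h.2 i).2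

theorem vec_cv (t : Torus) : ![(cv t 0), (cv t 1)] = cv t := by
  funext i; fin_cases i <;> rfl

theorem IsGood.tendsto_ext {y : Torus} (h : K.IsGood (cv y)) {ι : Type*} {l : Filter ι}
    {p : ι → Torus} (hp : Tendsto p l (𝓝 y)) :
    Tendsto (fun n => (K.zExt (cv (p n)), K.wExt (cv (p n)))) l (𝓝 (0, (K.c : ℂ))) := by
  have h' : K.IsGood ![cv y 0, cv y 1] := by rwa [vec_cv]
  have h1 := (IsGood.analyticAt_ext (y := (cv y 0, cv y 1)) h').continuousAt
  have h2 : Tendsto (fun n => (cv (p n) 0, cv (p n) 1)) l (𝓝 (cv y 0, cv y 1)) := by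
    have := tendsto_pi_nhds.1 ((continuous_cv.tendsto y).comp hp)
    exact (this 0).prodMk_nhds (this 1)
  have h3 := h1.tendsto.comp h2
  simp only [vec_cv, h.zExt_eq, h.wExt_eq, Function.comp_def] at h3
  exact h3

/-- Near a good point of the curve, `f` is close to the point of contraction. -/
theorem IsGood.tendsto_map {y : Torus} (h : K.IsGood (cv y)) {ι : Type*} {l : Filter ι}
    {p : ι → Torus} (hp : Tendsto p l (𝓝 y)) (hd : ∀ᶠ n in l, p n ∈ f.dom) :
    Tendsto (fun n => LimitSurface.torus (f.map (p n))) l (𝓝 K.point) := by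
  have h1 := h.tendsto_ext hp
  rw [nhds_prod_eq, tendsto_prod_iff'] at h1
  refine tendsto_torus_pole_iff.2 ⟨h1.1.congr' ?_, ?_⟩
  · filter_upwards [hd] with n hn using (K.coe_zc_map hn).symm
  · rw [Units.isOpenEmbedding_val.tendsto_nhds_iff]
    refine h1.2.congr' ?_
    filter_upwards [hd] with n hn using (K.coe_wc_map hn).symm

theorem neBot_nhdsWithin_dom (f : RatMap) (y : Torus) : NeBot (𝓝[f.dom] y) := by
  rw [← mem_closure_iff_nhdsWithin_neBot, mem_closure_iff]
  intro O hO hy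
  have hD : (f.num 0 * f.den 0) * (f.num 1 * f.den 1) ≠ 0 :=
    mul_ne_zero (mul_ne_zero (f.num_ne_zero 0) (f.den_ne_zero 0))
      (mul_ne_zero (f.num_ne_zero 1) (f.den_ne_zero 1))
  obtain ⟨t, ht, h⟩ := exists_eval_ne_zero_of_isOpen hD hO ⟨y, hy⟩
  simp only [map_mul, mul_ne_zero_iff] at h
  exact ⟨t, ht, f.mem_dom_iff.2 (Fin.forall_fin_two.2 ⟨h.1, h.2⟩)⟩

theorem IsGood.image_eq {y : Torus} (h : K.IsGood (cv y)) : f.image (.torus y) = {K.point} := by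
  ext q
  rw [Set.mem_singleton_iff]
  constructor
  · rw [f.mem_image_iff]
    rintro ⟨F, hF, h1, h2⟩
    have h3 : Tendsto id (F : Filter Torus) (𝓝 y) := tendsto_torus_iff.1 h1
    exact tendsto_nhds_unique h2 (h.tendsto_map h3 hF)
  · rintro rfl
    have := neBot_nhdsWithin_dom f y
    have hid : Tendsto id (𝓝[f.dom] y) (𝓝 y) := tendsto_nhdsWithin_of_tendsto_nhds tendsto_id
    exact f.mem_image_of_tendsto (l := 𝓝[f.dom] y) (p := id) self_mem_nhdsWithin
      (tendsto_torus_iff.2 hid) (h.tendsto_map hid self_mem_nhdsWithin)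

-- The pair `(zExt, wExt)` is holomorphic near a good point and represents `f` on `dom f`, so it is
-- the required extension.
open Classical in
theorem IsGood.notMem_Ind {y : Torus} (h : K.IsGood (cv y)) : .torus y ∉ f.Ind := by
  rw [RatMap.Ind, Set.mem_ofPred_eq, not_not]
  -- Only the values near `y` matter; the default unit `1` and the values on the poles are
  -- arbitrary.
  let g : LimitSurface → LimitSurface := fun x => match x with
    | .torus t => chart K.B (K.zExt (cv t),
        if hw : K.wExt (cv t) ≠ 0 then Units.mk0 _ hw else 1)
    | .pole v c => .pole v c
  have hgt : ∀ t, g (.torus t) = chart K.B (K.zExt (cv t),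
        if hw : K.wExt (cv t) ≠ 0 then Units.mk0 _ hw else 1) := fun t => rfl
  have hcv : ∀ z w : ℂˣ, cv (tor 1 z w) = ![(z : ℂ), (w : ℂ)] := by
    intro z w
    refine funext (Fin.forall_fin_two.2 ⟨?_, ?_⟩) <;> simp [cv, tor]
  have hy : ![(zc 1 y : ℂ), (wc 1 y : ℂ)] = cv y := by rw [← hcv, tor_zc_wc]
  have hy' : K.IsGood ![((zc 1 y : ℂ), (wc 1 y : ℂ)).1, ((zc 1 y : ℂ), (wc 1 y : ℂ)).2] := by
    rwa [hy]
  refine ⟨g, ⟨1, K.B, ((zc 1 y : ℂ), wc 1 y),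
    fun a : ℂ × ℂ => (K.zExt ![a.1, a.2], K.wExt ![a.1, a.2]), chart_zc_wc 1 y,
    hy'.analyticAt_ext, ?_⟩, ?_⟩
  · have hcont : ContinuousAt (fun a : ℂ × ℂˣ => K.wExt ![a.1, (a.2 : ℂ)]) ((zc 1 y : ℂ), wc 1 y) :=
      ContinuousAt.comp (f := coords) (g := fun a : ℂ × ℂ => K.wExt ![a.1, a.2])
        hy'.analyticAt_wExt.continuousAt isEmbedding_coords.continuous.continuousAt
    have hne : ∀ᶠ a : ℂ × ℂˣ in 𝓝 ((zc 1 y : ℂ), wc 1 y), K.wExt ![a.1, (a.2 : ℂ)] ≠ 0 := by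
      refine hcont.eventually_ne ?_
      simp only [hy, h.wExt_eq]
      exact K.c.ne_zero
    have hz : ∀ᶠ a : ℂ × ℂˣ in 𝓝 ((zc 1 y : ℂ), wc 1 y), a.1 ≠ 0 :=
      continuousAt_fst.eventually_ne (zc 1 y).ne_zero
    filter_upwards [hne, hz] with a ha ha1
    obtain ⟨z, w⟩ := a
    refine ⟨(K.zExt ![z, (w : ℂ)], Units.mk0 _ ha), rfl, ?_⟩
    have : chart 1 (z, w) = .torus (tor 1 (Units.mk0 z ha1) w) := chart_coe 1 (Units.mk0 z ha1) w
    rw [this, hgt]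
    simp only [hcv]
    exact congrArg (fun u => chart K.B (K.zExt ![z, (w : ℂ)], u)) (dif_pos ha)
  · refine Eventually.of_forall fun x p hp hx => ?_
    subst hx
    rw [hgt, ← f.map_eq_apply hp, ← chart_zc_wc K.B (f.map p)]
    have hw : K.wExt (cv p) ≠ 0 := by rw [← K.coe_wc_map hp]; exact Units.ne_zero _
    rw [dif_pos hw, K.coe_zc_map hp]
    congr 2
    ext
    simp [K.coe_wc_map hp]

variable (K)

theorem finite_not_good (hP : Prime P) :
    {t : Torus | eval (cv t) P = 0 ∧ ¬ K.IsGood (cv t)}.Finite := by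
  have hndvd : ¬ P ∣ (K.G 0 * K.H 0) * (K.G 1 * K.H 1) := by
    intro h
    rcases hP.dvd_or_dvd h with h | h <;> rcases hP.dvd_or_dvd h with h | h
    exacts [K.not_dvd_G 0 h, K.not_dvd_H 0 h, K.not_dvd_G 1 h, K.not_dvd_H 1 h]
  refine ((finite_common_zeros hP hndvd).preimage isOpenEmbedding_cv.injective.injOn).subset ?_
  rintro t ⟨h0, h1⟩
  refine ⟨h0, ?_⟩
  by_contra h2
  refine h1 ⟨h0, ?_⟩
  simp only [map_mul, mul_ne_zero_iff] at h2
  exact Fin.forall_fin_two.2 ⟨h2.1, h2.2⟩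

theorem exists_good_mem (hP : Prime P) {x : LimitSurface} (hx : x ∈ curve P)
    {O : Set LimitSurface} (hO : IsOpen O) (hxO : x ∈ O) :
    ∃ t : Torus, .torus t ∈ O ∧ K.IsGood (cv t) := by
  obtain ⟨t, ht, ht'⟩ := ((infinite_zeros_near hP.ne_zero hx hO hxO).sdiff
    (K.finite_not_good hP)).nonempty
  exact ⟨t, ht.1, by_contra fun h => ht' ⟨ht.2, h⟩⟩

/-- The graph is closed and good points accumulate at every point of the curve, including its points
on poles. -/
theorem point_mem_image (hP : Prime P) {x : LimitSurface} (hx : x ∈ curve P) :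
    K.point ∈ f.image x := by
  change (x, K.point) ∈ f.graph
  have hcl : IsClosed f.graph := isClosed_closure
  by_contra hcon
  have h1 : {x' | (x', K.point) ∈ f.graphᶜ} ∈ 𝓝 x :=
    (Continuous.prodMk_left K.point).continuousAt.preimage_mem_nhds (hcl.isOpen_compl.mem_nhds hcon)
  obtain ⟨O, hOs, hO, hxO⟩ := mem_nhds_iff.1 h1
  obtain ⟨t, ht, hg⟩ := K.exists_good_mem hP hx hO hxO
  have h2 : K.point ∈ f.image (.torus t) := by rw [hg.image_eq]; rfl
  exact hOs ht h2

theorem image_eq_of_notMem_Ind (hP : Prime P) {x : LimitSurface} (hx : x ∈ curve P)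
    (hxI : x ∉ f.Ind) : f.image x = {K.point} := by
  obtain ⟨B, B', y, q₀, h, -, -, -, -, himg⟩ := f.exists_analyticAt_of_notMem_Ind hxI
  have h1 := K.point_mem_image hP hx
  have h2 := himg h1
  rw [Set.mem_singleton_iff] at h2
  rw [← h2] at himg
  exact Set.Subset.antisymm himg (Set.singleton_subset_iff.2 h1)

/-- This is the link to the exceptional set: outside `Exc f`, no `fᵢ` has a zero or pole apart from
the poles of the surface. -/
theorem curve_subset_Exc (K : f.Contraction P) (hP : Prime P) : curve P ⊆ f.Exc :=
  Set.subset_sUnion_of_mem ⟨isAnalyticCurve_curve hP.ne_zero, K.point,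
    fun _ hx => K.image_eq_of_notMem_Ind hP hx.1 hx.2⟩

theorem point_mem_excImage (hP : Prime P) {x : LimitSurface} (hx : x ∈ curve P) :
    K.point ∈ f.excImage := by
  obtain ⟨t, -, ht⟩ := K.exists_good_mem hP hx isOpen_univ trivial
  refine Set.mem_biUnion (x := .torus t) ⟨K.curve_subset_Exc hP ?_, ht.notMem_Ind⟩ ?_
  · exact (torus_mem_curve_iff P t).2 ht.1
  · rw [ht.image_eq]; rfl

end RatMap.Contraction

/-- The finitely many irreducible curves along which some `fᵢ` vanishes or has a pole. -/
structure RatMap.Contractions (f : RatMap) where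
  ι : Type
  finite : Finite ι
  P : ι → MvPolynomial (Fin 2) ℂ
  prime : ∀ a, Prime (P a)
  K : ∀ a, f.Contraction (P a)
  nonempty : ∀ a, (curve (P a)).Nonempty
  cover : ∀ x i, (x ∈ curve (f.num i) ∨ x ∈ curve (f.den i)) → ∃ a, x ∈ curve (P a)

-- Only prime factors with a nonempty closed curve are kept: then a good point exists, so the image
-- point really belongs to `excImage`.
open Classical in
theorem RatMap.IsToric.nonempty_contractions {f : RatMap} (hf : f.IsToric) :
    Nonempty f.Contractions := by
  let S : Finset (MvPolynomial (Fin 2) ℂ) :=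
    Finset.univ.biUnion fun i : Fin 2 => (UniqueFactorizationMonoid.factors (f.num i)).toFinset ∪
      (UniqueFactorizationMonoid.factors (f.den i)).toFinset
  let good : MvPolynomial (Fin 2) ℂ → Prop := fun π => Prime π ∧ (∀ j, ¬ π ∣ X j) ∧
    (∃ i, π ∣ f.num i ∨ π ∣ f.den i) ∧ (curve π).Nonempty
  let T := S.filter good
  obtain ⟨e⟩ : Nonempty (Fin T.card ≃ T) := ⟨T.equivFin.symm⟩
  have hT : ∀ a, good (e a) := fun a => (Finset.mem_filter.1 (e a).2).2
  refine ⟨⟨Fin T.card, inferInstance, fun a => e a, fun a => (hT a).1, fun a =>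
    (hf.exists_contraction (hT a).1 (hT a).2.1 (hT a).2.2.1).some, fun a => (hT a).2.2.2, ?_⟩⟩
  rintro x i hx
  suffices ∃ π ∈ T, x ∈ curve π by
    obtain ⟨π, hπ, hx⟩ := this
    exact ⟨e.symm ⟨π, hπ⟩, by simpa using hx⟩
  rcases hx with hx | hx
  · obtain ⟨π, h1, h2, h3, h4, h5⟩ := exists_prime_factor_mem_curve (f.num_ne_zero i) hx
    refine ⟨π, Finset.mem_filter.2 ⟨?_, h2, h3, ⟨i, .inl h4⟩, ⟨x, h5⟩⟩, h5⟩
    exact Finset.mem_biUnion.2 ⟨i, Finset.mem_univ i, Finset.mem_union_left _ (by simpa using h1)⟩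
  · obtain ⟨π, h1, h2, h3, h4, h5⟩ := exists_prime_factor_mem_curve (f.den_ne_zero i) hx
    refine ⟨π, Finset.mem_filter.2 ⟨?_, h2, h3, ⟨i, .inr h4⟩, ⟨x, h5⟩⟩, h5⟩
    exact Finset.mem_biUnion.2 ⟨i, Finset.mem_univ i, Finset.mem_union_right _ (by simpa using h1)⟩

namespace RatMap.Contractions

variable (D : f.Contractions)

theorem curve_subset_Exc (a : D.ι) : curve (D.P a) ⊆ f.Exc := (D.K a).curve_subset_Exc (D.prime a)

theorem point_mem_excImage (a : D.ι) : (D.K a).point ∈ f.excImage :=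
  (D.K a).point_mem_excImage (D.prime a) (D.nonempty a).some_mem

theorem exists_eval_eq_zero {t : Torus} (ht : t ∉ f.dom) : ∃ a, eval (cv t) (D.P a) = 0 := by
  rw [f.mem_dom_iff] at ht
  push Not at ht
  obtain ⟨i, hi⟩ := ht
  have : .torus t ∈ curve (f.num i) ∨ .torus t ∈ curve (f.den i) := by
    rw [torus_mem_curve_iff, torus_mem_curve_iff]
    exact or_iff_not_imp_left.2 hi
  obtain ⟨a, ha⟩ := D.cover _ i this
  exact ⟨a, (torus_mem_curve_iff _ _).1 ha⟩

/-- The points of `𝕋` outside `dom f` at which `f` is not easily understood. -/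
def bad : Set Torus := ⋃ a, {t : Torus | eval (cv t) (D.P a) = 0 ∧ ¬ (D.K a).IsGood (cv t)}

theorem finite_bad : D.bad.Finite :=
  have := D.finite
  Set.finite_iUnion fun a => (D.K a).finite_not_good (D.prime a)

theorem exists_isGood {t : Torus} (ht : t ∉ f.dom) (hb : t ∉ D.bad) :
    ∃ a, (D.K a).IsGood (cv t) := by
  obtain ⟨a, ha⟩ := D.exists_eval_eq_zero ht
  exact ⟨a, by_contra fun h => hb (Set.mem_iUnion.2 ⟨a, ha, h⟩)⟩

/-- At a determinate point outside `dom f` the only value of `f` is a point of a pole, so a value in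
the torus forces membership in `dom f`. -/
theorem mem_dom_of_notMem_Ind (D : f.Contractions) {t s : Torus} (ht : .torus t ∉ f.Ind)
    (hs : .torus s ∈ f.image (.torus t)) : t ∈ f.dom := by
  by_contra h
  obtain ⟨a, ha⟩ := D.exists_eval_eq_zero h
  rw [(D.K a).image_eq_of_notMem_Ind (D.prime a) ((torus_mem_curve_iff _ _).2 ha) ht] at hs
  cases hs

end RatMap.Contractions

end ToricSurface

/-! ### Compactness by ultrafilters and asymptotics of polynomials -/

namespace ToricSurface

open Filter MvPolynomial Asymptotics

variable {ι : Type*}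

/-- An unbounded function on `S` tends to infinity along some ultrafilter on `S`. This reduces each
estimate of the theorem to a bound along one ultrafilter. -/
theorem exists_bound_of_ultrafilter {α : Type*} {S : Set α} {g : α → ℝ}
    (h : ∀ F : Ultrafilter α, S ∈ F → ∃ C, ∀ᶠ x in (F : Filter α), g x ≤ C) :
    ∃ C, ∀ x ∈ S, g x ≤ C := by
  by_contra! hcon
  have hne : NeBot (comap g atTop ⊓ 𝓟 S) := by
    rw [(((atTop_basis (α := ℝ)).comap g).inf_principal S).neBot_iff]
    rintro C -
    obtain ⟨x, hx, hxC⟩ := hcon C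
    exact ⟨x, hxC.le, hx⟩
  have hle := Ultrafilter.of_le (comap g atTop ⊓ 𝓟 S)
  obtain ⟨C, hC⟩ := h (Ultrafilter.of (comap g atTop ⊓ 𝓟 S)) (hle (mem_inf_of_right (mem_principal_self S)))
  have ht : Tendsto g (Ultrafilter.of (comap g atTop ⊓ 𝓟 S) : Filter α) atTop :=
    tendsto_comap.mono_left (hle.trans inf_le_left)
  obtain ⟨x, hx, hx'⟩ := (hC.and (ht.eventually_gt_atTop C)).exists
  exact absurd hx (not_le.2 hx')

theorem bounded_or_tendsto_abs_atTop (F : Ultrafilter ι) (g : ι → ℝ) :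
    (∃ C, ∀ᶠ n in (F : Filter ι), |g n| ≤ C) ∨ Tendsto (fun n => |g n|) F atTop := by
  refine or_iff_not_imp_left.2 fun h => tendsto_atTop.2 fun C => ?_
  push Not at h
  exact (h C).mono fun n hn => le_of_lt hn

theorem exists_tendsto_of_bounded_log {F : Ultrafilter ι} {u : ι → ℂˣ} {C : ℝ}
    (h : ∀ᶠ n in (F : Filter ι), |Real.log ‖(u n : ℂ)‖| ≤ C) : ∃ c, Tendsto u F (𝓝 c) := by
  have hK : IsCompact (Metric.closedBall (0 : ℂ) (Real.exp C) ∩ {z | Real.exp (-C) ≤ ‖z‖}) :=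
    (isCompact_closedBall _ _).inter_right (isClosed_le continuous_const continuous_norm)
  obtain ⟨c, hc, hle⟩ := hK.ultrafilter_le_nhds (F.map fun n => (u n : ℂ)) (by
    rw [le_principal_iff]
    change ∀ᶠ n in (F : Filter ι), _
    filter_upwards [h] with n hn
    have hpos : 0 < ‖(u n : ℂ)‖ := norm_pos_iff.2 (u n).ne_zero
    rw [abs_le] at hn
    refine ⟨?_, ?_⟩
    · rw [mem_closedBall_zero_iff, ← Real.log_le_iff_le_exp hpos]; exact hn.2
    · exact (Real.le_log_iff_exp_le hpos).1 hn.1)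
  have hc0 : c ≠ 0 := by
    rintro rfl
    have := hc.2
    simp only [Set.mem_ofPred_eq, norm_zero] at this
    exact absurd this (not_le.2 (Real.exp_pos _))
  refine ⟨Units.mk0 c hc0, Units.isOpenEmbedding_val.tendsto_nhds_iff.2 ?_⟩
  exact hle

theorem norm_prod_cv (t : Torus) (m : Fin 2 →₀ ℕ) :
    ‖∏ i, cv t i ^ m i‖ = Real.exp (-∑ i, (m i : ℝ) * Log t i) := by
  have h : ∀ i, ‖cv t i ^ m i‖ = Real.exp (-((m i : ℝ) * Log t i)) := by
    intro i
    have hpos : 0 < ‖(t i : ℂ)‖ := norm_pos_iff.2 (t i).ne_zero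
    rw [norm_pow, Log, mul_neg, neg_neg, mul_comm, Real.exp_mul, Real.exp_log hpos, Real.rpow_natCast]
    rfl
  rw [norm_prod, ← Finset.sum_neg_distrib, Real.exp_sum]
  exact Finset.prod_congr rfl fun i _ => h i

theorem tropPoly_le {P : MvPolynomial (Fin 2) ℂ} (hP : P ≠ 0) {m : Fin 2 →₀ ℕ} (hm : m ∈ P.support)
    (w : Fin 2 → ℝ) : tropPoly P hP w ≤ ∑ i, (m i : ℝ) * w i :=
  Finset.inf'_le (fun m : Fin 2 →₀ ℕ => ∑ i, (m i : ℝ) * w i) hm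

/-- If all nonzero characters tend to `0` or `∞`, then every polynomial is dominated by one of its
monomials. -/
theorem isBigO_log_sub_tropPoly {F : Ultrafilter ι} {p : ι → Torus}
    (h : ∀ d : Fin 2 → ℤ, d ≠ 0 →
      Tendsto (fun n => |(d 0 : ℝ) * Log (p n) 0 + d 1 * Log (p n) 1|) F atTop)
    {P : MvPolynomial (Fin 2) ℂ} (hP : P ≠ 0) :
    (∀ᶠ n in (F : Filter ι), eval (cv (p n)) P ≠ 0) ∧
      (fun n => -Real.log ‖eval (cv (p n)) P‖ - tropPoly P hP (Log (p n))) =O[F] fun _ => (1 : ℝ) := by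
  -- Among finitely many monomials the ultrafilter selects one that attains the minimum. The
  -- exponent of any other one exceeds it by a nonnegative quantity whose absolute value tends to
  -- infinity, so its ratio to the selected monomial tends to zero.
  obtain ⟨m₀, hm₀, hmin⟩ : ∃ m₀ ∈ P.support, ∀ᶠ n in (F : Filter ι),
      tropPoly P hP (Log (p n)) = ∑ i, (m₀ i : ℝ) * Log (p n) i := by
    have h1 : ∀ᶠ n in (F : Filter ι), ∃ m₀ ∈ P.support,
        tropPoly P hP (Log (p n)) = ∑ i, (m₀ i : ℝ) * Log (p n) i :=
      Eventually.of_forall fun n => Finset.exists_mem_eq_inf' _ _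
    by_contra! hcon
    have h2 : ∀ᶠ n in (F : Filter ι), ∀ m₀ ∈ P.support,
        tropPoly P hP (Log (p n)) ≠ ∑ i, (m₀ i : ℝ) * Log (p n) i := by
      refine (Finset.eventually_all P.support).2 fun m hm => ?_
      exact hcon m hm
    obtain ⟨n, ⟨m, hm, hn⟩, hn'⟩ := (h1.and h2).exists
    exact hn' m hm hn
  have hterm : ∀ m ∈ P.support, m ≠ m₀ → Tendsto (fun n => coeff m P * (∏ i, cv (p n) i ^ m i) /
      ∏ i, cv (p n) i ^ m₀ i) F (𝓝 0) := by
    intro m hm hne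
    have hd : (fun i => (m i : ℤ) - m₀ i) ≠ 0 := by
      intro h0
      refine hne (Finsupp.ext fun i => ?_)
      have := congrFun h0 i
      simp only [Pi.zero_apply] at this
      omega
    have h1 : Tendsto (fun n => ∑ i, (m i : ℝ) * Log (p n) i - ∑ i, (m₀ i : ℝ) * Log (p n) i) F atTop := by
      refine (h _ hd).congr' ?_
      filter_upwards [hmin] with n hn
      have h2 := tropPoly_le hP hm (Log (p n))
      rw [hn] at h2
      rw [← abs_of_nonneg (sub_nonneg.2 h2)]
      congr 1
      simp only [Fin.sum_univ_two]
      push_cast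
      ring
    rw [tendsto_zero_iff_norm_tendsto_zero]
    have h2 : Tendsto (fun n => ‖coeff m P‖ * Real.exp (-(∑ i, (m i : ℝ) * Log (p n) i -
        ∑ i, (m₀ i : ℝ) * Log (p n) i))) F (𝓝 (‖coeff m P‖ * 0)) :=
      (Real.tendsto_exp_neg_atTop_nhds_zero.comp h1).const_mul _
    rw [mul_zero] at h2
    refine h2.congr fun n => ?_
    rw [norm_div, norm_mul, norm_prod_cv, norm_prod_cv, mul_div_assoc, ← Real.exp_sub]
    congr 2; ring
  have hne0 : ∀ n, (∏ i, cv (p n) i ^ m₀ i) ≠ 0 := fun n =>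
    Finset.prod_ne_zero_iff.2 fun i _ => pow_ne_zero _ (p n i).ne_zero
  have hlim : Tendsto (fun n => eval (cv (p n)) P / ∏ i, cv (p n) i ^ m₀ i) F (𝓝 (coeff m₀ P)) := by
    have h1 : Tendsto (fun n => coeff m₀ P + ∑ m ∈ P.support.erase m₀,
        coeff m P * (∏ i, cv (p n) i ^ m i) / ∏ i, cv (p n) i ^ m₀ i) F
        (𝓝 (coeff m₀ P + ∑ m ∈ P.support.erase m₀, 0)) :=
      tendsto_const_nhds.add (tendsto_finsetSum _ fun m hm =>
        hterm m (Finset.mem_of_mem_erase hm) (Finset.ne_of_mem_erase hm))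
    rw [Finset.sum_const_zero, add_zero] at h1
    refine h1.congr fun n => ?_
    rw [eval_eq', ← Finset.add_sum_erase _ _ hm₀, add_div, mul_div_cancel_right₀ _ (hne0 n),
      Finset.sum_div]
  have hc0 : coeff m₀ P ≠ 0 := mem_support_iff.1 hm₀
  have hne := hlim.eventually_ne hc0
  refine ⟨hne.mono fun n hn => ?_, ?_⟩
  · exact (div_ne_zero_iff.1 hn).1
  · have h1 : Tendsto (fun n => -Real.log ‖eval (cv (p n)) P / ∏ i, cv (p n) i ^ m₀ i‖) F
        (𝓝 (-Real.log ‖coeff m₀ P‖)) := (hlim.norm.log (norm_ne_zero_iff.2 hc0)).neg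
    refine (h1.congr' ?_).isBigO_one ℝ
    filter_upwards [hne, hmin] with n hn hn'
    have h2 := (div_ne_zero_iff.1 hn).1
    rw [norm_div, Real.log_div (norm_ne_zero_iff.2 h2) (norm_ne_zero_iff.2 (hne0 n)), norm_prod_cv,
      Real.log_exp, hn']
    ring

/-- Along an ultrafilter, a family of points of `𝕋` converges in `𝕋`, or it converges to a point of a
pole, or all the polynomials are asymptotic to monomials. -/
theorem trichotomy (F : Ultrafilter ι) (p : ι → Torus) :
    (∃ t, Tendsto p F (𝓝 t)) ∨
    (∃ (B : Matrix.SpecialLinearGroup (Fin 2) ℤ) (c : ℂˣ),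
      Tendsto (fun n => (zc B (p n) : ℂ)) F (𝓝 0) ∧ Tendsto (fun n => wc B (p n)) F (𝓝 c)) ∨
    ∀ (P : MvPolynomial (Fin 2) ℂ) (hP : P ≠ 0),
      (∀ᶠ n in (F : Filter ι), eval (cv (p n)) P ≠ 0) ∧
        (fun n => -Real.log ‖eval (cv (p n)) P‖ - tropPoly P hP (Log (p n))) =O[F]
          fun _ => (1 : ℝ) := by
  by_cases h : ∀ d : Fin 2 → ℤ, d ≠ 0 →
      Tendsto (fun n => |(d 0 : ℝ) * Log (p n) 0 + d 1 * Log (p n) 1|) F atTop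
  · exact .inr (.inr fun P hP => isBigO_log_sub_tropPoly h hP)
  push Not at h
  obtain ⟨d, hd, hnt⟩ := h
  obtain ⟨C, hC⟩ := (bounded_or_tendsto_abs_atTop F _).resolve_right hnt
  -- The first basis vector is taken orthogonal to the bounded character `d`, so that `d` is, up to
  -- sign and the multiple `r`, the second coordinate `w`.
  obtain ⟨B, r, hr, hB⟩ := exists_specialLinear_of_ne_zero (a := ![d 1, -d 0]) (by
    intro h0
    apply hd
    have h1 := congrFun h0 0
    have h2 := congrFun h0 1
    simp at h1 h2
    refine funext (Fin.forall_fin_two.2 ⟨?_, ?_⟩) <;> simp [h1, h2])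
  have hw : ∃ c, Tendsto (fun n => wc B (p n)) F (𝓝 c) := by
    refine exists_tendsto_of_bounded_log (C := C) ?_
    filter_upwards [hC] with n hn
    have h1 := neg_log_wc B (p n)
    have h2 := hB 0
    have h3 := hB 1
    simp only [Matrix.cons_val_zero, Matrix.cons_val_one] at h2 h3
    have h2' : (d 1 : ℝ) = r * B.1 0 0 := by exact_mod_cast h2
    have h3' : (d 0 : ℝ) = -(r * B.1 1 0) := by
      have : d 0 = -(r * B.1 1 0) := by linarith
      exact_mod_cast this
    have h4 : (d 0 : ℝ) * Log (p n) 0 + d 1 * Log (p n) 1 = -(r * Real.log ‖(wc B (p n) : ℂ)‖) := by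
      rw [h2', h3']; linear_combination -(r : ℝ) * h1
    rw [h4, abs_neg, abs_mul, Nat.abs_cast] at hn
    have h5 : (1 : ℝ) ≤ r := by exact_mod_cast hr
    exact (le_mul_of_one_le_left (abs_nonneg _) h5).trans hn
  obtain ⟨c, hc⟩ := hw
  rcases bounded_or_tendsto_abs_atTop F (fun n => Real.log ‖(zc B (p n) : ℂ)‖) with ⟨C', hC'⟩ | ht
  · obtain ⟨c', hc'⟩ := exists_tendsto_of_bounded_log hC'
    refine .inl ⟨tor B c' c, ?_⟩
    have := ((continuous_tor B).tendsto (c', c)).comp (hc'.prodMk_nhds hc)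
    simpa only [Function.comp_def, tor_zc_wc] using this
  · refine .inr (.inl ?_)
    have habs : ∀ (u : ι → ℂˣ), Tendsto (fun n => Real.log ‖(u n : ℂ)‖) F atBot →
        Tendsto (fun n => (u n : ℂ)) F (𝓝 0) := by
      intro u hu
      rw [tendsto_zero_iff_norm_tendsto_zero]
      refine (Real.tendsto_exp_atBot.comp hu).congr fun n => ?_
      exact Real.exp_log (norm_pos_iff.2 (u n).ne_zero)
    rcases Ultrafilter.em F (fun n => Real.log ‖(zc B (p n) : ℂ)‖ < 0) with hs | hs
    · refine ⟨B, c, habs _ ?_, hc⟩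
      rw [← tendsto_neg_atTop_iff]
      refine ht.congr' ?_
      filter_upwards [hs] with n hn using abs_of_neg hn
    -- If `z → ∞`, the points converge to the pole of the opposite ray. In rank two `-B` still has
    -- determinant one, and it inverts both coordinates.
    · let B' : Matrix.SpecialLinearGroup (Fin 2) ℤ := ⟨-B.1, by simp [Matrix.det_neg]⟩
      have hz' : ∀ t, zc B' t = (zc B t)⁻¹ := by
        intro t; simp [zc, B', mul_comm]
      have hw' : ∀ t, wc B' t = (wc B t)⁻¹ := by
        intro t; simp [wc, B', mul_comm]
      refine ⟨B', c⁻¹, habs _ ?_, ?_⟩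
      · rw [← tendsto_neg_atTop_iff]
        refine ht.congr' ?_
        filter_upwards [hs] with n hn
        rw [abs_of_nonneg (not_lt.1 hn), hz', Units.val_inv_eq_inv_val, norm_inv, Real.log_inv, neg_neg]
      · simp only [hw']
        exact hc.inv

theorem exists_seminorm_le (nrm : Seminorm ℝ (Fin 2 → ℝ)) : ∃ C, 0 < C ∧ ∀ w, nrm w ≤ C * ‖w‖ := by
  refine ⟨∑ i, nrm (Pi.single i 1) + 1, by positivity, fun w => ?_⟩
  have h1 : w = ∑ i, w i • (Pi.single i (1 : ℝ) : Fin 2 → ℝ) := by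
    rw [← pi_eq_sum_univ' w]
  calc nrm w = nrm (∑ i, w i • (Pi.single i (1 : ℝ) : Fin 2 → ℝ)) := by rw [← h1]
    _ ≤ ∑ i, nrm (w i • (Pi.single i (1 : ℝ) : Fin 2 → ℝ)) := by
      simp only [Fin.sum_univ_two]; exact map_add_le_add nrm _ _
    _ ≤ ∑ i, ‖w‖ * nrm (Pi.single i (1 : ℝ)) := by
      refine Finset.sum_le_sum fun i _ => ?_
      rw [map_smul_eq_mul]
      exact mul_le_mul_of_nonneg_right (norm_le_pi_norm w i) (apply_nonneg nrm _)
    _ ≤ _ := by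
      rw [← Finset.mul_sum, add_mul, one_mul, mul_comm]
      linarith [norm_nonneg w]

/-- For `Log t = s v + τ u`, a monomial has exponent `s * pr B 0 m + τ * pr B 1 m`. As `s ≥ 0`, the
minimum is `s * ordB B P` up to a multiple of `|τ|`. -/
theorem exists_abs_tropPoly_sub_le (B : Matrix.SpecialLinearGroup (Fin 2) ℤ)
    {P : MvPolynomial (Fin 2) ℂ} (hP : P ≠ 0) : ∃ M, 0 ≤ M ∧ ∀ t : Torus,
      0 ≤ -Real.log ‖(zc B t : ℂ)‖ →
      |tropPoly P hP (Log t) - -Real.log ‖(zc B t : ℂ)‖ * ordB B P| ≤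
        M * |Real.log ‖(wc B t : ℂ)‖| := by
  refine ⟨∑ m ∈ P.support, |(pr B 1 m : ℝ)|, Finset.sum_nonneg fun _ _ => abs_nonneg _, fun t ht => ?_⟩
  have hpair : ∀ m : Fin 2 →₀ ℕ, ∑ i, (m i : ℝ) * Log t i =
      -Real.log ‖(zc B t : ℂ)‖ * pr B 0 m - Real.log ‖(wc B t : ℂ)‖ * pr B 1 m := by
    intro m
    rw [Fin.sum_univ_two, Log_eq B t 0, Log_eq B t 1, pr, pr]
    push_cast; ring
  have hle : ∀ m ∈ P.support, |Real.log ‖(wc B t : ℂ)‖ * pr B 1 m| ≤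
      (∑ m ∈ P.support, |(pr B 1 m : ℝ)|) * |Real.log ‖(wc B t : ℂ)‖| := by
    intro m hm
    rw [abs_mul, mul_comm]
    exact mul_le_mul_of_nonneg_right (Finset.single_le_sum (f := fun m => |(pr B 1 m : ℝ)|)
      (fun _ _ => abs_nonneg _) hm) (abs_nonneg _)
  rw [abs_sub_le_iff]
  constructor
  · obtain ⟨m, hm, hmo⟩ := exists_pr_eq_ordB B hP
    have h1 := tropPoly_le hP hm (Log t)
    rw [hpair, hmo] at h1
    have h2 := (abs_le.1 (hle m hm)).1
    linarith
  · obtain ⟨m, hm, hmo⟩ := Finset.exists_mem_eq_inf' (support_nonempty.2 hP)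
      (fun m : Fin 2 →₀ ℕ => ∑ i, (m i : ℝ) * Log t i)
    have h1 : tropPoly P hP (Log t) = ∑ i, (m i : ℝ) * Log t i := hmo
    rw [h1, hpair]
    have h2 := (abs_le.1 (hle m hm)).2
    have h3 : (ordB B P : ℝ) ≤ pr B 0 m := by exact_mod_cast ordB_le hm
    nlinarith [mul_le_mul_of_nonneg_left h3 ht]

/-- The order of `fᵢ` along the pole of the first vector of a basis. -/
noncomputable def RatMap.ord (f : RatMap) (B : Matrix.SpecialLinearGroup (Fin 2) ℤ) (i : Fin 2) : ℤ :=
  ordB B (f.num i) - ordB B (f.den i)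

theorem RatMap.isBigO_trop_sub (f : RatMap) {l : Filter ι} {p : ι → Torus}
    {B : Matrix.SpecialLinearGroup (Fin 2) ℤ} {c : ℂˣ}
    (hz : Tendsto (fun n => (zc B (p n) : ℂ)) l (𝓝 0)) (hw : Tendsto (fun n => wc B (p n)) l (𝓝 c))
    (i : Fin 2) : (fun n => f.trop (Log (p n)) i - -Real.log ‖(zc B (p n) : ℂ)‖ * f.ord B i) =O[l]
      fun _ => (1 : ℝ) := by
  have hs := (tendsto_neg_log_norm_atTop hz).eventually_ge_atTop 0
  have hlog : (fun n => Real.log ‖(wc B (p n) : ℂ)‖) =O[l] fun _ => (1 : ℝ) := by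
    simpa using ((tendsto_neg_log_norm hw).isBigO_one ℝ).neg_left
  have hP : ∀ (P : MvPolynomial (Fin 2) ℂ) (hP : P ≠ 0),
      (fun n => tropPoly P hP (Log (p n)) - -Real.log ‖(zc B (p n) : ℂ)‖ * ordB B P) =O[l]
      fun _ => (1 : ℝ) := by
    intro P hP
    obtain ⟨M, hM0, hM⟩ := exists_abs_tropPoly_sub_le B hP
    refine (IsBigO.of_bound M ?_).trans hlog
    filter_upwards [hs] with n hn
    exact hM (p n) hn
  refine ((hP _ (f.num_ne_zero i)).sub (hP _ (f.den_ne_zero i))).congr_left fun n => ?_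
  simp only [RatMap.trop, RatMap.ord]
  push_cast; ring

end ToricSurface

/-! ### Restriction of a toric map to a pole -/

namespace ToricSurface

open Filter MvPolynomial Asymptotics

variable {B : Matrix.SpecialLinearGroup (Fin 2) ℤ} {P : MvPolynomial (Fin 2) ℂ} {f : RatMap}

/-- The weights `pr B 0` and `pr B 1` belong to `z ∂/∂z` and `w ∂/∂w`; this is the change of basis
from the Euler fields of `𝕋`. -/
theorem redW_pr (k : Fin 2) (z w : ℂ) :
    (B.1 0 k : ℂ) * redW B P (fun m => m 0) z w + B.1 1 k * redW B P (fun m => m 1) z w =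
      redW B P (fun m => pr B k m) z w := by
  simp only [redW, Finset.mul_sum, ← Finset.sum_add_distrib]
  refine Finset.sum_congr rfl fun m _ => ?_
  simp only [pr]
  push_cast; ring

theorem redW_pr_zero (w : ℂ) : redW B P (fun m => pr B 0 m) 0 w = ordB B P * redP B P 0 w := by
  simp only [redP, redW, Finset.mul_sum]
  refine Finset.sum_congr rfl fun m hm => ?_
  by_cases h : pr B 0 m = ordB B P
  · rw [h]; simp
  · have h1 := ordB_le (B := B) hm
    rw [zero_pow (by omega)]; simp

theorem hasDerivAt_redP_zero {w : ℂ} (hw : w ≠ 0) :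
    HasDerivAt (fun w => redP B P 0 w) (redW B P (fun m => pr B 1 m) 0 w / w) w := by
  simp only [redP, redW, Finset.sum_div]
  refine HasDerivAt.fun_sum fun m _ => ?_
  have h := (((hasDerivAt_zpow (pr B 1 m) w (.inl hw)).const_mul
    ((0 : ℂ) ^ (pr B 0 m - ordB B P).toNat)).const_mul (coeff m P)).const_mul ((1 : (Fin 2 →₀ ℕ) → ℂ) m)
  convert! h using 1
  rw [zpow_sub_one₀ hw]
  simp only [Pi.one_apply]
  field_simp

/-- The invariance of the form `η`, restricted to a pole. -/
theorem RatMap.IsToric.exists_pole_identity (hf : f.IsToric)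
    (B : Matrix.SpecialLinearGroup (Fin 2) ℤ) : ∃ ρ : ℂ, ρ ≠ 0 ∧ ∀ w : ℂ, w ≠ 0 →
      (f.ord B 0 : ℂ) * (redP B (f.num 0) 0 w * redP B (f.den 0) 0 w) *
        (redW B (f.num 1) (fun m => pr B 1 m) 0 w * redP B (f.den 1) 0 w -
          redP B (f.num 1) 0 w * redW B (f.den 1) (fun m => pr B 1 m) 0 w) -
      (f.ord B 1 : ℂ) * (redP B (f.num 1) 0 w * redP B (f.den 1) 0 w) *
        (redW B (f.num 0) (fun m => pr B 1 m) 0 w * redP B (f.den 0) 0 w -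
          redP B (f.num 0) 0 w * redW B (f.den 0) (fun m => pr B 1 m) 0 w) =
      ρ * (redP B (f.num 0) 0 w * redP B (f.den 0) 0 w *
        (redP B (f.num 1) 0 w * redP B (f.den 1) 0 w)) := by
  obtain ⟨ρ, hρ, hid⟩ := hf.exists_identity
  refine ⟨ρ, hρ, fun w hw => ?_⟩
  set W : Fin 2 → Fin 2 → ℂ → ℂ := fun j i z =>
    redW B (f.num i) (fun m => m j) z w * redP B (f.den i) z w -
      redP B (f.num i) z w * redW B (f.den i) (fun m => m j) z w with hW
  have hz : ∀ z : ℂ, z ≠ 0 → W 0 0 z * W 1 1 z - W 1 0 z * W 0 1 z =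
      ρ * (redP B (f.num 0) z w * redP B (f.den 0) z w *
        (redP B (f.num 1) z w * redP B (f.den 1) z w)) := by
    intro z hz
    -- A polynomial and its Euler derivatives carry the same power of `z`. It cancels from the toric
    -- identity, which can then be continued to `z = 0`.
    have hev : ∀ (j : Fin 2) (Q : MvPolynomial (Fin 2) ℂ),
        eval (cv (tor B (Units.mk0 z hz) (Units.mk0 w hw))) (euler j Q) =
          z ^ ordB B Q * redW B Q (fun m => m j) z w := by
      intro j Q
      rw [eval_euler]
      exact sum_eq_zpow_mul_redW (fun m => (m j : ℂ)) (Units.mk0 z hz) (Units.mk0 w hw)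
    have hev' : ∀ Q : MvPolynomial (Fin 2) ℂ,
        eval (cv (tor B (Units.mk0 z hz) (Units.mk0 w hw))) Q = z ^ ordB B Q * redP B Q z w :=
      fun Q => eval_tor Q (Units.mk0 z hz) (Units.mk0 w hw)
    have h1 := congrArg (eval (cv (tor B (Units.mk0 z hz) (Units.mk0 w hw)))) hid
    simp only [RatMap.wron, map_sub, map_mul, eval_C] at h1
    simp only [hev, hev'] at h1
    have hne : z ^ ordB B (f.num 0) * z ^ ordB B (f.den 0) *
        (z ^ ordB B (f.num 1) * z ^ ordB B (f.den 1)) ≠ 0 := by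
      have := fun n : ℤ => zpow_ne_zero n hz
      simp [this]
    refine mul_left_cancel₀ hne ?_
    simp only [hW]
    linear_combination h1
  have hid0 : Tendsto (fun z : ℂ => z) (𝓝[≠] 0) (𝓝 0) := tendsto_nhdsWithin_of_tendsto_nhds tendsto_id
  have hWt : ∀ j i, Tendsto (W j i) (𝓝[≠] 0) (𝓝 (W j i 0)) := fun j i =>
    ((tendsto_redW _ hw hid0 tendsto_const_nhds).mul (tendsto_redP hw hid0 tendsto_const_nhds)).sub
      ((tendsto_redP hw hid0 tendsto_const_nhds).mul (tendsto_redW _ hw hid0 tendsto_const_nhds))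
  have hPt : ∀ Q, Tendsto (fun z => redP B Q z w) (𝓝[≠] 0) (𝓝 (redP B Q 0 w)) := fun Q =>
    tendsto_redP hw hid0 tendsto_const_nhds
  have hlim : W 0 0 0 * W 1 1 0 - W 1 0 0 * W 0 1 0 =
      ρ * (redP B (f.num 0) 0 w * redP B (f.den 0) 0 w *
        (redP B (f.num 1) 0 w * redP B (f.den 1) 0 w)) := by
    refine tendsto_nhds_unique (((hWt 0 0).mul (hWt 1 1)).sub ((hWt 1 0).mul (hWt 0 1)))
      (Tendsto.congr' ?_ ((((hPt _).mul (hPt _)).mul ((hPt _).mul (hPt _))).const_mul ρ))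
    filter_upwards [self_mem_nhdsWithin] with z hz' using (hz z hz').symm
  have hB : (B.1 0 0 : ℂ) * B.1 1 1 - B.1 0 1 * B.1 1 0 = 1 := by exact_mod_cast det_eq_one B
  -- On the pole, `z ∂/∂z` acts on `fᵢ` as multiplication by its order. The change of basis has
  -- determinant one and preserves the identity.
  have hz1 : ∀ i, (B.1 0 0 : ℂ) * W 0 i 0 + B.1 1 0 * W 1 i 0 =
      f.ord B i * (redP B (f.num i) 0 w * redP B (f.den i) 0 w) := by
    intro i
    have h1 := redW_pr (B := B) (P := f.num i) 0 0 w
    have h2 := redW_pr (B := B) (P := f.den i) 0 0 w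
    rw [redW_pr_zero] at h1 h2
    simp only [hW, RatMap.ord]
    push_cast
    linear_combination redP B (f.den i) 0 w * h1 - redP B (f.num i) 0 w * h2
  have hz2 : ∀ i, (B.1 0 1 : ℂ) * W 0 i 0 + B.1 1 1 * W 1 i 0 =
      redW B (f.num i) (fun m => pr B 1 m) 0 w * redP B (f.den i) 0 w -
          redP B (f.num i) 0 w * redW B (f.den i) (fun m => pr B 1 m) 0 w := by
    intro i
    have h1 := redW_pr (B := B) (P := f.num i) 1 0 w
    have h2 := redW_pr (B := B) (P := f.den i) 1 0 w
    simp only [hW]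
    linear_combination redP B (f.den i) 0 w * h1 - redP B (f.num i) 0 w * h2
  rw [← hz1, ← hz1, ← hz2, ← hz2, ← hlim]
  linear_combination (W 0 0 0 * W 1 1 0 - W 1 0 0 * W 0 1 0) * hB

/-- If both orders were zero, the left side of the identity on the pole would vanish, while its
right side is nonzero at a general point. Thus the image of a pole is again a pole. -/
theorem RatMap.IsToric.ord_ne_zero (hf : f.IsToric) (B : Matrix.SpecialLinearGroup (Fin 2) ℤ) :
    f.ord B ≠ 0 := by
  intro h0
  obtain ⟨ρ, hρ, h⟩ := hf.exists_pole_identity B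
  obtain ⟨w, hw⟩ := ((eventually_redP_zero_ne_zero B (f.num_ne_zero 0) one_ne_zero).and
    ((eventually_redP_zero_ne_zero B (f.num_ne_zero 1) one_ne_zero).and
    ((eventually_redP_zero_ne_zero B (f.den_ne_zero 0) one_ne_zero).and
    ((eventually_redP_zero_ne_zero B (f.den_ne_zero 1) one_ne_zero).and
    ((eventually_ne_nhds (one_ne_zero (α := ℂ))).filter_mono nhdsWithin_le_nhds))))).exists
  have h1 := h w hw.2.2.2.2
  rw [h0] at h1
  simp only [Pi.zero_apply, Int.cast_zero, zero_mul, sub_zero] at h1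
  have := mul_ne_zero hρ (mul_ne_zero (mul_ne_zero hw.1 hw.2.2.1) (mul_ne_zero hw.2.1 hw.2.2.2.1))
  exact this h1.symm

theorem RatMap.IsToric.exists_pole_image (hf : f.IsToric)
    (B : Matrix.SpecialLinearGroup (Fin 2) ℤ) :
    ∃ (B' : Matrix.SpecialLinearGroup (Fin 2) ℤ) (r : ℕ), 0 < r ∧ ∀ i, f.ord B i = r * B'.1 i 0 :=
  exists_specialLinear_of_ne_zero (hf.ord_ne_zero B)

/-- This computes `w ∂/∂w` of `(w - w₀) ^ k * e w`; the factor `w - w₀` avoids the exponent `k - 1`.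
-/
theorem mul_redW_eq {w₀ : ℂ} {k : ℕ} {e : ℂ → ℂ} (he : ∀ w, w ≠ 0 → AnalyticAt ℂ e w)
    (hk : ∀ w, w ≠ 0 → redP B P 0 w = (w - w₀) ^ k * e w) {w : ℂ} (hw : w ≠ 0) :
    (w - w₀) * redW B P (fun m => pr B 1 m) 0 w =
      (w - w₀) ^ k * (w * (k * e w + (w - w₀) * deriv e w)) := by
  have h1 := hasDerivAt_redP_zero (B := B) (P := P) hw
  have h2 : HasDerivAt (fun w => (w - w₀) ^ k * e w)
      ((k * (w - w₀) ^ (k - 1) * 1) * e w + (w - w₀) ^ k * deriv e w) w :=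
    (((hasDerivAt_id w).sub_const w₀).pow k).mul (he w hw).differentiableAt.hasDerivAt
  have h3 : (fun w => redP B P 0 w) =ᶠ[𝓝 w] fun w => (w - w₀) ^ k * e w := by
    filter_upwards [eventually_ne_nhds hw] with w hw using hk w hw
  have h4 := h1.unique (h2.congr_of_eventuallyEq h3)
  rw [div_eq_iff hw] at h4
  rw [h4]
  rcases k with _ | k
  · simp; ring
  · simp only [Nat.add_sub_cancel]; ring

/-- The orders of vanishing of the `fᵢ` at a point of a pole are proportional to the orders of the `fᵢ`
along the pole. -/
theorem RatMap.IsToric.ord_mul_eq (hf : f.IsToric) {w₀ : ℂ} (hw₀ : w₀ ≠ 0) {a b : Fin 2 → ℕ}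
    {e g : Fin 2 → ℂ → ℂ} (he : ∀ i w, w ≠ 0 → AnalyticAt ℂ (e i) w)
    (hg : ∀ i w, w ≠ 0 → AnalyticAt ℂ (g i) w) (he0 : ∀ i, e i w₀ ≠ 0) (hg0 : ∀ i, g i w₀ ≠ 0)
    (ha : ∀ i w, w ≠ 0 → redP B (f.num i) 0 w = (w - w₀) ^ a i * e i w)
    (hb : ∀ i w, w ≠ 0 → redP B (f.den i) 0 w = (w - w₀) ^ b i * g i w) :
    f.ord B 0 * ((a 1 : ℤ) - b 1) = f.ord B 1 * ((a 0 : ℤ) - b 0) := by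
  obtain ⟨ρ, -, hid⟩ := hf.exists_pole_identity B
  set E : Fin 2 → ℂ → ℂ := fun i w => w * (a i * e i w + (w - w₀) * deriv (e i) w) with hE
  set G : Fin 2 → ℂ → ℂ := fun i w => w * (b i * g i w + (w - w₀) * deriv (g i) w) with hG
  -- `L` is the identity on the pole, multiplied by `w - w₀` and divided by the common power of `w -
  -- w₀`. Its value at `w₀` is the desired relation times a nonzero factor.
  set L : ℂ → ℂ := fun w => (f.ord B 0 : ℂ) * (e 0 w * g 0 w) * (E 1 w * g 1 w - e 1 w * G 1 w) -
    (f.ord B 1 : ℂ) * (e 1 w * g 1 w) * (E 0 w * g 0 w - e 0 w * G 0 w) -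
    (w - w₀) * (ρ * (e 0 w * g 0 w * (e 1 w * g 1 w))) with hL
  have hcont : ContinuousAt L w₀ := by
    have ce := fun i => (he i w₀ hw₀).continuousAt
    have cg := fun i => (hg i w₀ hw₀).continuousAt
    have cde := fun i => (he i w₀ hw₀).deriv.continuousAt
    have cdg := fun i => (hg i w₀ hw₀).deriv.continuousAt
    have cE : ∀ i, ContinuousAt (E i) w₀ := fun i =>
      continuousAt_id.mul ((continuousAt_const.mul (ce i)).add
        ((continuousAt_id.sub continuousAt_const).mul (cde i)))
    have cG : ∀ i, ContinuousAt (G i) w₀ := fun i =>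
      continuousAt_id.mul ((continuousAt_const.mul (cg i)).add
        ((continuousAt_id.sub continuousAt_const).mul (cdg i)))
    exact ((((continuousAt_const.mul ((ce 0).mul (cg 0))).mul
      (((cE 1).mul (cg 1)).sub ((ce 1).mul (cG 1)))).sub
      ((continuousAt_const.mul ((ce 1).mul (cg 1))).mul
      (((cE 0).mul (cg 0)).sub ((ce 0).mul (cG 0))))).sub
      ((continuousAt_id.sub continuousAt_const).mul
      (continuousAt_const.mul (((ce 0).mul (cg 0)).mul ((ce 1).mul (cg 1))))))
  have hz : ∀ᶠ w in 𝓝[≠] w₀, L w = 0 := by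
    filter_upwards [(eventually_ne_nhds hw₀).filter_mono nhdsWithin_le_nhds,
      self_mem_nhdsWithin] with w hw hne
    have hne' : w - w₀ ≠ 0 := sub_ne_zero.2 hne
    have h1 := hid w hw
    have m1 := fun i => mul_redW_eq (he i) (ha i) hw
    have m2 := fun i => mul_redW_eq (hg i) (hb i) hw
    have h2 : (w - w₀) ^ (a 0 + b 0 + (a 1 + b 1)) * L w = 0 := by
      rw [ha 0 w hw, hb 0 w hw, ha 1 w hw, hb 1 w hw] at h1
      simp only [hL, hE, hG]
      rw [pow_add, pow_add, pow_add]
      linear_combination (w - w₀) * h1 - (f.ord B 0 * ((w - w₀) ^ a 0 * e 0 w * ((w - w₀) ^ b 0 * g 0 w)) *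
        ((w - w₀) ^ b 1 * g 1 w)) * m1 1 + (f.ord B 0 * ((w - w₀) ^ a 0 * e 0 w * ((w - w₀) ^ b 0 * g 0 w)) *
        ((w - w₀) ^ a 1 * e 1 w)) * m2 1
        + (f.ord B 1 * ((w - w₀) ^ a 1 * e 1 w * ((w - w₀) ^ b 1 * g 1 w)) *
        ((w - w₀) ^ b 0 * g 0 w)) * m1 0 - (f.ord B 1 * ((w - w₀) ^ a 1 * e 1 w * ((w - w₀) ^ b 1 * g 1 w)) *
        ((w - w₀) ^ a 0 * e 0 w)) * m2 0
    exact (mul_eq_zero.1 h2).resolve_left (pow_ne_zero _ hne')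
  have h0 : L w₀ = 0 := by
    refine tendsto_nhds_unique (hcont.tendsto.mono_left nhdsWithin_le_nhds : Tendsto L (𝓝[≠] w₀) _) ?_
    exact tendsto_const_nhds.congr' (hz.mono fun w hw => hw.symm)
  have h1 : (w₀ * (e 0 w₀ * g 0 w₀ * (e 1 w₀ * g 1 w₀))) *
      ((f.ord B 0 : ℂ) * (a 1 - b 1) - f.ord B 1 * (a 0 - b 0)) = 0 := by
    rw [← h0]
    simp only [hL, hE, hG, sub_self]
    ring
  have h2 := (mul_eq_zero.1 h1).resolve_left (mul_ne_zero hw₀ (mul_ne_zero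
    (mul_ne_zero (he0 0) (hg0 0)) (mul_ne_zero (he0 1) (hg0 1))))
  exact_mod_cast sub_eq_zero.1 h2

/-- A polynomial near a point of a pole, away from a thin neighbourhood of a transversal line. -/
theorem tendsto_redP_div {w₀ : ℂ} (hw₀ : w₀ ≠ 0) {k : ℕ} {e : ℂ → ℂ}
    (he : ∀ w, w ≠ 0 → AnalyticAt ℂ e w) (hk : ∀ w, w ≠ 0 → redP B P 0 w = (w - w₀) ^ k * e w)
    {N : ℕ} (hN : k < N) {ι : Type*} {l : Filter ι} {z w : ι → ℂ} (hz : Tendsto z l (𝓝 0))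
    (hw : Tendsto w l (𝓝 w₀)) (hzw : ∀ᶠ n in l, w n ≠ w₀ ∧ ‖z n‖ ≤ ‖w n - w₀‖ ^ N) :
    Tendsto (fun n => redP B P (z n) (w n) / (w n - w₀) ^ k) l (𝓝 (e w₀)) := by
  -- The error `redP z w - redP 0 w` is `O(|z|)`, and `|z| ≤ |w - w₀| ^ N` with `N > k` makes it
  -- negligible against `(w - w₀) ^ k`.
  have hd := (analyticAt_redP (B := B) (P := P) (y := (0, w₀)) hw₀).hasStrictFDerivAt.isBigO_sub
  obtain ⟨C, hC⟩ := hd.bound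
  have ht : Tendsto (fun n => (((z n, w n) : ℂ × ℂ), ((0, w n) : ℂ × ℂ))) l (𝓝 ((0, w₀), (0, w₀))) :=
    (hz.prodMk_nhds hw).prodMk_nhds (tendsto_const_nhds.prodMk_nhds hw)
  have hsmall : Tendsto (fun n => (redP B P (z n) (w n) - redP B P 0 (w n)) / (w n - w₀) ^ k) l (𝓝 0) := by
    have h0 : Tendsto (fun n => |C| * ‖w n - w₀‖) l (𝓝 (|C| * ‖w₀ - w₀‖)) :=
      ((hw.sub_const w₀).norm).const_mul _
    rw [sub_self, norm_zero, mul_zero] at h0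
    have hw1 : ∀ᶠ n in l, ‖w n - w₀‖ ≤ 1 := by
      have h1 : Tendsto (fun n => ‖w n - w₀‖) l (𝓝 ‖w₀ - w₀‖) := (hw.sub_const w₀).norm
      rw [sub_self, norm_zero] at h1
      exact h1.eventually_le_const one_pos
    refine squeeze_zero_norm' ?_ h0
    filter_upwards [ht.eventually hC, hzw, hw1] with n h1 h2 h3
    have hpos : 0 < ‖w n - w₀‖ := norm_pos_iff.2 (sub_ne_zero.2 h2.1)
    simp only [Prod.mk_sub_mk, sub_self, sub_zero, Prod.norm_mk, norm_zero,
      max_eq_left (norm_nonneg _)] at h1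
    rw [norm_div, norm_pow, div_le_iff₀ (pow_pos hpos k)]
    calc _ ≤ C * ‖z n‖ := h1
      _ ≤ |C| * ‖z n‖ := mul_le_mul_of_nonneg_right (le_abs_self C) (norm_nonneg _)
      _ ≤ |C| * ‖w n - w₀‖ ^ (k + 1) := by
        refine mul_le_mul_of_nonneg_left (h2.2.trans ?_) (abs_nonneg _)
        exact pow_le_pow_of_le_one hpos.le h3 hN
      _ = _ := by rw [pow_succ']; ring
  have h1 : Tendsto (fun n => e (w n) + (redP B P (z n) (w n) - redP B P 0 (w n)) / (w n - w₀) ^ k) l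
      (𝓝 (e w₀ + 0)) := ((he w₀ hw₀).continuousAt.tendsto.comp hw).add hsmall
  rw [add_zero] at h1
  refine h1.congr' ?_
  filter_upwards [hzw, hw.eventually_ne hw₀] with n hn hn0
  have hne := pow_ne_zero k (sub_ne_zero.2 hn.1)
  rw [hk _ hn0, sub_div, mul_div_cancel_left₀ _ hne]
  ring

/-- `fᵢ` in a toric chart, divided by a power of `z`. -/
noncomputable def RatMap.red (f : RatMap) (B : Matrix.SpecialLinearGroup (Fin 2) ℤ) (i : Fin 2)
    (z w : ℂ) : ℂ := redP B (f.num i) z w / redP B (f.den i) z w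

/-- The first coordinate of `f` in toric charts, divided by a power of `z`. -/
noncomputable def RatMap.zRed (f : RatMap) (B B' : Matrix.SpecialLinearGroup (Fin 2) ℤ)
    (z w : ℂ) : ℂ := f.red B 0 z w ^ B'.1 1 1 * f.red B 1 z w ^ (-B'.1 0 1)

/-- The second coordinate of `f` in toric charts. -/
noncomputable def RatMap.wRed (f : RatMap) (B B' : Matrix.SpecialLinearGroup (Fin 2) ℤ)
    (z w : ℂ) : ℂ := f.red B 0 z w ^ (-B'.1 1 0) * f.red B 1 z w ^ B'.1 0 0

/-- The points of a toric chart that are on none of the curves `numᵢ = 0`, `denᵢ = 0`. -/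
def RatMap.Regular (f : RatMap) (B : Matrix.SpecialLinearGroup (Fin 2) ℤ) (z w : ℂ) : Prop :=
  ∀ i, redP B (f.num i) z w ≠ 0 ∧ redP B (f.den i) z w ≠ 0

theorem RatMap.tor_mem_dom_iff {z w : ℂˣ} : tor B z w ∈ f.dom ↔ f.Regular B z w := by
  rw [f.mem_dom_iff]
  simp only [RatMap.Regular, ne_eq, redP_eq_zero_iff]

theorem RatMap.mem_dom_iff_regular {p : Torus} : p ∈ f.dom ↔ f.Regular B (zc B p) (wc B p) := by
  rw [← RatMap.tor_mem_dom_iff, tor_zc_wc]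

theorem RatMap.coe_map_tor {p : Torus} (hp : p ∈ f.dom) (i : Fin 2) :
    (f.map p i : ℂ) = (zc B p : ℂ) ^ f.ord B i * f.red B i (zc B p) (wc B p) := by
  rw [f.coe_map hp, RatMap.val]
  have h : ∀ Q, eval (cv p) Q = (zc B p : ℂ) ^ ordB B Q * redP B Q (zc B p) (wc B p) := by
    intro Q
    rw [← eval_tor, tor_zc_wc]
  rw [h, h, RatMap.ord, RatMap.red, zpow_sub₀ (zc B p).ne_zero, mul_div_mul_comm]

theorem RatMap.coe_zc_map {B' : Matrix.SpecialLinearGroup (Fin 2) ℤ} {r : ℕ}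
    (hr : ∀ i, f.ord B i = r * B'.1 i 0) {p : Torus} (hp : p ∈ f.dom) :
    (zc B' (f.map p) : ℂ) = (zc B p : ℂ) ^ r * f.zRed B B' (zc B p) (wc B p) := by
  rw [coe_zc, RatMap.coe_map_tor (B := B) hp, RatMap.coe_map_tor (B := B) hp, mul_zpow, mul_zpow,
    ← zpow_mul, ← zpow_mul, mul_mul_mul_comm, ← zpow_add₀ (zc B p).ne_zero, RatMap.zRed, hr, hr,
    ← zpow_natCast]
  congr 2
  linear_combination (r : ℤ) * det_eq_one B'

theorem RatMap.coe_wc_map {B' : Matrix.SpecialLinearGroup (Fin 2) ℤ} {r : ℕ}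
    (hr : ∀ i, f.ord B i = r * B'.1 i 0) {p : Torus} (hp : p ∈ f.dom) :
    (wc B' (f.map p) : ℂ) = f.wRed B B' (zc B p) (wc B p) := by
  rw [coe_wc, RatMap.coe_map_tor (B := B) hp, RatMap.coe_map_tor (B := B) hp, mul_zpow, mul_zpow,
    ← zpow_mul, ← zpow_mul, mul_mul_mul_comm, ← zpow_add₀ (zc B p).ne_zero, RatMap.wRed, hr, hr,
    show r * B'.1 0 0 * -B'.1 1 0 + r * B'.1 1 0 * B'.1 0 0 = 0 by ring, zpow_zero, one_mul]

section Regular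

variable {ι : Type*} {l : Filter ι} {z w : ι → ℂ} {z₀ w₀ : ℂ}

theorem RatMap.Regular.eventually (h : f.Regular B z₀ w₀) (hw₀ : w₀ ≠ 0) (hz : Tendsto z l (𝓝 z₀))
    (hw : Tendsto w l (𝓝 w₀)) : ∀ᶠ n in l, f.Regular B (z n) (w n) :=
  eventually_all.2 fun i => ((tendsto_redP hw₀ hz hw).eventually_ne (h i).1).and
    ((tendsto_redP hw₀ hz hw).eventually_ne (h i).2)

theorem RatMap.Regular.red_ne_zero (h : f.Regular B z₀ w₀) (i : Fin 2) : f.red B i z₀ w₀ ≠ 0 :=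
  div_ne_zero (h i).1 (h i).2

theorem RatMap.Regular.zRed_ne_zero (h : f.Regular B z₀ w₀)
    (B' : Matrix.SpecialLinearGroup (Fin 2) ℤ) : f.zRed B B' z₀ w₀ ≠ 0 :=
  mul_ne_zero (zpow_ne_zero _ (h.red_ne_zero 0)) (zpow_ne_zero _ (h.red_ne_zero 1))

theorem RatMap.Regular.wRed_ne_zero (h : f.Regular B z₀ w₀)
    (B' : Matrix.SpecialLinearGroup (Fin 2) ℤ) : f.wRed B B' z₀ w₀ ≠ 0 :=
  mul_ne_zero (zpow_ne_zero _ (h.red_ne_zero 0)) (zpow_ne_zero _ (h.red_ne_zero 1))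

theorem RatMap.Regular.tendsto_red (h : f.Regular B z₀ w₀) (hw₀ : w₀ ≠ 0)
    (hz : Tendsto z l (𝓝 z₀)) (hw : Tendsto w l (𝓝 w₀)) (i : Fin 2) :
    Tendsto (fun n => f.red B i (z n) (w n)) l (𝓝 (f.red B i z₀ w₀)) :=
  (tendsto_redP hw₀ hz hw).div (tendsto_redP hw₀ hz hw) (h i).2

theorem RatMap.Regular.tendsto_zRed (h : f.Regular B z₀ w₀) (hw₀ : w₀ ≠ 0)
    (hz : Tendsto z l (𝓝 z₀)) (hw : Tendsto w l (𝓝 w₀)) (B' : Matrix.SpecialLinearGroup (Fin 2) ℤ) :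
    Tendsto (fun n => f.zRed B B' (z n) (w n)) l (𝓝 (f.zRed B B' z₀ w₀)) :=
  ((h.tendsto_red hw₀ hz hw 0).zpow₀ _ (.inl (h.red_ne_zero 0))).mul
    ((h.tendsto_red hw₀ hz hw 1).zpow₀ _ (.inl (h.red_ne_zero 1)))

theorem RatMap.Regular.tendsto_wRed (h : f.Regular B z₀ w₀) (hw₀ : w₀ ≠ 0)
    (hz : Tendsto z l (𝓝 z₀)) (hw : Tendsto w l (𝓝 w₀)) (B' : Matrix.SpecialLinearGroup (Fin 2) ℤ) :
    Tendsto (fun n => f.wRed B B' (z n) (w n)) l (𝓝 (f.wRed B B' z₀ w₀)) :=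
  ((h.tendsto_red hw₀ hz hw 0).zpow₀ _ (.inl (h.red_ne_zero 0))).mul
    ((h.tendsto_red hw₀ hz hw 1).zpow₀ _ (.inl (h.red_ne_zero 1)))

theorem RatMap.eventually_regular_zero (f : RatMap) (B : Matrix.SpecialLinearGroup (Fin 2) ℤ)
    (hw₀ : w₀ ≠ 0) : ∀ᶠ w in 𝓝[≠] w₀, f.Regular B 0 w :=
  eventually_all.2 fun i => (eventually_redP_zero_ne_zero B (f.num_ne_zero i) hw₀).and
    (eventually_redP_zero_ne_zero B (f.den_ne_zero i) hw₀)

end Regular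

/-- The behaviour of a toric map near a point of a pole, away from a thin neighbourhood of a
transversal line. -/
theorem RatMap.IsToric.exists_pole_limit (hf : f.IsToric)
    {B' : Matrix.SpecialLinearGroup (Fin 2) ℤ} {r : ℕ} (hr0 : 0 < r)
    (hr : ∀ i, f.ord B i = r * B'.1 i 0) {w₀ : ℂ} (hw₀ : w₀ ≠ 0) :
    ∃ (N : ℕ) (k : ℤ) (c d : ℂ), c ≠ 0 ∧ d ≠ 0 ∧ k.natAbs < N ∧
      ∀ {ι : Type} (l : Filter ι) (z w : ι → ℂ), Tendsto z l (𝓝 0) → Tendsto w l (𝓝 w₀) →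
        (∀ᶠ n in l, w n ≠ w₀ ∧ ‖z n‖ ≤ ‖w n - w₀‖ ^ N) →
        (∀ᶠ n in l, f.Regular B (z n) (w n)) ∧
        Tendsto (fun n => f.wRed B B' (z n) (w n)) l (𝓝 c) ∧
        Tendsto (fun n => f.zRed B B' (z n) (w n) / (w n - w₀) ^ k) l (𝓝 d) := by
  choose a e he he0 ha using fun i => exists_redP_zero_eq B (f.num_ne_zero i) hw₀
  choose b g hg hg0 hb using fun i => exists_redP_zero_eq B (f.den_ne_zero i) hw₀
  have hab := hf.ord_mul_eq hw₀ he hg he0 hg0 ha hb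
  rw [hr, hr, mul_assoc, mul_assoc] at hab
  -- The character that gives the second coordinate of `f` has order zero at `w₀`, so its limit is
  -- neither zero nor infinity.
  have hab' : -B'.1 1 0 * ((a 0 : ℤ) - b 0) + B'.1 0 0 * ((a 1 : ℤ) - b 1) = 0 := by
    have := mul_left_cancel₀ (by exact_mod_cast hr0.ne' : (r : ℤ) ≠ 0) hab
    linarith
  set k : ℤ := B'.1 1 1 * ((a 0 : ℤ) - b 0) - B'.1 0 1 * ((a 1 : ℤ) - b 1) with hk
  set ε : Fin 2 → ℂ := fun i => e i w₀ / g i w₀ with hε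
  have hε0 : ∀ i, ε i ≠ 0 := fun i => div_ne_zero (he0 i) (hg0 i)
  -- `N` exceeds all the orders of vanishing, as `tendsto_redP_div` requires, and also `|k|`, so
  -- that `z ^ r * (w - w₀) ^ k` tends to zero in the region.
  refine ⟨a 0 + a 1 + b 0 + b 1 + k.natAbs + 1, k, ε 0 ^ (-B'.1 1 0) * ε 1 ^ B'.1 0 0,
    ε 0 ^ B'.1 1 1 * ε 1 ^ (-B'.1 0 1), mul_ne_zero (zpow_ne_zero _ (hε0 0)) (zpow_ne_zero _ (hε0 1)),
    mul_ne_zero (zpow_ne_zero _ (hε0 0)) (zpow_ne_zero _ (hε0 1)), by omega, ?_⟩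
  intro ι l z w hz hw hzw
  have hna : ∀ i, a i < a 0 + a 1 + b 0 + b 1 + k.natAbs + 1 :=
    Fin.forall_fin_two.2 ⟨by omega, by omega⟩
  have hnb : ∀ i, b i < a 0 + a 1 + b 0 + b 1 + k.natAbs + 1 :=
    Fin.forall_fin_two.2 ⟨by omega, by omega⟩
  have h1 := fun i => tendsto_redP_div hw₀ (he i) (ha i) (hna i) hz hw hzw
  have h2 := fun i => tendsto_redP_div hw₀ (hg i) (hb i) (hnb i) hz hw hzw
  have h3 : ∀ i, Tendsto (fun n => f.red B i (z n) (w n) / (w n - w₀) ^ ((a i : ℤ) - b i)) l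
      (𝓝 (ε i)) := by
    intro i
    refine ((h1 i).div (h2 i) (hg0 i)).congr' ?_
    filter_upwards [hzw] with n hn
    have hne := sub_ne_zero.2 hn.1
    simp only [Pi.div_apply]
    rw [zpow_sub₀ hne, zpow_natCast, zpow_natCast, RatMap.red, div_div_div_eq, div_div_div_eq]
    congr 1; ring
  refine ⟨eventually_all.2 fun i => ?_, ?_, ?_⟩
  · filter_upwards [(h1 i).eventually_ne (he0 i), (h2 i).eventually_ne (hg0 i)] with n hn1 hn2
    exact ⟨(div_ne_zero_iff.1 hn1).1, (div_ne_zero_iff.1 hn2).1⟩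
  · refine (((h3 0).zpow₀ _ (.inl (hε0 0))).mul ((h3 1).zpow₀ _ (.inl (hε0 1)))).congr' ?_
    filter_upwards [hzw] with n hn
    have hne := sub_ne_zero.2 hn.1
    rw [RatMap.wRed, div_zpow, div_zpow, ← zpow_mul, ← zpow_mul, div_mul_div_comm, ← zpow_add₀ hne,
      show ((a 0 : ℤ) - b 0) * -B'.1 1 0 + ((a 1 : ℤ) - b 1) * B'.1 0 0 = 0 by linarith,
      zpow_zero, div_one]
  · refine (((h3 0).zpow₀ _ (.inl (hε0 0))).mul ((h3 1).zpow₀ _ (.inl (hε0 1)))).congr' ?_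
    filter_upwards [hzw] with n hn
    have hne := sub_ne_zero.2 hn.1
    rw [RatMap.zRed, div_zpow, div_zpow, ← zpow_mul, ← zpow_mul, div_mul_div_comm, ← zpow_add₀ hne]
    congr 2
    rw [hk]; ring

end ToricSurface

/-! ### The estimates away from the exceptional set and from the indeterminacy -/

namespace ToricSurface

open Filter MvPolynomial Asymptotics

variable {ι : Type*} {f : RatMap} {B B' : Matrix.SpecialLinearGroup (Fin 2) ℤ}

theorem continuous_Log : Continuous Log := by
  refine continuous_pi fun i => Continuous.neg (Continuous.log ?_ fun t => norm_ne_zero_iff.2 (t i).ne_zero)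
  exact (Units.continuous_val.comp (continuous_apply i)).norm

theorem continuous_tropPoly {P : MvPolynomial (Fin 2) ℂ} (hP : P ≠ 0) :
    Continuous (tropPoly P hP) := by
  unfold tropPoly
  refine Continuous.finset_inf'_apply _ fun m _ => ?_
  fun_prop

theorem RatMap.continuous_trop (f : RatMap) : Continuous f.trop :=
  continuous_pi fun _ => (continuous_tropPoly _).sub (continuous_tropPoly _)

theorem exists_seminorm_le_of_isBigO (nrm : Seminorm ℝ (Fin 2 → ℝ)) {l : Filter ι}
    {u : ι → Fin 2 → ℝ} (hu : u =O[l] fun _ => (1 : ℝ)) : ∃ C, ∀ᶠ n in l, nrm (u n) ≤ C := by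
  obtain ⟨K, hK0, hK⟩ := exists_seminorm_le nrm
  obtain ⟨C, hC⟩ := hu.bound
  refine ⟨K * C, hC.mono fun n hn => (hK _).trans (mul_le_mul_of_nonneg_left ?_ hK0.le)⟩
  simpa using hn

theorem RatMap.Log_map {p : Torus} (hp : p ∈ f.dom) (i : Fin 2) :
    Log (f.map p) i = -Real.log ‖eval (cv p) (f.num i)‖ - -Real.log ‖eval (cv p) (f.den i)‖ := by
  have h := f.mem_dom_iff.1 hp i
  rw [Log, f.coe_map hp, RatMap.val, norm_div, Real.log_div (norm_ne_zero_iff.2 h.1)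
    (norm_ne_zero_iff.2 h.2)]
  ring

theorem RatMap.isBigO_of_generic {F : Filter ι} {p : ι → Torus}
    (h : ∀ (P : MvPolynomial (Fin 2) ℂ) (hP : P ≠ 0),
      (∀ᶠ n in F, eval (cv (p n)) P ≠ 0) ∧
        (fun n => -Real.log ‖eval (cv (p n)) P‖ - tropPoly P hP (Log (p n))) =O[F]
          fun _ => (1 : ℝ)) :
    (fun n => Log (f.map (p n)) - f.trop (Log (p n))) =O[F] fun _ => (1 : ℝ) := by
  have hd : ∀ᶠ n in F, p n ∈ f.dom := eventually_all.2 fun i =>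
    (h _ (f.num_ne_zero i)).1.and (h _ (f.den_ne_zero i)).1
  refine isBigO_pi.2 fun i => ?_
  refine ((h _ (f.num_ne_zero i)).2.sub (h _ (f.den_ne_zero i)).2).congr' ?_ EventuallyEq.rfl
  filter_upwards [hd] with n hn
  rw [Pi.sub_apply, RatMap.Log_map hn, RatMap.trop]
  ring

/-- Near a regular point of a pole, `fᵢ` is `z ^ ord` times a unit, and the tropicalization is the
same multiple of `-log |z|` up to a bounded error. -/
theorem RatMap.isBigO_of_regular {l : Filter ι} {p : ι → Torus} {c : ℂˣ}
    (hz : Tendsto (fun n => (zc B (p n) : ℂ)) l (𝓝 0)) (hw : Tendsto (fun n => wc B (p n)) l (𝓝 c))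
    (hreg : f.Regular B 0 c) :
    (fun n => Log (f.map (p n)) - f.trop (Log (p n))) =O[l] fun _ => (1 : ℝ) := by
  have hw' : Tendsto (fun n => (wc B (p n) : ℂ)) l (𝓝 (c : ℂ)) := (Units.continuous_val.tendsto c).comp hw
  have hd : ∀ᶠ n in l, p n ∈ f.dom := (hreg.eventually c.ne_zero hz hw').mono fun n hn =>
    RatMap.mem_dom_iff_regular.2 hn
  refine isBigO_pi.2 fun i => ?_
  have h1 := ((hreg.tendsto_red c.ne_zero hz hw' i).norm.log
    (norm_ne_zero_iff.2 (hreg.red_ne_zero i))).neg.isBigO_one ℝ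
  refine (h1.sub (f.isBigO_trop_sub hz hw i)).congr' ?_ EventuallyEq.rfl
  filter_upwards [hd, hreg.eventually c.ne_zero hz hw'] with n hn hr
  rw [Pi.sub_apply, Log, RatMap.coe_map_tor (B := B) hn, norm_mul, norm_zpow, Real.log_mul
    (zpow_ne_zero _ (norm_ne_zero_iff.2 (zc B (p n)).ne_zero)) (norm_ne_zero_iff.2 (hr.red_ne_zero i)),
    Real.log_zpow]
  ring

/-- The first part of the main theorem. -/
theorem RatMap.IsToric.exists_bound_off_Exc (hf : f.IsToric) (nrm : Seminorm ℝ (Fin 2 → ℝ))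
    {U : Set LimitSurface} (hU : U ∈ 𝓝ˢ f.Exc) : ∃ C, ∀ p : Torus, .torus p ∉ U →
      p ∈ f.dom ∧ nrm (Log (f.map p) - f.trop (Log p)) ≤ C := by
  obtain ⟨D⟩ := hf.nonempty_contractions
  have hUx : ∀ x ∈ f.Exc, U ∈ 𝓝 x := mem_nhdsSet_iff_forall.1 hU
  have hdom : ∀ p : Torus, .torus p ∉ f.Exc → p ∈ f.dom := by
    intro p hp
    by_contra h
    obtain ⟨a, ha⟩ := D.exists_eval_eq_zero h
    exact hp (D.curve_subset_Exc a ((torus_mem_curve_iff _ _).2 ha))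
  suffices h : ∃ C, ∀ p ∈ {p : Torus | .torus p ∉ U}, nrm (Log (f.map p) - f.trop (Log p)) ≤ C by
    obtain ⟨C, hC⟩ := h
    exact ⟨C, fun p hp => ⟨hdom p fun h => hp (mem_of_mem_nhds (hUx _ h)), hC p hp⟩⟩
  refine exists_bound_of_ultrafilter fun F hF => exists_seminorm_le_of_isBigO nrm ?_
  have hlim : ∀ x, Tendsto LimitSurface.torus (F : Filter Torus) (𝓝 x) → x ∉ f.Exc := by
    intro x hx hxE
    obtain ⟨p, hp, hp'⟩ := ((hx.eventually (hUx x hxE)).and hF).exists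
    exact hp' hp
  rcases trichotomy F id with ⟨t, ht⟩ | ⟨B, c, hz, hw⟩ | h
  · have htd := hdom t (hlim _ (tendsto_torus_iff.2 ht))
    have h1 := ((continuous_Log.tendsto _).comp ((f.continuousAt_map htd).tendsto.comp ht)).sub
      (((f.continuous_trop.comp continuous_Log).tendsto _).comp ht)
    exact h1.isBigO_one ℝ
  · have hx := hlim _ (tendsto_torus_pole_iff.2 ⟨hz, hw⟩)
    refine RatMap.isBigO_of_regular hz hw fun i => ?_
    by_contra hcon
    -- A limit point that is not regular lies on a contracted curve, hence in `Exc f`.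
    have hor : .pole (firstCol B) c ∈ curve (f.num i) ∨ .pole (firstCol B) c ∈ curve (f.den i) := by
      rw [← chart_zero, chart_mem_curve_iff, chart_mem_curve_iff]
      by_contra h
      push Not at h
      exact hcon h
    obtain ⟨a, ha⟩ := D.cover _ i hor
    exact hx (D.curve_subset_Exc a ha)
  · exact RatMap.isBigO_of_generic h

theorem isBigO_Log_sub {l : Filter ι} {t : ι → Torus} {c : ℂˣ}
    (hw : Tendsto (fun n => wc B (t n)) l (𝓝 c)) :
    (fun n => Log (t n) - (-Real.log ‖(zc B (t n) : ℂ)‖) • (fun i => (B.1 i 0 : ℝ))) =O[l]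
      fun _ => (1 : ℝ) := by
  refine isBigO_pi.2 fun i => ?_
  refine (((tendsto_neg_log_norm hw).isBigO_one ℝ).mul (isBigO_const_const (B.1 i 1 : ℝ)
    (one_ne_zero (α := ℝ)) l)).congr ?_ (fun _ => one_mul _)
  intro n
  rw [Pi.sub_apply, Log_eq B]
  simp

theorem RatMap.isBigO_trop_sub_smul {l : Filter ι} {p : ι → Torus} {r : ℕ}
    (hr : ∀ i, f.ord B i = r * B'.1 i 0) {c : ℂˣ}
    (hz : Tendsto (fun n => (zc B (p n) : ℂ)) l (𝓝 0)) (hw : Tendsto (fun n => wc B (p n)) l (𝓝 c)) :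
    (fun n => f.trop (Log (p n)) - (r * -Real.log ‖(zc B (p n) : ℂ)‖) • (fun i => (B'.1 i 0 : ℝ)))
      =O[l] fun _ => (1 : ℝ) := by
  refine isBigO_pi.2 fun i => (f.isBigO_trop_sub hz hw i).congr_left fun n => ?_
  rw [hr i]
  simp only [Pi.sub_apply, Pi.smul_apply, smul_eq_mul]
  push_cast; ring

/-- Two vectors close to multiples of the same `e` are compared through the scalars alone. It serves
for the second estimate and, with the roles of `Log f` and `A_f` exchanged, for the third. -/
theorem exists_seminorm_sub_le (nrm : Seminorm ℝ (Fin 2 → ℝ)) {l : Filter ι}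
    {u v : ι → Fin 2 → ℝ} {a b : ι → ℝ} {e : Fin 2 → ℝ} {C : ℝ}
    (hu : (fun n => u n - a n • e) =O[l] fun _ => (1 : ℝ))
    (hv : (fun n => v n - b n • e) =O[l] fun _ => (1 : ℝ))
    (hab : ∀ᶠ n in l, 0 ≤ a n ∧ a n ≤ b n + C) : ∃ C, ∀ᶠ n in l, nrm (u n) - nrm (v n) ≤ C := by
  obtain ⟨C₁, h₁⟩ := exists_seminorm_le_of_isBigO nrm hu
  obtain ⟨C₂, h₂⟩ := exists_seminorm_le_of_isBigO nrm hv
  refine ⟨C₁ + C₂ + |C| * nrm e, ?_⟩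
  filter_upwards [h₁, h₂, hab] with n h1 h2 ⟨h3, h4⟩
  have e1 : nrm (u n) ≤ nrm (u n - a n • e) + nrm (a n • e) := by
    simpa using map_add_le_add nrm (u n - a n • e) (a n • e)
  have e2 : nrm (b n • e) ≤ nrm (v n - b n • e) + nrm (v n) := by
    have := map_add_le_add nrm (-(v n - b n • e)) (v n)
    rw [map_neg_eq_map] at this
    simpa using this
  rw [map_smul_eq_mul, Real.norm_eq_abs] at e1 e2
  have h5 : |a n| ≤ |b n| + |C| := by
    rw [abs_of_nonneg h3]
    linarith [le_abs_self (b n), le_abs_self C]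
  have := mul_le_mul_of_nonneg_right h5 (apply_nonneg nrm e)
  linarith

theorem eventually_nhds_coords {y : ℂ × ℂˣ} {q : ℂ × ℂˣ → Prop} (h : ∀ᶠ y' in 𝓝 y, q y') :
    ∀ᶠ a in 𝓝 (coords y), ∃ y', coords y' = a ∧ q y' := by
  have h3 : IsOpenEmbedding coords := IsOpenEmbedding.id.prodMap Units.isOpenEmbedding_val
  rw [← h3.map_nhds_eq, eventually_map]
  exact h.mono fun y' hy' => ⟨y', rfl, hy'⟩

/-- The charts of a holomorphic extension of `f` at a point of a pole. -/
theorem RatMap.firstCol_eq_of_extension {r : ℕ} (hr0 : 0 < r)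
    (hr : ∀ i, f.ord B i = r * B'.1 i 0) {c : ℂˣ} {B₁ : Matrix.SpecialLinearGroup (Fin 2) ℤ}
    {h : ℂ × ℂ → ℂ × ℂ} (hh : AnalyticAt ℂ h (0, (c : ℂ)))
    (hloc : ∀ᶠ y' in 𝓝 ((0, c) : ℂ × ℂˣ), ∃ q, coords q = h (coords y') ∧
        ∀ p ∈ f.dom, chart B y' = .torus p → .torus (f.map p) = chart B₁ q) :
    firstCol B₁ = firstCol B' := by
  have h1 : ∀ᶠ a in 𝓝 ((0, (c : ℂ)) : ℂ × ℂ), (∃ y', coords y' = a ∧ ∃ q, coords q = h (coords y') ∧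
        ∀ p ∈ f.dom, chart B y' = .torus p → .torus (f.map p) = chart B₁ q) ∧ AnalyticAt ℂ h a :=
    (eventually_nhds_coords hloc).and hh.eventually_analyticAt
  have h2 : ∀ᶠ w in 𝓝 (c : ℂ), ∀ᶠ a in 𝓝 ((0, w) : ℂ × ℂ), (∃ y', coords y' = a ∧ ∃ q, coords q = h (coords y') ∧
        ∀ p ∈ f.dom, chart B y' = .torus p → .torus (f.map p) = chart B₁ q) ∧ AnalyticAt ℂ h a :=
    ((continuous_const.prodMk continuous_id).tendsto (c : ℂ)).eventually h1.eventually_nhds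
  -- At a regular point near `c`, the limit of `f` as `z → 0` is known to lie on the pole of `B'`.
  -- The extension has the same limit, which determines the pole of its chart.
  obtain ⟨w, ⟨hw1, hw0⟩, hreg⟩ := ((h2.filter_mono nhdsWithin_le_nhds).and
    ((eventually_ne_nhds c.ne_zero).filter_mono nhdsWithin_le_nhds) |>.and
    (f.eventually_regular_zero B c.ne_zero)).exists
  set w' := Units.mk0 w hw0
  obtain ⟨⟨y₁, hy₁, q₁, hq₁, -⟩, hana⟩ := hw1.self_of_nhds
  let l : Filter ℂˣ := comap ((↑) : ℂˣ → ℂ) (𝓝 0)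
  have hl : NeBot l := by
    rw [comap_neBot_iff]
    intro t ht
    have h3 : ∀ᶠ z in 𝓝[≠] (0 : ℂ), z ∈ t := mem_nhdsWithin_of_mem_nhds ht
    obtain ⟨z, hz, hz0⟩ := (h3.and self_mem_nhdsWithin).exists
    exact ⟨Units.mk0 z hz0, hz⟩
  have hz : Tendsto (fun z : ℂˣ => (z : ℂ)) l (𝓝 0) := tendsto_comap
  have hwc : Tendsto (fun _ : ℂˣ => w) l (𝓝 w) := tendsto_const_nhds
  have hdom : ∀ᶠ z in l, tor B z w' ∈ f.dom := (hreg.eventually hw0 hz hwc).mono fun z hz =>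
    RatMap.tor_mem_dom_iff.2 hz
  have hlim1 : Tendsto (fun z => LimitSurface.torus (f.map (tor B z w'))) l
      (𝓝 (.pole (firstCol B') (Units.mk0 _ (hreg.wRed_ne_zero B')))) := by
    refine tendsto_torus_pole_iff.2 ⟨?_, Units.isOpenEmbedding_val.tendsto_nhds_iff.2 ?_⟩
    · have := (hz.pow r).mul (hreg.tendsto_zRed hw0 hz hwc B')
      rw [zero_pow hr0.ne', zero_mul] at this
      refine this.congr' (hdom.mono fun z hz => ?_)
      simp only
      rw [RatMap.coe_zc_map hr hz, zc_tor, wc_tor]; rfl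
    · refine (hreg.tendsto_wRed hw0 hz hwc B').congr' (hdom.mono fun z hz => ?_)
      simp only [Function.comp_def]
      rw [RatMap.coe_wc_map hr hz, zc_tor, wc_tor]; rfl
  have hq : ∀ᶠ z : ℂˣ in l, ∃ q, coords q = h ((z : ℂ), w) ∧ .torus (f.map (tor B z w')) = chart B₁ q := by
    filter_upwards [(hz.prodMk_nhds hwc).eventually hw1, hdom] with z h3 h4
    obtain ⟨⟨y', hy', q, hq, hq'⟩, -⟩ := h3
    refine ⟨q, by rw [hq, hy'], hq' _ h4 ?_⟩
    have : y' = ((z : ℂ), w') := isEmbedding_coords.injective hy'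
    rw [this, chart_coe]
  choose! Q hQ using fun z (hz : ∃ q, coords q = h (((z : ℂˣ) : ℂ), w) ∧
    .torus (f.map (tor B z w')) = chart B₁ q) => hz
  have hlim2 : Tendsto (fun z => LimitSurface.torus (f.map (tor B z w'))) l (𝓝 (chart B₁ q₁)) := by
    have h5 : Tendsto Q l (𝓝 q₁) := by
      rw [isEmbedding_coords.tendsto_nhds_iff, hq₁, hy₁]
      exact (hana.continuousAt.tendsto.comp (hz.prodMk_nhds hwc)).congr'
        (hq.mono fun z hz => (hQ z hz).1.symm)
    exact (((continuous_chart B₁).tendsto q₁).comp h5).congr'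
      (hq.mono fun z hz => (hQ z hz).2.symm)
  have heq := tendsto_nhds_unique hlim2 hlim1
  rcases chart_cases q₁ with ⟨u, hu⟩ | ⟨z, u, hu⟩
  · rw [hu, chart_zero] at heq
    injection heq
  · rw [hu, chart_coe] at heq
    cases heq

/-- At a point of a pole at which `f` is holomorphic, it vanishes at least to the generic order. -/
theorem RatMap.exists_norm_extension_le {r : ℕ}
    (hr : ∀ i, f.ord B i = r * B'.1 i 0) {c : ℂˣ}
    {h : ℂ × ℂ → ℂ × ℂ} (hh : AnalyticAt ℂ h (0, (c : ℂ)))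
    (hloc : ∀ᶠ y' in 𝓝 ((0, c) : ℂ × ℂˣ), ∃ q, coords q = h (coords y') ∧
        ∀ p ∈ f.dom, chart B y' = .torus p → .torus (f.map p) = chart B' q) :
    ∃ C > 0, ∀ᶠ a in 𝓝 ((0, (c : ℂ)) : ℂ × ℂ), a.1 ≠ 0 → ‖(h a).1‖ ≤ C * ‖a.1‖ ^ r := by
  have h1 : ∀ᶠ a in 𝓝 ((0, (c : ℂ)) : ℂ × ℂ), (∃ y', coords y' = a ∧ ∃ q, coords q = h (coords y') ∧
        ∀ p ∈ f.dom, chart B y' = .torus p → .torus (f.map p) = chart B' q) ∧ AnalyticAt ℂ h a :=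
    (eventually_nhds_coords hloc).and hh.eventually_analyticAt
  obtain ⟨ε₁, hε₁, hball⟩ := Metric.eventually_nhds_iff.1 h1
  have hreg := f.eventually_regular_zero B c.ne_zero
  rw [eventually_nhdsWithin_iff, Metric.eventually_nhds_iff] at hreg
  obtain ⟨ε₂, hε₂, hreg⟩ := hreg
  set ε := min ε₁ ε₂ / 2 with hε
  have hε0 : 0 < ε := half_pos (lt_min hε₁ hε₂)
  have hεlt : ε < min ε₁ ε₂ := half_lt_self (lt_min hε₁ hε₂)
  have hε1 : ε < ε₁ := hεlt.trans_le (min_le_left _ _)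
  have hε2 : ε < ε₂ := hεlt.trans_le (min_le_right _ _)
  have hgood : ∀ z w : ℂ, ‖z‖ < ε₁ → dist w c ≤ ε → (∃ y', coords y' = (z, w) ∧ ∃ q, coords q = h (coords y') ∧
        ∀ p ∈ f.dom, chart B y' = .torus p → .torus (f.map p) = chart B' q) ∧ AnalyticAt ℂ h (z, w) := by
    intro z w hz hw
    refine hball ?_
    rw [Prod.dist_eq]
    exact max_lt (by simpa using hz) (hw.trans_lt hε1)
  have hw0 : ∀ w : ℂ, dist w c ≤ ε → w ≠ 0 := by
    intro w hw
    obtain ⟨⟨y', hy', -⟩, -⟩ := hgood 0 w (by simpa using hε₁) hw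
    have : (y'.2 : ℂ) = w := congrArg Prod.snd hy'
    rw [← this]; exact y'.2.ne_zero
  have hregs : ∀ w ∈ Metric.sphere (c : ℂ) ε, f.Regular B 0 w := by
    intro w hw
    refine hreg (by rw [Metric.mem_sphere.1 hw]; exact hε2) ?_
    rintro rfl
    rw [Metric.mem_sphere, dist_self] at hw
    exact hε0.ne hw
  -- The circle consists of regular points of the pole, so `zRed` is bounded over it, also for small
  -- nonzero `z`.
  obtain ⟨M, hM⟩ := (isCompact_sphere (c : ℂ) ε).exists_bound_of_continuousOn
    (f := fun w => f.zRed B B' 0 w) (fun w hw => ContinuousAt.continuousWithinAt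
      ((hregs w hw).tendsto_zRed (hw0 w (Metric.mem_sphere.1 hw).le) tendsto_const_nhds
        tendsto_id B'))
  have hev : ∀ᶠ z in 𝓝 (0 : ℂ), ∀ w ∈ Metric.sphere (c : ℂ) ε,
      f.Regular B z w ∧ ‖f.zRed B B' z w‖ < |M| + 1 := by
    refine (isCompact_sphere (c : ℂ) ε).eventually_forall_of_forall_eventually fun w hw => ?_
    have hwn := hw0 w (Metric.mem_sphere.1 hw).le
    have t1 : Tendsto (fun a : ℂ × ℂ => a.1) (𝓝 (0, w)) (𝓝 0) := continuous_fst.tendsto (0, w)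
    have t2 : Tendsto (fun a : ℂ × ℂ => a.2) (𝓝 (0, w)) (𝓝 w) := continuous_snd.tendsto (0, w)
    refine ((hregs w hw).eventually hwn t1 t2).and
      (((hregs w hw).tendsto_zRed hwn t1 t2 B').norm.eventually (gt_mem_nhds ?_))
    exact (hM w hw).trans_lt (by linarith [le_abs_self M])
  refine ⟨|M| + 1, by positivity, ?_⟩
  have hev2 : ∀ᶠ a in 𝓝 ((0, (c : ℂ)) : ℂ × ℂ), dist a.2 (c : ℂ) < ε :=
    (continuous_snd.tendsto ((0, (c : ℂ)) : ℂ × ℂ)).eventually (Metric.ball_mem_nhds _ hε0)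
  have hev3 : ∀ᶠ a in 𝓝 ((0, (c : ℂ)) : ℂ × ℂ), ‖a.1‖ < ε₁ := by
    have := (continuous_fst.tendsto ((0, (c : ℂ)) : ℂ × ℂ)).eventually (Metric.ball_mem_nhds _ hε₁)
    simpa using this
  filter_upwards [(continuous_fst.tendsto ((0, (c : ℂ)) : ℂ × ℂ)).eventually hev, hev2, hev3]
    with a h2 h3 h4 ha
  obtain ⟨z, w⟩ := a
  simp only at h2 h3 h4 ha ⊢
  have hslice : ∀ w' : ℂ, dist w' c ≤ ε → DifferentiableAt ℂ (fun w' => (h (z, w')).1) w' := by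
    intro w' hw'
    have h5 := (hgood z w' h4 hw').2.differentiableAt
    have h6 : DifferentiableAt ℂ (fun w' => h (z, w')) w' :=
      h5.comp w' ((differentiableAt_const z).prodMk differentiableAt_id)
    exact h6.fst
  -- For fixed `z ≠ 0`, the maximum principle in the second coordinate carries the bound from the
  -- circle into the disc.
  refine Complex.norm_le_of_forall_mem_frontier_norm_le (U := Metric.ball (c : ℂ) ε)
    (f := fun w' => (h (z, w')).1) Metric.isBounded_ball ?_ ?_ (subset_closure h3)
  · refine DifferentiableOn.diffContOnCl fun w' hw' => ?_
    rw [closure_ball _ hε0.ne'] at hw'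
    exact (hslice w' hw').differentiableWithinAt
  · intro w' hw'
    rw [frontier_ball _ hε0.ne'] at hw'
    obtain ⟨hr1, hr2⟩ := h2 w' hw'
    have hwn := hw0 w' (Metric.mem_sphere.1 hw').le
    obtain ⟨⟨y', hy', q, hq, hq'⟩, -⟩ := hgood z w' h4 (Metric.mem_sphere.1 hw').le
    have hd : tor B (Units.mk0 z ha) (Units.mk0 w' hwn) ∈ f.dom := RatMap.tor_mem_dom_iff.2 hr1
    have hy'' : y' = (((Units.mk0 z ha : ℂˣ) : ℂ), Units.mk0 w' hwn) := isEmbedding_coords.injective hy'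
    have h7 := hq' _ hd (by rw [hy'', chart_coe])
    rw [← chart_zc_wc B'] at h7
    have h8 : q.1 = (zc B' (f.map (tor B (Units.mk0 z ha) (Units.mk0 w' hwn))) : ℂ) :=
      (congrArg Prod.fst (chart_injective B' h7)).symm
    have h9 : (h (z, w')).1 = q.1 := by rw [← hy', ← hq]; rfl
    rw [h9, h8, RatMap.coe_zc_map hr hd, zc_tor, wc_tor, norm_mul, norm_pow, mul_comm]
    exact mul_le_mul_of_nonneg_right hr2.le (by positivity)

/-- The second part of the main theorem. -/
theorem RatMap.IsToric.exists_bound_off_Ind (hf : f.IsToric) (nrm : Seminorm ℝ (Fin 2 → ℝ))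
    {U : Set LimitSurface} (hU : U ∈ 𝓝ˢ f.Ind) : ∃ C, ∀ p ∈ {p : Torus | p ∈ f.dom ∧ .torus p ∉ U},
      nrm (f.trop (Log p)) - nrm (Log (f.map p)) ≤ C := by
  have hUx : ∀ x ∈ f.Ind, U ∈ 𝓝 x := mem_nhdsSet_iff_forall.1 hU
  refine exists_bound_of_ultrafilter fun F hF => ?_
  have hd : ∀ᶠ p in (F : Filter Torus), p ∈ f.dom := mem_of_superset hF fun p hp => hp.1
  have hlim : ∀ x, Tendsto LimitSurface.torus (F : Filter Torus) (𝓝 x) → x ∉ f.Ind := by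
    intro x hx hxE
    obtain ⟨p, hp, hp'⟩ := ((hx.eventually (hUx x hxE)).and hF).exists
    exact hp'.2 hp
  rcases trichotomy F id with ⟨t, ht⟩ | ⟨B₀, c₀, hz₀, hw₀⟩ | h
  · have h1 := (((f.continuous_trop.comp continuous_Log).tendsto _).comp ht).isBigO_one ℝ
    obtain ⟨C, hC⟩ := exists_seminorm_le_of_isBigO nrm h1
    refine ⟨C, hC.mono fun p hp => ?_⟩
    have := apply_nonneg nrm (Log (f.map p))
    simp only [Function.comp_def, id] at hp
    linarith
  · have hx₀ := tendsto_torus_pole_iff.2 ⟨hz₀, hw₀⟩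
    obtain ⟨B, B', y, q₀, h, hy, hh, hq₀, hloc, -⟩ := f.exists_analyticAt_of_notMem_Ind (hlim _ hx₀)
    obtain ⟨c, rfl⟩ : ∃ c, y = (0, c) := by
      rcases chart_cases y with h1 | ⟨z, w, rfl⟩
      · exact h1
      · rw [chart_coe] at hy; cases hy
    rw [chart_zero] at hy
    rw [← hy] at hx₀
    obtain ⟨hz, hw⟩ := tendsto_torus_pole_iff.1 hx₀
    simp only [id] at hz hw
    obtain ⟨B₁, r, hr0, hr₁⟩ := hf.exists_pole_image B
    -- The given extension comes with its own chart `B'`, whose first vector must be that of the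
    -- image pole; so the orders can be written with `B'`.
    have hcol := RatMap.firstCol_eq_of_extension hr0 hr₁ hh hloc
    have hr : ∀ i, f.ord B i = r * B'.1 i 0 := by
      intro i
      rw [hr₁]
      congr 1
      exact (congrFun (congrArg Subtype.val hcol) i).symm
    -- On logarithms this says that `Log f` moves along the image ray at least as far as `r * -log
    -- |z|`, which is the distance of `A_f`, up to a constant.
    obtain ⟨C, hC0, hC⟩ := RatMap.exists_norm_extension_le hr hh hloc
    have hw' : Tendsto (fun p => (wc B p : ℂ)) (F : Filter Torus) (𝓝 (c : ℂ)) :=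
      (Units.continuous_val.tendsto c).comp hw
    have hcoord : ∀ᶠ p in (F : Filter Torus), coords (((zc B' (f.map p)) : ℂ), wc B' (f.map p)) =
        h ((zc B p : ℂ), (wc B p : ℂ)) := by
      filter_upwards [(hz.prodMk_nhds hw).eventually hloc, hd] with p hp hpd
      obtain ⟨q, hq, hq'⟩ := hp
      have h1 := hq' p hpd (chart_zc_wc B p)
      rw [← chart_zc_wc B'] at h1
      rw [chart_injective B' h1, hq]; rfl
    have hwlim : Tendsto (fun p => wc B' (f.map p)) (F : Filter Torus) (𝓝 q₀.2) := by
      refine Units.isOpenEmbedding_val.tendsto_nhds_iff.2 ?_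
      have h1 : Tendsto (fun p => (h ((zc B p : ℂ), (wc B p : ℂ))).2) (F : Filter Torus)
          (𝓝 (h (0, (c : ℂ))).2) :=
        (continuous_snd.tendsto _).comp (hh.continuousAt.tendsto.comp (hz.prodMk_nhds hw'))
      have h2 : (h (0, (c : ℂ))).2 = (q₀.2 : ℂ) := congrArg Prod.snd hq₀.symm
      rw [h2] at h1
      refine h1.congr' (hcoord.mono fun p hp => ?_)
      rw [← hp]; rfl
    have hs := (tendsto_neg_log_norm_atTop hz).eventually_ge_atTop 0
    refine exists_seminorm_sub_le nrm (RatMap.isBigO_trop_sub_smul hr hz hw)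
      (isBigO_Log_sub hwlim) (C := Real.log C) ?_
    filter_upwards [hs, hcoord, (hz.prodMk_nhds hw').eventually hC] with p h1 h2 h3
    refine ⟨by positivity, ?_⟩
    have h4 := h3 (zc B p).ne_zero
    have h5 : (h ((zc B p : ℂ), (wc B p : ℂ))).1 = (zc B' (f.map p) : ℂ) := by rw [← h2]; rfl
    rw [h5] at h4
    have hzpos : 0 < ‖(zc B p : ℂ)‖ := norm_pos_iff.2 (zc B p).ne_zero
    have h6 := Real.log_le_log (norm_pos_iff.2 (zc B' (f.map p)).ne_zero) h4
    rw [Real.log_mul hC0.ne' (pow_pos hzpos r).ne', Real.log_pow] at h6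
    linarith
  · obtain ⟨C, hC⟩ := exists_seminorm_le_of_isBigO nrm (RatMap.isBigO_of_generic (f := f) h)
    refine ⟨C, hC.mono fun p hp => ?_⟩
    have h1 := map_sub_le_add nrm (Log (f.map p)) (Log (f.map p) - f.trop (Log p))
    simp only [sub_sub_cancel, id] at h1 hp
    linarith

end ToricSurface

/-! ### Constant Jacobian in logarithmic coordinates -/

namespace ToricSurface

open Filter MvPolynomial

section LogDeriv

variable {E : Type*} [NormedAddCommGroup E] [NormedSpace ℂ E]

/-- `g` is strictly differentiable at `u`, with logarithmic derivative `L`. -/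
def HasLogDeriv (g : E → ℂ) (L : E →L[ℂ] ℂ) (u : E) : Prop := HasStrictFDerivAt g (g u • L) u

variable {g h : E → ℂ} {L L' : E →L[ℂ] ℂ} {u : E}

theorem HasLogDeriv.mul (hg : HasLogDeriv g L u) (hh : HasLogDeriv h L' u) :
    HasLogDeriv (fun u => g u * h u) (L + L') u := by
  refine (HasStrictFDerivAt.mul hg hh).congr_fderiv ?_
  ext v
  simp only [add_apply, smul_apply, smul_eq_mul]
  ring

theorem HasLogDeriv.zpow (hg : HasLogDeriv g L u) (h0 : g u ≠ 0) (n : ℤ) :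
    HasLogDeriv (fun u => g u ^ n) ((n : ℂ) • L) u := by
  refine ((hasStrictDerivAt_zpow n (g u) (.inl h0)).comp_hasStrictFDerivAt u hg).congr_fderiv ?_
  ext v
  simp only [smul_apply, smul_eq_mul]
  rw [zpow_sub_one₀ h0]
  field_simp

theorem HasLogDeriv.const_mul (hg : HasLogDeriv g L u) (κ : ℂ) :
    HasLogDeriv (fun u => κ * g u) L u := by
  refine (HasStrictFDerivAt.const_mul hg κ).congr_fderiv ?_
  ext v
  simp only [smul_apply, smul_eq_mul]
  ring

theorem HasLogDeriv.div (hg : HasLogDeriv g L u) (hh : HasLogDeriv h L' u) (h0 : h u ≠ 0) :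
    HasLogDeriv (fun u => g u / h u) (L - L') u := by
  have h1 := hg.mul (hh.zpow h0 (-1))
  simp only [zpow_neg_one, ← div_eq_mul_inv] at h1
  refine HasStrictFDerivAt.congr_fderiv h1 ?_
  ext v
  simp [sub_eq_add_neg]

end LogDeriv

/-- The exponential function, as a map to the units. -/
noncomputable def expU (z : ℂ) : ℂˣ := Units.mk0 (Complex.exp z) (Complex.exp_ne_zero z)

/-- The exponential map to `𝕋`, in a toric chart. -/
noncomputable def ex (B : Matrix.SpecialLinearGroup (Fin 2) ℤ) (u : Fin 2 → ℂ) : Torus :=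
  tor B (expU (u 0)) (expU (u 1))

variable (B B' : Matrix.SpecialLinearGroup (Fin 2) ℤ) (f : RatMap)

theorem continuous_expU : Continuous expU :=
  Units.isOpenEmbedding_val.isEmbedding.continuous_iff.2 Complex.continuous_exp

theorem continuous_ex : Continuous (ex B) :=
  (continuous_tor B).comp ((continuous_expU.comp (continuous_apply 0)).prodMk
    (continuous_expU.comp (continuous_apply 1)))

/-- The linear form `B_{j0} u_0 + B_{j1} u_1`. -/
noncomputable def rowForm (j : Fin 2) : (Fin 2 → ℂ) →L[ℂ] ℂ :=
  (B.1 j 0 : ℂ) • ContinuousLinearMap.proj (R := ℂ) (φ := fun _ : Fin 2 => ℂ) 0 +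
    (B.1 j 1 : ℂ) • ContinuousLinearMap.proj (R := ℂ) (φ := fun _ : Fin 2 => ℂ) 1

theorem hasLogDeriv_cv_ex (j : Fin 2) (u : Fin 2 → ℂ) :
    HasLogDeriv (fun u => cv (ex B u) j) (rowForm B j) u := by
  have hexp : ∀ k : Fin 2, HasLogDeriv (fun u : Fin 2 → ℂ => Complex.exp (u k))
      (ContinuousLinearMap.proj (R := ℂ) (φ := fun _ : Fin 2 => ℂ) k) u := fun k =>
    (ContinuousLinearMap.proj (R := ℂ) (φ := fun _ : Fin 2 => ℂ) k).hasStrictFDerivAt.cexp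
  have h := ((hexp 0).zpow (Complex.exp_ne_zero _) (B.1 j 0)).mul
    ((hexp 1).zpow (Complex.exp_ne_zero _) (B.1 j 1))
  have h' : HasLogDeriv (fun u : Fin 2 → ℂ => Complex.exp (u 0) ^ B.1 j 0 * Complex.exp (u 1) ^ B.1 j 1)
      (rowForm B j) u := h
  simpa [cv, ex, tor, expU] using h'

theorem hasStrictFDerivAt_eval_ex (P : MvPolynomial (Fin 2) ℂ) (u : Fin 2 → ℂ) :
    HasStrictFDerivAt (fun u => eval (cv (ex B u)) P)
      (∑ j, eval (cv (ex B u)) (euler j P) • rowForm B j) u := by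
  have h1 : HasStrictFDerivAt (fun u => cv (ex B u))
      (ContinuousLinearMap.pi fun j => cv (ex B u) j • rowForm B j) u :=
    hasStrictFDerivAt_pi.2 fun j => hasLogDeriv_cv_ex B j u
  refine ((hasStrictFDerivAt_eval P (cv (ex B u))).comp u h1).congr_fderiv ?_
  ext v
  simp only [Fin.sum_univ_two, euler_apply, map_mul, eval_X, ContinuousLinearMap.comp_apply,
    add_apply, smul_apply, smul_eq_mul,
    ContinuousLinearMap.proj_apply, ContinuousLinearMap.pi_apply]
  ring

theorem hasLogDeriv_eval_ex {P : MvPolynomial (Fin 2) ℂ} {u : Fin 2 → ℂ}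
    (h0 : eval (cv (ex B u)) P ≠ 0) : HasLogDeriv (fun u => eval (cv (ex B u)) P)
      (∑ j, (eval (cv (ex B u)) (euler j P) / eval (cv (ex B u)) P) • rowForm B j) u := by
  refine (hasStrictFDerivAt_eval_ex B P u).congr_fderiv ?_
  rw [Finset.smul_sum]
  refine Finset.sum_congr rfl fun j _ => ?_
  rw [smul_smul, mul_div_cancel₀ _ h0]

/-- The logarithmic derivatives of the `fᵢ`. -/
noncomputable def RatMap.logJac (x : Fin 2 → ℂ) : Matrix (Fin 2) (Fin 2) ℂ :=
  Matrix.of fun i j => eval x (f.wron j i) / (eval x (f.num i) * eval x (f.den i))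

variable {f} in
theorem RatMap.hasLogDeriv_val {u : Fin 2 → ℂ} (hu : ex B u ∈ f.dom) (i : Fin 2) :
    HasLogDeriv (fun u => f.val i (cv (ex B u)))
      (∑ j, f.logJac (cv (ex B u)) i j • rowForm B j) u := by
  have h := (f.mem_dom_iff.1 hu) i
  have h1 := (hasLogDeriv_eval_ex B h.1).div (hasLogDeriv_eval_ex B h.2) h.2
  refine HasStrictFDerivAt.congr_fderiv h1 ?_
  have h2 := h.1
  have h3 := h.2
  ext v
  simp only [RatMap.logJac, Matrix.of_apply, RatMap.wron, map_sub, map_mul, Fin.sum_univ_two,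
    smul_apply, add_apply, sub_apply, smul_eq_mul, RatMap.val]
  field_simp
  ring

/-- `f` in exponential coordinates and a toric chart, multiplied by constants. -/
noncomputable def RatMap.expMap (κ u : Fin 2 → ℂ) : Fin 2 → ℂ :=
  ![κ 0 * (f.val 0 (cv (ex B u)) ^ B'.1 1 1 * f.val 1 (cv (ex B u)) ^ (-B'.1 0 1)),
    κ 1 * (f.val 0 (cv (ex B u)) ^ (-B'.1 1 0) * f.val 1 (cv (ex B u)) ^ B'.1 0 0)]

variable {B f} in
theorem RatMap.expMap_eq {u : Fin 2 → ℂ} (hu : ex B u ∈ f.dom) (κ : Fin 2 → ℂ) :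
    f.expMap B B' κ u = ![κ 0 * (zc B' (f.map (ex B u)) : ℂ), κ 1 * (wc B' (f.map (ex B u)) : ℂ)] := by
  rw [coe_zc, coe_wc, f.coe_map hu, f.coe_map hu]; rfl

/-- A toric map has a constant Jacobian determinant in logarithmic coordinates. -/
theorem RatMap.IsToric.exists_hasStrictFDerivAt {f : RatMap} (hf : f.IsToric) :
    ∃ ρ : ℂ, ρ ≠ 0 ∧ ∀ (B B' : Matrix.SpecialLinearGroup (Fin 2) ℤ) (κ u : Fin 2 → ℂ),
      ex B u ∈ f.dom → ∃ M : Matrix (Fin 2) (Fin 2) ℂ,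
        M.det = ρ * (f.expMap B B' κ u 0 * f.expMap B B' κ u 1) ∧
        HasStrictFDerivAt (f.expMap B B' κ) (Matrix.toLin' M).toContinuousLinearMap u := by
  obtain ⟨ρ, hρ, hid⟩ := hf.exists_identity
  refine ⟨ρ, hρ, fun B B' κ u hu => ?_⟩
  have hdet : (f.logJac (cv (ex B u))).det = ρ := by
    have h0 := f.mem_dom_iff.1 hu
    have h1 := congrArg (eval (cv (ex B u))) hid
    simp only [map_sub, map_mul, eval_C] at h1
    have n0 := (h0 0).1
    have n1 := (h0 1).1
    have d0 := (h0 0).2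
    have d1 := (h0 1).2
    rw [Matrix.det_fin_two]
    simp only [RatMap.logJac, Matrix.of_apply]
    field_simp
    linear_combination h1
  have hB : (B.1.map (fun n : ℤ => (n : ℂ))).det = 1 := by
    rw [Matrix.det_fin_two]
    simp only [Matrix.map_apply]
    exact_mod_cast det_eq_one B
  have hB' : (!![(B'.1 1 1 : ℂ), -B'.1 0 1; -B'.1 1 0, B'.1 0 0]).det = 1 := by
    rw [Matrix.det_fin_two_of]
    have : (B'.1 0 0 * B'.1 1 1 - B'.1 0 1 * B'.1 1 0 : ℂ) = 1 := by exact_mod_cast det_eq_one B'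
    linear_combination this
  -- The two changes of basis have determinant one, `logJac` has determinant `ρ`, and the diagonal
  -- factor passes from logarithmic to ordinary derivatives of the values.
  set M : Matrix (Fin 2) (Fin 2) ℂ := Matrix.diagonal (f.expMap B B' κ u) *
    !![(B'.1 1 1 : ℂ), -B'.1 0 1; -B'.1 1 0, B'.1 0 0] * f.logJac (cv (ex B u)) *
      B.1.map (fun n : ℤ => (n : ℂ)) with hM
  refine ⟨M, ?_, ?_⟩
  · rw [hM, Matrix.det_mul, Matrix.det_mul, Matrix.det_mul, hB, hB', hdet, Matrix.det_diagonal,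
      Fin.prod_univ_two]
    ring
  · have hv : ∀ i, f.val i (cv (ex B u)) ≠ 0 := fun i => by
      rw [← f.coe_map hu]; exact Units.ne_zero _
    have h0 := (((RatMap.hasLogDeriv_val B hu 0).zpow (hv 0) (B'.1 1 1)).mul
      ((RatMap.hasLogDeriv_val B hu 1).zpow (hv 1) (-B'.1 0 1))).const_mul (κ 0)
    have h1 := (((RatMap.hasLogDeriv_val B hu 0).zpow (hv 0) (-B'.1 1 0)).mul
      ((RatMap.hasLogDeriv_val B hu 1).zpow (hv 1) (B'.1 0 0))).const_mul (κ 1)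
    rw [hasStrictFDerivAt_pi']
    refine Fin.forall_fin_two.2 ⟨?_, ?_⟩
    · refine HasStrictFDerivAt.congr_fderiv h0 ?_
      ext v
      simp only [hM, RatMap.expMap, rowForm, Fin.sum_univ_two, ContinuousLinearMap.comp_apply,
        add_apply, smul_apply, smul_eq_mul,
        ContinuousLinearMap.proj_apply, LinearMap.coe_toContinuousLinearMap', Matrix.toLin'_apply,
        Matrix.mulVec, dotProduct, Matrix.mul_apply, Matrix.diagonal_apply, Matrix.map_apply]
      simp
      ring
    · refine HasStrictFDerivAt.congr_fderiv h1 ?_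
      ext v
      simp only [hM, RatMap.expMap, rowForm, Fin.sum_univ_two, ContinuousLinearMap.comp_apply,
        add_apply, smul_apply, smul_eq_mul,
        ContinuousLinearMap.proj_apply, LinearMap.coe_toContinuousLinearMap', Matrix.toLin'_apply,
        Matrix.mulVec, dotProduct, Matrix.mul_apply, Matrix.diagonal_apply, Matrix.map_apply]
      simp
      ring

end ToricSurface

/-! ### Algebraic curves have measure zero and do not separate balls -/

namespace ToricSurface

open Filter MvPolynomial MeasureTheory

theorem finite_zeros_line {Φ : MvPolynomial (Fin 2) ℂ} (a b : Fin 2 → ℂ) {μ : ℂ}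
    (h : eval (a + μ • b) Φ ≠ 0) : {ν : ℂ | eval (a + ν • b) Φ = 0}.Finite := by
  set p : Polynomial ℂ := aeval (fun i => Polynomial.C (a i) + Polynomial.X * Polynomial.C (b i)) Φ
  have hp : ∀ ν, p.eval ν = eval (a + ν • b) Φ := by
    intro ν
    have h1 := MvPolynomial.comp_aeval_apply
      (fun i => Polynomial.C (a i) + Polynomial.X * Polynomial.C (b i)) (Polynomial.aeval ν) Φ
    rw [Polynomial.coe_aeval_eq_eval] at h1
    have h2 : (fun i => Polynomial.eval ν (Polynomial.C (a i) + Polynomial.X * Polynomial.C (b i))) =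
        a + ν • b := by
      funext i; simp; exact mul_comm _ _
    rw [h2] at h1
    exact h1.trans (DFunLike.congr_fun (MvPolynomial.coe_aeval_eq_eval _) Φ)
  have hp0 : p ≠ 0 := by
    intro h0
    rw [← hp, h0] at h
    simp at h
  refine (p.roots.toFinset.finite_toSet).subset fun ν hν => ?_
  rw [Finset.mem_coe, Multiset.mem_toFinset, Polynomial.mem_roots hp0, Polynomial.IsRoot, hp]
  exact hν

theorem volume_zeros_eq_zero {Φ : MvPolynomial (Fin 2) ℂ} (hΦ : Φ ≠ 0) :
    volume {x : Fin 2 → ℂ | eval x Φ = 0} = 0 := by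
  obtain ⟨x₀, hx₀⟩ := exists_eval_ne_zero hΦ
  have hmp := volume_preserving_finTwoArrow ℂ
  set S : Set (ℂ × ℂ) := {y | eval ![y.1, y.2] Φ = 0} with hS
  have hclosed : IsClosed S := by
    refine isClosed_eq ((MvPolynomial.continuous_eval Φ).comp ?_) continuous_const
    refine continuous_pi (Fin.forall_fin_two.2 ⟨?_, ?_⟩)
    · exact continuous_fst
    · exact continuous_snd
  have hpre : {x : Fin 2 → ℂ | eval x Φ = 0} = MeasurableEquiv.finTwoArrow ⁻¹' S := by
    ext x
    simp only [hS, Set.mem_ofPred_eq, Set.mem_preimage]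
    have : ![(MeasurableEquiv.finTwoArrow x).1, (MeasurableEquiv.finTwoArrow x).2] = x := by
      funext i; fin_cases i <;> rfl
    rw [this]
  rw [hpre, hmp.measure_preimage hclosed.measurableSet.nullMeasurableSet]
  change (volume.prod volume) S = 0
  -- By Fubini: for all but finitely many `a`, the slice over `a` is the finite zero set of a
  -- polynomial in one variable.
  rw [Measure.measure_prod_null hclosed.measurableSet]
  have hfin : {a : ℂ | eval ![a, x₀ 1] Φ = 0}.Finite := by
    have h1 := finite_zeros_line (Φ := Φ) ![0, x₀ 1] ![1, 0] (μ := x₀ 0) (by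
      convert! hx₀ using 2
      congr 1
      funext i; fin_cases i <;> simp)
    refine h1.subset fun a ha => ?_
    have : (![0, x₀ 1] + a • ![1, 0] : Fin 2 → ℂ) = ![a, x₀ 1] := by
      funext i; fin_cases i <;> simp
    rw [Set.mem_ofPred_eq, this]
    exact ha
  have hae : ∀ᵐ a : ℂ, a ∉ {a : ℂ | eval ![a, x₀ 1] Φ = 0} :=
    measure_eq_zero_iff_ae_notMem.1 (hfin.measure_zero volume)
  filter_upwards [hae] with a ha
  have h1 := finite_zeros_line (Φ := Φ) ![a, 0] ![0, 1] (μ := x₀ 1) (by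
      have : (![a, 0] + x₀ 1 • ![0, 1] : Fin 2 → ℂ) = ![a, x₀ 1] := by
        funext i; fin_cases i <;> simp
      rw [this]
      exact ha)
  refine (h1.subset fun b hb => ?_).measure_zero volume
  have : (![a, 0] + b • ![0, 1] : Fin 2 → ℂ) = ![a, b] := by
    funext i; fin_cases i <;> simp
  rw [Set.mem_ofPred_eq, this]
  exact hb

/-- The complement of an algebraic curve in a ball is connected. -/
theorem ball_diff_zeros_subset {Φ : MvPolynomial (Fin 2) ℂ} (hΦ : Φ ≠ 0) {S : Set (Fin 2 → ℂ)}
    (hS : IsOpen S) {c : Fin 2 → ℂ} {δ : ℝ} (hne : (S ∩ Metric.ball c δ).Nonempty)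
    (hcl : ∀ t ∈ closure S, t ∈ Metric.ball c δ → eval t Φ ≠ 0 → t ∈ S) :
    ∀ t ∈ Metric.ball c δ, eval t Φ ≠ 0 → t ∈ S := by
  intro b hb hbΦ
  obtain ⟨a, ⟨haS, ha⟩, haΦ⟩ : ∃ a ∈ S ∩ Metric.ball c δ, eval a Φ ≠ 0 := by
    by_contra! hcon
    have h1 : volume (S ∩ Metric.ball c δ) = 0 :=
      measure_mono_null hcon (volume_zeros_eq_zero hΦ)
    exact (hS.inter Metric.isOpen_ball).measure_ne_zero volume hne h1
  -- The segment from `a` to `b` is bent inside the complex line through these points. The line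
  -- meets the curve in finitely many parameters `ν`, each of which is hit for at most one height
  -- `ε`.
  set γ : ℝ → ℝ → Fin 2 → ℂ := fun ε s => a + ((s : ℂ) + (ε * s * (1 - s) : ℝ) * Complex.I) • (b - a) with hγ
  have hfin : {ν : ℂ | eval (a + ν • (b - a)) Φ = 0}.Finite :=
    finite_zeros_line a (b - a) (μ := 0) (by simpa using haΦ)
  have hballε : ∀ᶠ ε in 𝓝[>] (0 : ℝ), ∀ s ∈ Set.Icc (0 : ℝ) 1, γ ε s ∈ Metric.ball c δ := by
    have h1 : Tendsto (fun ε : ℝ => max (dist a c) (dist b c) + ε * ‖b - a‖) (𝓝[>] 0)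
        (𝓝 (max (dist a c) (dist b c) + 0 * ‖b - a‖)) :=
      tendsto_const_nhds.add ((tendsto_nhdsWithin_of_tendsto_nhds tendsto_id).mul_const _)
    rw [zero_mul, add_zero] at h1
    filter_upwards [h1.eventually (gt_mem_nhds (max_lt ha hb)), self_mem_nhdsWithin] with ε hε hε0 s hs
    rw [Metric.mem_ball, dist_eq_norm]
    refine lt_of_le_of_lt ?_ hε
    have e1 : γ ε s - c = ((1 - s : ℝ) : ℂ) • (a - c) + (s : ℂ) • (b - c) +
        (((ε * s * (1 - s) : ℝ) : ℂ) * Complex.I) • (b - a) := by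
      simp only [hγ]
      funext i
      simp only [Pi.sub_apply, Pi.add_apply, Pi.smul_apply, smul_eq_mul]
      push_cast; ring
    have hε0' : 0 < ε := hε0
    have hs0 := hs.1
    have hs1 : 0 ≤ 1 - s := sub_nonneg.2 hs.2
    rw [e1]
    refine (norm_add_le _ _).trans (add_le_add ((norm_add_le _ _).trans ?_) ?_)
    · rw [norm_smul, norm_smul, Complex.norm_of_nonneg hs1, Complex.norm_of_nonneg hs0,
        ← dist_eq_norm, ← dist_eq_norm]
      have h2 := mul_le_mul_of_nonneg_left (le_max_left (dist a c) (dist b c)) hs1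
      have h3 := mul_le_mul_of_nonneg_left (le_max_right (dist a c) (dist b c)) hs0
      linarith
    · rw [norm_smul, norm_mul, Complex.norm_I, mul_one, Complex.norm_of_nonneg (by positivity)]
      refine mul_le_mul_of_nonneg_right ?_ (norm_nonneg _)
      nlinarith [mul_nonneg hs0 hs1, mul_nonneg hε0'.le hs0]
  have hZε : ∀ᶠ ε in 𝓝[>] (0 : ℝ), ∀ s ∈ Set.Icc (0 : ℝ) 1, eval (γ ε s) Φ ≠ 0 := by
    have hE : ∀ᶠ ε in 𝓝[>] (0 : ℝ), ∀ ν ∈ {ν : ℂ | eval (a + ν • (b - a)) Φ = 0},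
        ε ≠ ν.im / (ν.re * (1 - ν.re)) := by
      refine (eventually_all_finite hfin).2 fun ν _ => ?_
      by_cases h : ν.im / (ν.re * (1 - ν.re)) = 0
      · rw [h]
        filter_upwards [self_mem_nhdsWithin] with ε hε using ne_of_gt hε
      · exact (eventually_ne_nhds (Ne.symm h)).filter_mono nhdsWithin_le_nhds
    filter_upwards [hE] with ε hε s hs h0
    rcases eq_or_ne s 0 with rfl | hs0
    · simp [hγ] at h0
      exact haΦ h0
    rcases eq_or_ne s 1 with rfl | hs1
    · simp [hγ] at h0
      exact hbΦ h0
    have h1 := hε _ h0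
    apply h1
    have hs1' : 1 - s ≠ 0 := sub_ne_zero.2 hs1.symm
    have him : ((s : ℂ) + (ε * s * (1 - s) : ℝ) * Complex.I).im = ε * s * (1 - s) := by
      simp only [Complex.add_im, Complex.ofReal_im, Complex.ofReal_re, Complex.mul_im,
        Complex.I_re, Complex.I_im]
      ring
    have hre : ((s : ℂ) + (ε * s * (1 - s) : ℝ) * Complex.I).re = s := by
      simp only [Complex.add_re, Complex.ofReal_im, Complex.ofReal_re, Complex.mul_re,
        Complex.I_re, Complex.I_im]
      ring
    rw [him, hre]
    field_simp
  obtain ⟨ε, hε1, hε2⟩ := (hballε.and hZε).exists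
  have hcont : Continuous (γ ε) := by simp only [hγ]; fun_prop
  have hconn : IsPreconnected (γ ε '' Set.Icc 0 1) := isPreconnected_Icc.image _ hcont.continuousOn
  have hγ0 : γ ε 0 = a := by simp [hγ]
  have hγ1 : γ ε 1 = b := by simp [hγ]
  -- Along a path that avoids the curve, `S` is relatively open and closed.
  refine hconn.subset_of_closure_inter_subset hS ⟨a, ⟨0, by simp, hγ0⟩, haS⟩ ?_ ⟨1, by simp, hγ1⟩
  rintro t ⟨ht, s, hs, rfl⟩
  exact hcl _ ht (hε1 s hs) (hε2 s hs)

end ToricSurface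

/-! ### The volume argument -/

namespace ToricSurface

open Filter MvPolynomial MeasureTheory

variable {f : RatMap} {B : Matrix.SpecialLinearGroup (Fin 2) ℤ}

theorem zc_one (t : Torus) : zc 1 t = t 0 := by simp [zc]

theorem wc_one (t : Torus) : wc 1 t = t 1 := by simp [wc]

theorem RatMap.expMap_one_apply {u : Fin 2 → ℂ} (hu : ex B u ∈ f.dom) (κ : Fin 2 → ℂ) (i : Fin 2) :
    f.expMap B 1 κ u i = κ i * (f.map (ex B u) i : ℂ) := by
  rw [RatMap.expMap_eq 1 hu, zc_one, wc_one]
  fin_cases i <;> rfl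

/-- A toric coordinate as a quotient of monomials. -/
theorem exists_eval_div_eq_zc (B : Matrix.SpecialLinearGroup (Fin 2) ℤ) :
    ∃ N M : MvPolynomial (Fin 2) ℂ, N ≠ 0 ∧ M ≠ 0 ∧ ∀ t : Torus, eval (cv t) M ≠ 0 ∧
      eval (cv t) N / eval (cv t) M = (zc B t : ℂ) := by
  have hX : ∀ i n, (X i : MvPolynomial (Fin 2) ℂ) ^ n ≠ 0 := fun i n => pow_ne_zero n (X_ne_zero i)
  refine ⟨X 0 ^ (B.1 1 1).toNat * X 1 ^ (-B.1 0 1).toNat,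
    X 0 ^ (-B.1 1 1).toNat * X 1 ^ (- -B.1 0 1).toNat, mul_ne_zero (hX _ _) (hX _ _),
    mul_ne_zero (hX _ _) (hX _ _), fun t => ?_⟩
  simp only [map_mul, map_pow, eval_X]
  have h0 : cv t 0 ≠ 0 := (t 0).ne_zero
  have h1 : cv t 1 ≠ 0 := (t 1).ne_zero
  refine ⟨mul_ne_zero (pow_ne_zero _ h0) (pow_ne_zero _ h1), ?_⟩
  have hz : ∀ (x : ℂ) (n : ℤ), x ≠ 0 → x ^ n.toNat / x ^ (-n).toNat = x ^ n := by
    intro x n hx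
    rw [← zpow_natCast, ← zpow_natCast, ← zpow_sub₀ hx, Int.toNat_sub_toNat_neg]
  rw [mul_div_mul_comm, hz _ _ h0, hz _ _ h1, coe_zc]; rfl

theorem exists_eval_eq_eval_mul {Φ : MvPolynomial (Fin 2) ℂ} (hΦ : Φ ≠ 0) {q : Fin 2 → ℂ}
    (hq : ∀ i, q i ≠ 0) : ∃ Ψ : MvPolynomial (Fin 2) ℂ, Ψ ≠ 0 ∧ ∀ t, eval t Ψ = eval (q * t) Φ := by
  have hev : ∀ t, eval t (bind₁ (fun i => C (q i) * X i) Φ) = eval (q * t) Φ := by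
    intro t
    rw [← MvPolynomial.coe_aeval_eq_eval, ← MvPolynomial.coe_aeval_eq_eval]
    simp only [RingHom.coe_coe, aeval_bind₁, map_mul, aeval_X, aeval_C]
    rfl
  refine ⟨bind₁ (fun i => C (q i) * X i) Φ, fun h0 => ?_, hev⟩
  obtain ⟨x, hx⟩ := exists_eval_ne_zero hΦ
  apply hx
  have h1 := hev fun i => x i / q i
  rw [h0, map_zero] at h1
  rw [h1]
  congr 2
  funext i
  exact (mul_div_cancel₀ _ (hq i)).symm

theorem range_toLin'_eq_top {M : Matrix (Fin 2) (Fin 2) ℂ} (hM : M.det ≠ 0) :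
    (Matrix.toLin' M).toContinuousLinearMap.range = ⊤ := by
  refine LinearMap.range_eq_top.2 fun y => ?_
  obtain ⟨x, hx⟩ := (Matrix.mulVec_surjective_iff_isUnit.2
    ((Matrix.isUnit_iff_isUnit_det _).2 (isUnit_iff_ne_zero.2 hM))) y
  exact ⟨x, hx⟩

/-- The determinant over the reals of a complex matrix. -/
theorem det_restrictScalars_toLin' (M : Matrix (Fin 2) (Fin 2) ℂ) :
    ((Matrix.toLin' M).toContinuousLinearMap.restrictScalars ℝ).det = ‖M.det‖ ^ 2 := by
  have h : (((Matrix.toLin' M).toContinuousLinearMap.restrictScalars ℝ : (Fin 2 → ℂ) →L[ℝ] (Fin 2 → ℂ)) :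
      (Fin 2 → ℂ) →ₗ[ℝ] (Fin 2 → ℂ)) = (Matrix.toLin' M).restrictScalars ℝ := rfl
  rw [ContinuousLinearMap.det, h, LinearMap.det_restrictScalars, LinearMap.det_toLin',
    Algebra.norm_complex_apply, Complex.normSq_eq_norm_sq]

/-- If an open set has small volume in logarithmic coordinates, then its image under a toric map
cannot contain a large ball, and thus the values in the set come close to those on its boundary. -/
theorem RatMap.IsToric.exists_mem_frontier (hf : f.IsToric)
    (B : Matrix.SpecialLinearGroup (Fin 2) ℤ) {δ : ℝ} (hδ0 : 0 < δ) (hδ1 : δ ≤ 1) :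
    ∃ κ : ENNReal, 0 < κ ∧ ∀ (Ω : Set Torus) (D : Set (Fin 2 → ℂ)), IsOpen Ω → MeasurableSet D →
      (∀ p ∈ Ω, ∃ u ∈ D, ex B u = p) → volume D < κ →
      (∀ F : Ultrafilter Torus, Ω ∈ F →
        (∃ t, (F : Filter Torus) ≤ 𝓝 t) ∨ Tendsto (fun p => (zc B p : ℂ)) F (𝓝 0)) →
      ∀ p ∈ Ω, p ∈ f.dom → ∃ p' ∈ frontier Ω, p' ∈ f.dom ∧
        ∀ i, ‖(f.map p' i : ℂ) / f.map p i - 1‖ < δ := by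
  obtain ⟨ρ, hρ, hder⟩ := hf.exists_hasStrictFDerivAt
  have hball0 : volume (Metric.ball (1 : Fin 2 → ℂ) δ) ≠ 0 :=
    Metric.isOpen_ball.measure_ne_zero volume ⟨1, Metric.mem_ball_self hδ0⟩
  -- `R` bounds the real Jacobian `|ρ * T₀ * T₁| ^ 2` where `|Tᵢ| ≤ 2`, which holds on the ball
  -- because `δ ≤ 1`.
  set R : ENNReal := ENNReal.ofReal (16 * ‖ρ‖ ^ 2) with hR
  have hR0 : R ≠ 0 := by
    rw [hR, Ne, ENNReal.ofReal_eq_zero, not_le]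
    have := norm_pos_iff.2 hρ
    positivity
  have hRt : R ≠ ⊤ := ENNReal.ofReal_ne_top
  refine ⟨volume (Metric.ball (1 : Fin 2 → ℂ) δ) / R, ENNReal.div_pos hball0 hRt, ?_⟩
  intro Ω D hΩ hD hcov hvol hlim p hpΩ hpd
  by_contra! hcon
  set q : Torus := f.map p with hq
  set κ : Fin 2 → ℂ := fun i => (q i : ℂ)⁻¹ with hκ
  -- `T` is `f` in exponential coordinates, divided by its value at `p`. The negated conclusion says
  -- that `T` stays out of the ball of radius `δ` about `1` over boundary points in `dom f`.
  set T := f.expMap B 1 κ with hT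
  have hTi : ∀ u, ex B u ∈ f.dom → ∀ i, T u i = (f.map (ex B u) i : ℂ) / q i := by
    intro u hu i
    rw [hT, RatMap.expMap_one_apply hu, div_eq_inv_mul]
  set O : Set (Fin 2 → ℂ) := {u | ex B u ∈ Ω ∧ ex B u ∈ f.dom ∧ T u ∈ Metric.ball 1 δ} with hO
  have hOopen : IsOpen O := by
    rw [isOpen_iff_mem_nhds]
    rintro u ⟨h1, h2, h3⟩
    obtain ⟨M, -, hM⟩ := hder B 1 κ u h2
    filter_upwards [(continuous_ex B).continuousAt.preimage_mem_nhds (hΩ.mem_nhds h1),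
      (continuous_ex B).continuousAt.preimage_mem_nhds (f.isOpen_dom.mem_nhds h2),
      hM.continuousAt.preimage_mem_nhds (Metric.isOpen_ball.mem_nhds h3)] with u' a1 a2 a3
    exact ⟨a1, a2, a3⟩
  set S := T '' O with hSdef
  have hSmem : ∀ t, t ∈ Metric.ball (1 : Fin 2 → ℂ) δ → ∀ p' ∈ Ω, p' ∈ f.dom →
      (∀ i, t i = (f.map p' i : ℂ) / q i) → t ∈ T '' (D ∩ O) := by
    intro t ht p' hp'Ω hp'd hp't
    obtain ⟨u, huD, hu⟩ := hcov p' hp'Ω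
    have hud : ex B u ∈ f.dom := by rw [hu]; exact hp'd
    have hTu : T u = t := by
      funext i; rw [hTi u hud, hu, hp't]
    exact ⟨u, ⟨huD, by rw [hu]; exact hp'Ω, hud, by rw [hTu]; exact ht⟩, hTu⟩
  have hSO : S ⊆ T '' (D ∩ O) := by
    rintro t ⟨u, hu, rfl⟩
    exact hSmem _ hu.2.2 _ hu.1 hu.2.1 (hTi u hu.2.1)
  have hSopen : IsOpen S := by
    rw [isOpen_iff_mem_nhds]
    rintro t ⟨u, hu, rfl⟩
    obtain ⟨M, hMdet, hM⟩ := hder B 1 κ u hu.2.1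
    have hne : M.det ≠ 0 := by
      rw [hMdet, ← hT, hTi u hu.2.1, hTi u hu.2.1]
      exact mul_ne_zero hρ (mul_ne_zero (div_ne_zero (Units.ne_zero _) (Units.ne_zero _))
        (div_ne_zero (Units.ne_zero _) (Units.ne_zero _)))
    rw [← hM.map_nhds_eq_of_surj (range_toLin'_eq_top hne)]
    exact image_mem_map (hOopen.mem_nhds hu)
  have hq0 : ∀ i, ((fun i => (q i : ℂ)) : Fin 2 → ℂ) i ≠ 0 := fun i => (q i).ne_zero
  obtain ⟨N, M, hN0, hM0, hNM⟩ := exists_eval_div_eq_zc B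
  obtain ⟨Φ₁, hΦ₁, hfib₁⟩ := f.exists_fiber_polynomial hN0 hM0
  have hprod : f.num 0 * f.den 0 * (f.num 1 * f.den 1) ≠ 0 :=
    mul_ne_zero (mul_ne_zero (f.num_ne_zero 0) (f.den_ne_zero 0))
      (mul_ne_zero (f.num_ne_zero 1) (f.den_ne_zero 1))
  obtain ⟨Φ₂, hΦ₂, hfib₂⟩ := f.exists_fiber_polynomial hprod (one_ne_zero (α := MvPolynomial (Fin 2) ℂ))
  -- Values approached as `z → 0` lie on the curve `Φ₁`, and values approached at points outside
  -- `dom f` on `Φ₂`. `Ψ` is their union in the normalized coordinates.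
  obtain ⟨Ψ, hΨ, hΨe⟩ := exists_eval_eq_eval_mul (mul_ne_zero hΦ₁ hΦ₂) hq0
  have hcl : ∀ t ∈ closure S, t ∈ Metric.ball (1 : Fin 2 → ℂ) δ → eval t Ψ ≠ 0 → t ∈ S := by
    intro t htS htb htΨ
    rw [hΨe, map_mul] at htΨ
    obtain ⟨G, hGS, hGt⟩ := mem_closure_iff_ultrafilter.1 htS
    choose! u hu using fun s (hs : s ∈ S) => hs
    have hval : Tendsto (fun s i => f.val i (cv (ex B (u s)))) (G : Filter (Fin 2 → ℂ))
        (𝓝 ((fun i => (q i : ℂ)) * t)) := by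
      refine tendsto_pi_nhds.2 fun i => ?_
      have h1 : Tendsto (fun s : Fin 2 → ℂ => (q i : ℂ) * s i) (G : Filter (Fin 2 → ℂ))
          (𝓝 ((q i : ℂ) * t i)) :=
        (((continuous_apply i).tendsto t).mono_left hGt).const_mul _
      refine h1.congr' ?_
      filter_upwards [hGS] with s hs
      obtain ⟨⟨h2, h3, h4⟩, h5⟩ := hu s hs
      rw [← f.coe_map h3]
      conv_lhs => rw [← h5]
      rw [hTi _ h3, mul_div_cancel₀ _ (q i).ne_zero]
    have hdomG : ∀ᶠ s in (G : Filter (Fin 2 → ℂ)), ex B (u s) ∈ f.dom := by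
      filter_upwards [hGS] with s hs using (hu s hs).1.2.1
    have hden : ∀ᶠ s in (G : Filter (Fin 2 → ℂ)), ∀ i, eval (cv (ex B (u s))) (f.den i) ≠ 0 :=
      hdomG.mono fun s hs i => (f.mem_dom_iff.1 hs i).2
    have hΩG : Ω ∈ G.map fun s => ex B (u s) := by
      change ∀ᶠ s in (G : Filter (Fin 2 → ℂ)), ex B (u s) ∈ Ω
      filter_upwards [hGS] with s hs using (hu s hs).1.1
    -- Off the curve `Ψ`, preimages of points converging to `t` converge to some `x` in `dom f`. It
    -- is not a boundary point, so it is in `Ω` and `t` is a value.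
    rcases hlim (G.map fun s => ex B (u s)) hΩG with ⟨x, hx⟩ | hz
    · have hx' : Tendsto (fun s => ex B (u s)) (G : Filter (Fin 2 → ℂ)) (𝓝 x) := hx
      have hxd : x ∈ f.dom := by
        by_contra hxd
        apply right_ne_zero_of_mul htΨ
        refine hfib₂ (G : Filter (Fin 2 → ℂ)) (fun s => cv (ex B (u s))) _
          (hden.mono fun s hs => ⟨by simp, hs⟩) ?_ hval
        have h1 := ((continuous_eval_cv (f.num 0 * f.den 0 * (f.num 1 * f.den 1))).tendsto x).comp hx'
        have h2 : eval (cv x) (f.num 0 * f.den 0 * (f.num 1 * f.den 1)) = 0 := by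
          by_contra h3
          simp only [map_mul, mul_eq_zero, not_or] at h3
          exact hxd (f.mem_dom_iff.2 (Fin.forall_fin_two.2 ⟨h3.1, h3.2⟩))
        rw [h2] at h1
        simpa [Function.comp_def] using h1
      have hxt : ∀ i, t i = (f.map x i : ℂ) / q i := by
        intro i
        have h1 : Tendsto (fun s => (f.map (ex B (u s)) i : ℂ)) (G : Filter (Fin 2 → ℂ))
            (𝓝 (f.map x i : ℂ)) :=
          (Units.continuous_val.tendsto _).comp (((continuous_apply i).tendsto _).comp
            ((f.continuousAt_map hxd).tendsto.comp hx'))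
        have h2 := tendsto_pi_nhds.1 hval i
        have h3 := tendsto_nhds_unique h2 (h1.congr' (hdomG.mono fun s hs => f.coe_map hs i))
        rw [eq_div_iff (q i).ne_zero, ← h3, mul_comm]; rfl
      have hxcl : x ∈ closure Ω := by
        refine mem_closure_of_tendsto hx' ?_
        exact hΩG
      by_cases hxΩ : x ∈ Ω
      · obtain ⟨u', hu', hu''⟩ := hSmem t htb x hxΩ hxd hxt
        exact ⟨u', hu'.2, hu''⟩
      · exfalso
        obtain ⟨i, hi⟩ := hcon x ⟨hxcl, by rwa [hΩ.interior_eq]⟩ hxd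
        rw [← hxt] at hi
        have h1 := (dist_pi_lt_iff hδ0).1 (Metric.mem_ball.1 htb) i
        rw [dist_eq_norm] at h1
        exact absurd h1 (not_lt.2 hi)
    · exfalso
      apply left_ne_zero_of_mul htΨ
      refine hfib₁ (G : Filter (Fin 2 → ℂ)) (fun s => cv (ex B (u s))) _
        (hden.mono fun s hs => ⟨(hNM _).1, hs⟩) ?_ hval
      simp only [(hNM _).2]
      exact hz
  have h1S : (1 : Fin 2 → ℂ) ∈ S := by
    obtain ⟨u', hu', hu''⟩ := hSmem 1 (Metric.mem_ball_self hδ0) p hpΩ hpd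
      (fun i => (div_self (q i).ne_zero).symm)
    exact ⟨u', hu'.2, hu''⟩
  -- Thus the image fills the ball up to a null set, whereas the area formula bounds its volume by
  -- `R * volume D`, which is smaller.
  have hsub := ball_diff_zeros_subset hΨ hSopen ⟨1, h1S, Metric.mem_ball_self hδ0⟩ hcl
  have hle1 : volume (Metric.ball (1 : Fin 2 → ℂ) δ) ≤ volume S := by
    calc volume (Metric.ball (1 : Fin 2 → ℂ) δ) ≤ volume (S ∪ {x | eval x Ψ = 0}) :=
          measure_mono fun t ht => or_iff_not_imp_right.2 fun h => hsub t ht h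
      _ ≤ volume S + volume {x | eval x Ψ = 0} := measure_union_le _ _
      _ = volume S := by rw [volume_zeros_eq_zero hΨ, add_zero]
  choose! M' hM'det hM' using fun u (hu : ex B u ∈ f.dom) => hder B 1 κ u hu
  have hle2 : volume (T '' (D ∩ O)) ≤ ∫⁻ u in D ∩ O, ENNReal.ofReal
      |((Matrix.toLin' (M' u)).toContinuousLinearMap.restrictScalars ℝ).det| :=
    addHaar_image_le_lintegral_abs_det_fderiv volume (hD.inter hOopen.measurableSet) fun u hu =>
      ((hM' u hu.2.2.1).hasFDerivAt.restrictScalars ℝ).hasFDerivWithinAt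
  have hle3 : ∫⁻ u in D ∩ O, ENNReal.ofReal
      |((Matrix.toLin' (M' u)).toContinuousLinearMap.restrictScalars ℝ).det| ≤
      ∫⁻ _ in D ∩ O, R := by
    refine setLIntegral_mono measurable_const fun u hu => ?_
    rw [det_restrictScalars_toLin', hM'det u hu.2.2.1, ← hT, abs_of_nonneg (by positivity), hR]
    refine ENNReal.ofReal_le_ofReal ?_
    have hn : ∀ i, ‖T u i‖ ≤ 2 := by
      intro i
      have h1 := (dist_pi_lt_iff hδ0).1 (Metric.mem_ball.1 hu.2.2.2) i
      rw [dist_eq_norm] at h1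
      have h2 := norm_add_le (T u i - (1 : Fin 2 → ℂ) i) ((1 : Fin 2 → ℂ) i)
      simp only [sub_add_cancel, Pi.one_apply, norm_one] at h2 h1
      linarith
    rw [norm_mul, norm_mul, mul_pow, mul_comm]
    refine mul_le_mul_of_nonneg_right ?_ (by positivity)
    have h3 : ‖T u 0‖ * ‖T u 1‖ ≤ 2 * 2 := mul_le_mul (hn 0) (hn 1) (norm_nonneg _) (by norm_num)
    calc (‖T u 0‖ * ‖T u 1‖) ^ 2 ≤ (2 * 2) ^ 2 := pow_le_pow_left₀ (by positivity) h3 2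
      _ = 16 := by norm_num
  have hle4 : volume (Metric.ball (1 : Fin 2 → ℂ) δ) ≤ R * volume D := by
    refine hle1.trans ((measure_mono hSO).trans (hle2.trans (hle3.trans ?_)))
    rw [setLIntegral_const]
    gcongr
    exact Set.inter_subset_left
  have hlt : R * volume D < volume (Metric.ball (1 : Fin 2 → ℂ) δ) := by
    rw [mul_comm]
    exact (ENNReal.lt_div_iff_mul_lt (.inl hR0) (.inl hRt)).1 hvol
  exact absurd hle4 (not_le.2 hlt)

end ToricSurface

/-! ### From limits on the boundary of a set to limits inside -/

namespace ToricSurface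

open Filter MvPolynomial MeasureTheory

variable {f : RatMap} {B : Matrix.SpecialLinearGroup (Fin 2) ℤ}

theorem zc_mul (s t : Torus) : zc B (s * t) = zc B s * zc B t := by
  simp only [zc, Pi.mul_apply, mul_zpow]
  exact mul_mul_mul_comm _ _ _ _

theorem wc_mul (s t : Torus) : wc B (s * t) = wc B s * wc B t := by
  simp only [wc, Pi.mul_apply, mul_zpow]
  exact mul_mul_mul_comm _ _ _ _

/-- The translations of the torus extend continuously to the limit surface. -/
theorem eventually_torus_mem_of_near {y : LimitSurface} {W : Set LimitSurface} (hW : W ∈ 𝓝 y) :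
    ∀ᶠ δ in 𝓝[>] (0 : ℝ), ∃ W' ∈ 𝓝 y, ∀ s t : Torus, .torus s ∈ W' →
      (∀ i, ‖(s i : ℂ) / t i - 1‖ < δ) → .torus t ∈ W := by
  obtain ⟨B, y₀, rfl⟩ := exists_chart_eq y
  -- In a chart a translation multiplies the two coordinates by units, so it extends over the pole
  -- and depends continuously on the translating element.
  let act : Torus × (ℂ × ℂˣ) → ℂ × ℂˣ := fun a => ((zc B a.1 : ℂ) * a.2.1, wc B a.1 * a.2.2)
  have hact : Continuous act :=
    ((Units.continuous_val.comp ((continuous_zc B).comp continuous_fst)).mul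
      (continuous_fst.comp continuous_snd)).prodMk
      (((continuous_wc B).comp continuous_fst).mul (continuous_snd.comp continuous_snd))
  have hact1 : act (1, y₀) = y₀ := by
    simp [act, zc, wc]
  have hmem : {a | chart B (act a) ∈ W} ∈ 𝓝 ((1 : Torus), y₀) := by
    refine (((continuous_chart B).comp hact).continuousAt (x := ((1 : Torus), y₀))).preimage_mem_nhds ?_
    simpa only [Function.comp_apply, hact1] using hW
  obtain ⟨R, hR, Y, hY, hRY⟩ := mem_nhds_prod_iff.1 hmem
  have hR' : (fun r : Torus => r⁻¹) ⁻¹' R ∈ 𝓝 (1 : Torus) :=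
    continuous_inv.continuousAt.preimage_mem_nhds (by simpa using hR)
  rw [isOpenEmbedding_cv.isEmbedding.nhds_eq_comap] at hR'
  obtain ⟨A, hA, hAR⟩ := hR'
  obtain ⟨ε, hε, hεA⟩ := Metric.mem_nhds_iff.1 hA
  filter_upwards [Ioo_mem_nhdsGT hε] with δ hδ
  refine ⟨chart B '' Y, (isOpenEmbedding_chart B).isOpenMap.image_mem_nhds hY, ?_⟩
  rintro s t ⟨a, ha, hs⟩ hst
  rw [← chart_zc_wc B] at hs
  have ha' := chart_injective B hs
  have h1 : t / s ∈ R := by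
    have h2 : s / t ∈ (fun r : Torus => r⁻¹) ⁻¹' R := by
      refine hAR (hεA ?_)
      rw [Metric.mem_ball, dist_pi_lt_iff hε]
      intro i
      rw [dist_eq_norm]
      have := hst i
      simp only [cv, Pi.div_apply, Pi.one_apply, Units.val_div_eq_div_val, Units.val_one]
      exact this.trans hδ.2
    simpa using h2
  have h3 := hRY (Set.mk_mem_prod h1 ha)
  have h4 : act (t / s, a) = ((zc B t : ℂ), wc B t) := by
    simp only [act, ha', ← Units.val_mul, ← zc_mul, ← wc_mul, div_mul_cancel]
  have h5 : chart B (act (t / s, a)) ∈ W := h3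
  rwa [h4, chart_zc_wc] at h5

theorem exists_tendsto_of_near {ι : Type*} {F : Ultrafilter ι} {s t : ι → Torus} {s₀ : Torus}
    (hs : Tendsto s F (𝓝 s₀)) {δ : ℝ} (hδ : δ < 1)
    (hst : ∀ᶠ n in (F : Filter ι), ∀ i, ‖(s n i : ℂ) / t n i - 1‖ < δ) :
    ∃ t₀, Tendsto t F (𝓝 t₀) := by
  have hi : ∀ i, ∃ c, Tendsto (fun n => t n i) F (𝓝 c) := by
    intro i
    have h1 : Tendsto (fun n => ‖(s n i : ℂ)‖) F (𝓝 ‖(s₀ i : ℂ)‖) :=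
      ((Units.continuous_val.tendsto _).comp (((continuous_apply i).tendsto _).comp hs)).norm
    have hpos : 0 < ‖(s₀ i : ℂ)‖ := norm_pos_iff.2 (s₀ i).ne_zero
    have h2 := h1.eventually (Ioo_mem_nhds (half_lt_self hpos) (lt_two_mul_self hpos))
    have hδ' : 0 < 1 - δ := sub_pos.2 hδ
    set a := ‖(s₀ i : ℂ)‖ with ha
    have hlog : ∀ᶠ n in (F : Filter ι), Real.log ‖(t n i : ℂ)‖ ∈
        Set.Icc (Real.log (a / 2 / (1 + δ))) (Real.log (2 * a / (1 - δ))) := by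
      filter_upwards [h2, hst] with n hn hn'
      have h3 := hn' i
      have hδ0 : 0 < δ := (norm_nonneg _).trans_lt h3
      have htp : 0 < ‖(t n i : ℂ)‖ := norm_pos_iff.2 (t n i).ne_zero
      have h4 : ‖(s n i : ℂ) - t n i‖ ≤ δ * ‖(t n i : ℂ)‖ := by
        have : (s n i : ℂ) - t n i = ((s n i : ℂ) / t n i - 1) * t n i := by
          rw [sub_mul, div_mul_cancel₀ _ (t n i).ne_zero, one_mul]
        rw [this, norm_mul]
        exact mul_le_mul_of_nonneg_right h3.le htp.le
      have h5 := norm_sub_norm_le (s n i : ℂ) (t n i)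
      have h6 := norm_sub_norm_le (t n i : ℂ) (s n i)
      rw [norm_sub_rev] at h6
      have h7 := hn.1
      have h8 := hn.2
      refine ⟨Real.log_le_log (by positivity) ?_, Real.log_le_log htp ?_⟩
      · rw [div_le_iff₀ (by positivity)]; nlinarith
      · rw [le_div_iff₀ hδ']; nlinarith
    refine exists_tendsto_of_bounded_log (C := max |Real.log (a / 2 / (1 + δ))|
      |Real.log (2 * a / (1 - δ))|) ?_
    filter_upwards [hlog] with n hn
    exact abs_le_max_abs_abs hn.1 hn.2
  choose c hc using hi
  exact ⟨c, tendsto_pi_nhds.2 hc⟩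

/-- If the limits of `f` along the boundary of a set of small volume belong to a finite
set `E`, then inside the set `f` is close to `E` where it does not stay bounded. -/
theorem RatMap.IsToric.exists_tendsto_of_frontier (hf : f.IsToric) (K : f.Contractions)
    (B : Matrix.SpecialLinearGroup (Fin 2) ℤ) {E V : Set LimitSurface} (hE : E.Finite)
    (hV : ∀ y ∈ E, V ∈ 𝓝 y) (hKE : ∀ a, (K.K a).point ∈ E) :
    ∃ κ : ENNReal, 0 < κ ∧ ∀ (Ω : Set Torus) (D : Set (Fin 2 → ℂ)), IsOpen Ω → MeasurableSet D →
      (∀ p ∈ Ω, ∃ u ∈ D, ex B u = p) → volume D < κ →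
      (∀ F : Ultrafilter Torus, Ω ∈ F →
        (∃ t, (F : Filter Torus) ≤ 𝓝 t) ∨ Tendsto (fun p => (zc B p : ℂ)) F (𝓝 0)) →
      (∀ F : Ultrafilter Torus, frontier Ω ∈ F → f.dom ∈ F →
        (∃ t ∉ K.bad, (F : Filter Torus) ≤ 𝓝 t) ∨
          ∃ y ∈ E, Tendsto (fun p => LimitSurface.torus (f.map p)) F (𝓝 y)) →
      ∀ F : Ultrafilter Torus, Ω ∈ F → f.dom ∈ F →
        (∀ᶠ p in (F : Filter Torus), .torus (f.map p) ∉ V) → ∃ t, Tendsto f.map F (𝓝 t) := by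
  have hev : ∀ᶠ δ in 𝓝[>] (0 : ℝ), ∀ y ∈ E, ∃ W' ∈ 𝓝 y, ∀ s t : Torus, .torus s ∈ W' →
      (∀ i, ‖(s i : ℂ) / t i - 1‖ < δ) → .torus t ∈ V :=
    (hE.eventually_all).2 fun y hy => eventually_torus_mem_of_near (hV y hy)
  obtain ⟨δ, hδ, hδ01⟩ := (hev.and (Ioo_mem_nhdsGT one_pos)).exists
  obtain ⟨κ, hκ, h⟩ := hf.exists_mem_frontier B hδ01.1 hδ01.2.le
  refine ⟨κ, hκ, fun Ω D hΩ hD hcov hvol hlim hfr F hΩF hdF hVF => ?_⟩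
  -- `g p` is a boundary point whose value is close to that of `p` in the multiplicative sense.
  -- Values along `g` cannot tend to `E`, since `f p` would then enter `V`.
  choose! g hg1 hg2 hg3 using h Ω D hΩ hD hcov hvol hlim
  have hgd : ∀ᶠ p in (F : Filter Torus), g p ∈ f.dom := by
    filter_upwards [hΩF, hdF] with p h1 h2 using hg2 p h1 h2
  have hgn : ∀ᶠ p in (F : Filter Torus), ∀ i, ‖(f.map (g p) i : ℂ) / f.map p i - 1‖ < δ := by
    filter_upwards [hΩF, hdF] with p h1 h2 using hg3 p h1 h2
  have hno : ∀ y ∈ E, ¬ Tendsto (fun p => LimitSurface.torus (f.map (g p))) F (𝓝 y) := by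
    intro y hy hlim
    obtain ⟨W', hW', h2⟩ := hδ y hy
    obtain ⟨p, h3, h4, h5⟩ := ((hlim.eventually hW').and (hgn.and hVF)).exists
    exact h5 (h2 _ _ h3 h4)
  rcases hfr (F.map g) (by
      change ∀ᶠ p in (F : Filter Torus), g p ∈ frontier Ω
      filter_upwards [hΩF, hdF] with p h1 h2 using hg1 p h1 h2) hgd with ⟨t, htb, ht⟩ | ⟨y, hy, hlim⟩
  · have ht' : Tendsto g F (𝓝 t) := ht
    -- If `g` converges in `dom f`, its values converge in `𝕋`, and so do the nearby ones. Otherwise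
    -- the limit is a good point of a contracted curve, whose image belongs to `E`.
    by_cases htd : t ∈ f.dom
    · exact exists_tendsto_of_near ((f.continuousAt_map htd).tendsto.comp ht') hδ01.2 hgn
    · obtain ⟨a, ha⟩ := K.exists_isGood htd htb
      exact absurd (ha.tendsto_map ht' hgd) (hno _ (hKE a))
  · exact absurd hlim (hno y hy)

end ToricSurface

/-! ### Limits at points of the torus, and thin regions near a pole -/

namespace ToricSurface

open Filter MvPolynomial MeasureTheory

variable {f : RatMap} {B B' : Matrix.SpecialLinearGroup (Fin 2) ℤ}

instance : LocallyCompactSpace ℂˣ := Units.isOpenEmbedding_val.locallyCompactSpace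

theorem RatMap.Contractions.finite_range_point (K : f.Contractions) :
    (Set.range fun a => (K.K a).point).Finite :=
  haveI := K.finite
  Set.finite_range _

theorem expU_log (z : ℂˣ) : expU (Complex.log z) = z := by
  ext
  simp [expU, Complex.exp_log]

theorem expU_log_add (z w : ℂˣ) : expU (Complex.log w + Complex.log (z / w)) = z := by
  ext
  have h : (z : ℂ) / w ≠ 0 := div_ne_zero z.ne_zero w.ne_zero
  simp only [expU, Units.val_mk0, Complex.exp_add, Complex.exp_log h, Complex.exp_log w.ne_zero]
  exact mul_div_cancel₀ _ w.ne_zero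

theorem ex_log (t p : Torus) :
    ex 1 (fun i => Complex.log (t i) + Complex.log (p i / t i)) = p := by
  simp only [ex, expU_log_add]
  rw [← zc_one p, ← wc_one p, tor_zc_wc]

/-- A small neighborhood of `t` has small volume in a branch of the logarithm. It may be chosen with
no bad point except possibly `t`, which is interior, so the boundary behaves well. -/
theorem RatMap.IsToric.exists_tendsto_of_le_nhds (hf : f.IsToric) (K : f.Contractions)
    {V : Set LimitSurface} (hV : ∀ a, V ∈ 𝓝 (K.K a).point) {F : Ultrafilter Torus} {t : Torus}
    (ht : (F : Filter Torus) ≤ 𝓝 t) (hd : f.dom ∈ F)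
    (hVF : ∀ᶠ p in (F : Filter Torus), .torus (f.map p) ∉ V) : ∃ s, Tendsto f.map F (𝓝 s) := by
  obtain ⟨κ, hκ, h⟩ := hf.exists_tendsto_of_frontier K 1 K.finite_range_point
    (Set.forall_mem_range.2 hV) (fun a => ⟨a, rfl⟩)
  set L : Torus → Fin 2 → ℂ := fun p i => Complex.log (t i) + Complex.log (p i / t i) with hL
  have hLt : ContinuousAt L t := by
    refine continuousAt_pi.2 fun i => ContinuousAt.const_add ?_ _
    refine ContinuousAt.clog ?_ ?_
    · exact ((Units.continuous_val.comp (continuous_apply i)).div_const _).continuousAt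
    · rw [div_self (t i).ne_zero]; exact Complex.one_mem_slitPlane
  obtain ⟨D, hDt, hDo, hDκ⟩ := Set.exists_isOpen_lt_of_lt ({L t} : Set (Fin 2 → ℂ)) (μ := volume) κ
    (by rwa [measure_singleton])
  have h1 : L ⁻¹' D ∩ (K.bad \ {t})ᶜ ∈ 𝓝 t :=
    inter_mem (hLt.preimage_mem_nhds (hDo.mem_nhds (hDt rfl)))
      ((K.finite_bad.sdiff.isClosed.isOpen_compl).mem_nhds (by simp))
  obtain ⟨Q, hQt, hQs, hQ⟩ := local_compact_nhds h1
  have hcl : closure (interior Q) ⊆ Q := closure_minimal interior_subset hQ.isClosed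
  refine h (interior Q) D isOpen_interior hDo.measurableSet ?_ hDκ ?_ ?_ F
    (ht (interior_mem_nhds.2 hQt)) hd hVF
  · exact fun p hp => ⟨L p, (hQs (interior_subset hp)).1, ex_log t p⟩
  · intro G hG
    obtain ⟨x, -, hx⟩ := hQ.ultrafilter_le_nhds G
      (le_principal_iff.2 (mem_of_superset hG interior_subset))
    exact .inl ⟨x, hx⟩
  · intro G hG _
    obtain ⟨x, -, hx⟩ := hQ.ultrafilter_le_nhds G
      (le_principal_iff.2 (mem_of_superset hG (frontier_subset_closure.trans hcl)))
    have hxf : x ∈ frontier (interior Q) :=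
      isClosed_iff_ultrafilter.1 isClosed_frontier x G hx hG
    refine .inl ⟨x, fun hb => ?_, hx⟩
    refine (hQs (hcl (frontier_subset_closure hxf))).2 ⟨hb, ?_⟩
    rintro rfl
    exact hxf.2 (by rw [interior_interior]; exact mem_interior_iff_mem_nhds.2 hQt)

/-- Thin regions near a pole have small volume in logarithmic coordinates. -/
theorem exists_thin (w₀ : ℂ) {N : ℕ} (hN : 0 < N) {C : ℝ} (hC : 0 ≤ C) {κ : ENNReal} (hκ : 0 < κ) :
    ∃ D : Set (Fin 2 → ℂ), MeasurableSet D ∧ volume D < κ ∧ ∃ A : ℝ, ∀ u : Fin 2 → ℂ,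
      |(u 0).im| ≤ Real.pi → (u 0).re < A → ‖u 1 - w₀‖ ≤ C * Real.exp ((u 0).re / N) → u ∈ D := by
  -- Boxes around `log z ≈ -k` have volume proportional to `exp (-2 k / N)`, so a tail of the series
  -- is below `κ`. The radius `5` suffices because `1 + π < 5`.
  set S : ℕ → Set (Fin 2 → ℂ) := fun k => Set.univ.pi
    ![Metric.closedBall (-(k : ℂ)) 5, Metric.closedBall w₀ (C * Real.exp (-k / N))] with hS
  have hSm : ∀ k, MeasurableSet (S k) := fun k => MeasurableSet.univ_pi
    (Fin.forall_fin_two.2 ⟨measurableSet_closedBall, measurableSet_closedBall⟩)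
  set ρ : ℝ := Real.exp (-2 / N) with hρ
  have hN' : (0 : ℝ) < N := by exact_mod_cast hN
  have hρ1 : ρ < 1 := by
    rw [hρ, Real.exp_lt_one_iff]
    exact div_neg_of_neg_of_pos (by norm_num) hN'
  have hvol : ∀ k, volume (S k) = ENNReal.ofReal (25 * C ^ 2 * ρ ^ k) * (NNReal.pi * NNReal.pi) := by
    intro k
    have h1 : (C * Real.exp (-k / N)) ^ 2 = C ^ 2 * ρ ^ k := by
      rw [mul_pow, hρ, ← Real.exp_nat_mul, ← Real.exp_nat_mul]
      congr 2
      push_cast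
      ring
    rw [hS, volume_pi_pi, Fin.prod_univ_two]
    simp only [Matrix.cons_val_zero, Matrix.cons_val_one, Complex.volume_closedBall]
    rw [← ENNReal.ofReal_pow (by norm_num), ← ENNReal.ofReal_pow (by positivity), h1, mul_assoc 25,
      ENNReal.ofReal_mul (p := 25) (by norm_num)]
    norm_num
    ring
  have hsum : ∑' k, volume (S k) ≠ ⊤ := by
    simp only [hvol]
    rw [ENNReal.tsum_mul_right]
    refine ENNReal.mul_ne_top ?_ (ENNReal.mul_ne_top ENNReal.coe_ne_top ENNReal.coe_ne_top)
    exact ((summable_geometric_of_lt_one (Real.exp_pos _).le hρ1).mul_left _).tsum_ofReal_ne_top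
  obtain ⟨m, hm⟩ := ((ENNReal.tendsto_sum_nat_add _ hsum).eventually (gt_mem_nhds hκ)).exists
  refine ⟨⋃ k, S (k + m), .iUnion fun k => hSm _, (measure_iUnion_le _).trans_lt hm, -m, ?_⟩
  intro u h1 h2 h3
  have h0 : 0 ≤ -(u 0).re := by
    have : (0 : ℝ) ≤ m := Nat.cast_nonneg m
    linarith
  have h4 := Nat.floor_le h0
  have h5 := Nat.lt_floor_add_one (-(u 0).re)
  have h6 : m ≤ ⌊-(u 0).re⌋₊ := Nat.le_floor (by linarith)
  refine Set.mem_iUnion.2 ⟨⌊-(u 0).re⌋₊ - m, ?_⟩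
  rw [Nat.sub_add_cancel h6]
  set k := ⌊-(u 0).re⌋₊
  refine Set.mem_univ_pi.2 (Fin.forall_fin_two.2 ⟨?_, ?_⟩)
  · simp only [Matrix.cons_val_zero, mem_closedBall_iff_norm, sub_neg_eq_add]
    refine (Complex.norm_le_abs_re_add_abs_im _).trans ?_
    have h7 : |(u 0 + k).re| ≤ 1 := by
      rw [Complex.add_re, Complex.natCast_re, abs_le]
      constructor <;> linarith
    have h8 : (u 0 + k).im = (u 0).im := by simp
    rw [h8]
    linarith [Real.pi_lt_four]
  · change u 1 ∈ Metric.closedBall w₀ (C * Real.exp (-k / N))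
    rw [mem_closedBall_iff_norm]
    refine h3.trans (mul_le_mul_of_nonneg_left (Real.exp_le_exp.2 ?_) hC)
    gcongr
    linarith

/-- Along curves that are not too tangential to a pole, `f` converges to a point of the
image pole. -/
theorem RatMap.IsToric.exists_pole_point (hf : f.IsToric) {r : ℕ} (hr0 : 0 < r)
    (hr : ∀ i, f.ord B i = r * B'.1 i 0) (w₀ : ℂˣ) :
    ∃ (N : ℕ) (c : ℂˣ), 0 < N ∧ ∀ F : Filter Torus, Tendsto (fun p => (zc B p : ℂ)) F (𝓝 0) →
      Tendsto (wc B) F (𝓝 w₀) →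
      (∀ᶠ p in F, wc B p ≠ w₀ ∧ ‖(zc B p : ℂ)‖ ≤ ‖(wc B p : ℂ) - w₀‖ ^ N) →
      Tendsto (fun p => LimitSurface.torus (f.map p)) F (𝓝 (.pole (firstCol B') c)) := by
  obtain ⟨N, k, c, d, hc, hd, hkN, h⟩ := hf.exists_pole_limit hr0 hr w₀.ne_zero
  refine ⟨N, Units.mk0 c hc, by omega, fun F hz hw hzw => tendsto_torus_pole_iff.2 ?_⟩
  have hw' : Tendsto (fun p => (wc B p : ℂ)) F (𝓝 w₀) := (Units.continuous_val.tendsto _).comp hw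
  obtain ⟨hreg, h1, h2⟩ := h F (fun p => (zc B p : ℂ)) (fun p => (wc B p : ℂ)) hz hw'
    (hzw.mono fun p hp => ⟨fun h0 => hp.1 (Units.ext h0), hp.2⟩)
  have hdom : ∀ᶠ p in F, p ∈ f.dom := hreg.mono fun p hp => f.mem_dom_iff_regular.2 hp
  constructor
  · have h3 : Tendsto (fun p => (zc B p : ℂ) ^ r * ((wc B p : ℂ) - w₀) ^ k) F (𝓝 0) := by
      have h4 : Tendsto (fun p => (wc B p : ℂ) - w₀) F (𝓝 0) := by
        simpa using hw'.sub_const (w₀ : ℂ)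
      refine squeeze_zero_norm' ?_ (by simpa using h4.norm)
      filter_upwards [hzw, hz.norm.eventually (gt_mem_nhds (by simp : ‖(0 : ℂ)‖ < 1)),
        h4.norm.eventually (gt_mem_nhds (by simp : ‖(0 : ℂ)‖ < 1))] with p hp hp1 hp2
      have hx : 0 < ‖(wc B p : ℂ) - w₀‖ :=
        norm_pos_iff.2 (sub_ne_zero.2 fun h0 => hp.1 (Units.ext h0))
      rw [norm_mul, norm_pow, norm_zpow]
      calc ‖(zc B p : ℂ)‖ ^ r * ‖(wc B p : ℂ) - w₀‖ ^ k
          ≤ ‖(wc B p : ℂ) - w₀‖ ^ (N : ℤ) * ‖(wc B p : ℂ) - w₀‖ ^ k := by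
            gcongr
            rw [zpow_natCast]
            exact (pow_le_of_le_one (norm_nonneg _) hp1.le hr0.ne').trans hp.2
        _ = ‖(wc B p : ℂ) - w₀‖ ^ (N + k : ℤ) := (zpow_add₀ hx.ne' _ _).symm
        _ ≤ ‖(wc B p : ℂ) - w₀‖ ^ (1 : ℤ) :=
            zpow_le_zpow_right_of_le_one₀ hx hp2.le (by omega)
        _ = _ := zpow_one _
    have h5 := h3.mul h2
    rw [zero_mul] at h5
    refine h5.congr' ?_
    filter_upwards [hzw, hdom] with p hp hpd
    rw [RatMap.coe_zc_map hr hpd]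
    have hx : (wc B p : ℂ) - w₀ ≠ 0 := sub_ne_zero.2 fun h0 => hp.1 (Units.ext h0)
    rw [mul_assoc, mul_div_cancel₀ _ (zpow_ne_zero _ hx)]
  · refine Units.isOpenEmbedding_val.isEmbedding.tendsto_nhds_iff.2 ?_
    refine h1.congr' ?_
    filter_upwards [hdom] with p hpd
    rw [Function.comp_apply, RatMap.coe_wc_map hr hpd]

end ToricSurface

/-! ### Limits at points of a pole -/

namespace ToricSurface

open Filter MvPolynomial MeasureTheory

variable {f : RatMap} {B B' : Matrix.SpecialLinearGroup (Fin 2) ℤ}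

/-- The box is relatively compact in a chart, since `b < ‖w₀‖` keeps `w` away from zero. -/
theorem exists_limit_of_box {ι : Type*} {F : Ultrafilter ι} {p : ι → Torus} {w₀ : ℂ} {A b : ℝ}
    (hb : b < ‖w₀‖)
    (h : ∀ᶠ n in (F : Filter ι), ‖(zc B (p n) : ℂ)‖ ≤ A ∧ ‖(wc B (p n) : ℂ) - w₀‖ ≤ b) :
    (∃ t, Tendsto p F (𝓝 t)) ∨ ∃ c, Tendsto (fun n => (zc B (p n) : ℂ)) F (𝓝 0) ∧
      Tendsto (fun n => wc B (p n)) F (𝓝 c) := by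
  obtain ⟨z₁, -, hz₁⟩ := (isCompact_closedBall (0 : ℂ) A).ultrafilter_le_nhds
    (F.map fun n => (zc B (p n) : ℂ)) (by
      rw [le_principal_iff]
      change ∀ᶠ n in (F : Filter ι), _
      exact h.mono fun n hn => by simpa using hn.1)
  obtain ⟨w₁, hw₁m, hw₁⟩ := (isCompact_closedBall w₀ b).ultrafilter_le_nhds
    (F.map fun n => (wc B (p n) : ℂ)) (by
      rw [le_principal_iff]
      change ∀ᶠ n in (F : Filter ι), _
      exact h.mono fun n hn => mem_closedBall_iff_norm.2 hn.2)
  have hz : Tendsto (fun n => (zc B (p n) : ℂ)) F (𝓝 z₁) := hz₁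
  have hw : Tendsto (fun n => (wc B (p n) : ℂ)) F (𝓝 w₁) := hw₁
  have hw0 : w₁ ≠ 0 := by
    rintro rfl
    rw [mem_closedBall_iff_norm, zero_sub, norm_neg] at hw₁m
    linarith
  have hw' : Tendsto (fun n => wc B (p n)) F (𝓝 (Units.mk0 w₁ hw0)) :=
    Units.isOpenEmbedding_val.isEmbedding.tendsto_nhds_iff.2 hw
  by_cases hz0 : z₁ = 0
  · exact .inr ⟨_, hz0 ▸ hz, hw'⟩
  · have hz' : Tendsto (fun n => zc B (p n)) F (𝓝 (Units.mk0 z₁ hz0)) :=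
      Units.isOpenEmbedding_val.isEmbedding.tendsto_nhds_iff.2 hz
    refine .inl ⟨tor B (Units.mk0 z₁ hz0) (Units.mk0 w₁ hw0), ?_⟩
    have := ((continuous_tor B).tendsto (Units.mk0 z₁ hz0, Units.mk0 w₁ hw0)).comp
      (hz'.prodMk_nhds hw')
    simpa only [Function.comp_def, tor_zc_wc] using this

theorem ex_log_chart (p : Torus) (w₀ : ℂˣ) : ex B ![Complex.log (zc B p),
    Complex.log w₀ + Complex.log (wc B p / w₀)] = p := by
  simp only [ex, Matrix.cons_val_zero, Matrix.cons_val_one, Matrix.cons_val_fin_one, expU_log_add,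
    expU_log, tor_zc_wc]

theorem norm_log_div_le {w w₀ : ℂ} (hw₀ : w₀ ≠ 0) (h : ‖w - w₀‖ ≤ ‖w₀‖ / 2) :
    ‖Complex.log (w / w₀)‖ ≤ 3 / 2 / ‖w₀‖ * ‖w - w₀‖ := by
  have hp : 0 < ‖w₀‖ := norm_pos_iff.2 hw₀
  have h1 : w / w₀ = 1 + (w - w₀) / w₀ := by field_simp; ring
  have h2 : ‖(w - w₀) / w₀‖ ≤ 1 / 2 := by
    rw [norm_div, div_le_iff₀ hp]; linarith
  rw [h1]
  refine (Complex.norm_log_one_add_half_le_self h2).trans (le_of_eq ?_)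
  rw [norm_div]; ring

/-- Near a point of a pole, the limit points of `f` at infinity are the images of the contracted
curves and the image of the point under the restriction of `f` to the pole. -/
theorem RatMap.IsToric.exists_tendsto_of_pole (hf : f.IsToric) (K : f.Contractions) {r : ℕ}
    (hr0 : 0 < r) (hr : ∀ i, f.ord B i = r * B'.1 i 0) (w₀ : ℂˣ) :
    ∃ c : ℂˣ, ∀ V : Set LimitSurface, (∀ a, V ∈ 𝓝 (K.K a).point) →
      V ∈ 𝓝 (.pole (firstCol B') c) → ∀ F : Ultrafilter Torus,
      Tendsto (fun p => (zc B p : ℂ)) F (𝓝 0) → Tendsto (wc B) F (𝓝 w₀) → f.dom ∈ F →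
      (∀ᶠ p in (F : Filter Torus), .torus (f.map p) ∉ V) → ∃ t, Tendsto f.map F (𝓝 t) := by
  obtain ⟨N, c, hN, hlimc⟩ := hf.exists_pole_point hr0 hr w₀
  refine ⟨c, fun V hV hVc F hz hw hdF hVF => ?_⟩
  obtain ⟨κ, hκ, h⟩ := hf.exists_tendsto_of_frontier K B
    (K.finite_range_point.insert (.pole (firstCol B') c)) (V := V)
    (by
      rintro y (rfl | ⟨a, rfl⟩)
      exacts [hVc, hV a]) (fun a => .inr ⟨a, rfl⟩)
  have hw₀ : 0 < ‖(w₀ : ℂ)‖ := norm_pos_iff.2 w₀.ne_zero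
  obtain ⟨D, hDm, hDκ, A, hDA⟩ := exists_thin (Complex.log w₀) hN
    (C := 3 / 2 / ‖(w₀ : ℂ)‖) (by positivity) hκ
  have hbad : ∀ᶠ ε in 𝓝[>] (0 : ℝ), ∀ b ∈ K.bad, ε < ‖(zc B b : ℂ)‖ :=
    K.finite_bad.eventually_all.2 fun b _ =>
      mem_nhdsWithin_of_mem_nhds (gt_mem_nhds (norm_pos_iff.2 (zc B b).ne_zero))
  -- `ε` keeps the bad points out, puts logarithms of points of the horn into the thin set `D`, and
  -- ensures `|w - w₀| ≤ |w₀| / 2`.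
  obtain ⟨ε, ⟨⟨hεb, hεA⟩, hεw⟩, hε0⟩ := (((hbad.and
    (mem_nhdsWithin_of_mem_nhds (gt_mem_nhds (Real.exp_pos A)))).and
    (mem_nhdsWithin_of_mem_nhds (gt_mem_nhds (pow_pos (half_pos hw₀) N)))).and
    self_mem_nhdsWithin).exists
  have hε0 : 0 < ε := hε0
  have hcz : Continuous fun p => ‖(zc B p : ℂ)‖ :=
    (Units.continuous_val.comp (continuous_zc B)).norm
  have hcw : Continuous fun p => ‖(wc B p : ℂ) - w₀‖ ^ N :=
    ((Units.continuous_val.comp (continuous_wc B)).sub continuous_const).norm.pow N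
  set Ω : Set Torus := {p | ‖(wc B p : ℂ) - w₀‖ ^ N < ‖(zc B p : ℂ)‖ ∧ ‖(zc B p : ℂ)‖ < ε} with hΩ
  have hΩo : IsOpen Ω := (isOpen_lt hcw hcz).inter (isOpen_lt hcz continuous_const)
  have hcl : ∀ p ∈ closure Ω, ‖(wc B p : ℂ) - w₀‖ ^ N ≤ ‖(zc B p : ℂ)‖ ∧ ‖(zc B p : ℂ)‖ ≤ ε := by
    intro p hp
    exact closure_minimal (s := Ω) (t := {p | ‖(wc B p : ℂ) - w₀‖ ^ N ≤ ‖(zc B p : ℂ)‖ ∧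
      ‖(zc B p : ℂ)‖ ≤ ε}) (fun q hq => ⟨hq.1.le, hq.2.le⟩)
      ((isClosed_le hcw hcz).inter (isClosed_le hcz continuous_const)) hp
  have hhalf : ∀ p, ‖(wc B p : ℂ) - w₀‖ ^ N ≤ ‖(zc B p : ℂ)‖ → ‖(zc B p : ℂ)‖ ≤ ε →
      ‖(wc B p : ℂ) - w₀‖ ≤ ‖(w₀ : ℂ)‖ / 2 := fun p h1 h2 =>
    le_of_pow_le_pow_left₀ hN.ne' (by positivity) ((h1.trans h2).trans hεw.le)
  have hbox : ∀ G : Ultrafilter Torus, closure Ω ∈ G → (∃ t, (G : Filter Torus) ≤ 𝓝 t) ∨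
      ∃ c, Tendsto (fun p => (zc B p : ℂ)) G (𝓝 0) ∧ Tendsto (wc B) G (𝓝 c) := by
    intro G hG
    refine exists_limit_of_box (p := id) (half_lt_self hw₀) (A := ε) ?_
    filter_upwards [hG] with p hp
    exact ⟨(hcl p hp).2, hhalf p (hcl p hp).1 (hcl p hp).2⟩
  -- Outside the horn `f` tends to the point of the pole with coordinate `c`, whose neighborhood `V`
  -- is avoided; so the ultrafilter lives in the horn.
  by_cases hcase : ∀ᶠ p in (F : Filter Torus),
      wc B p ≠ w₀ ∧ ‖(zc B p : ℂ)‖ ≤ ‖(wc B p : ℂ) - w₀‖ ^ N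
  · obtain ⟨p, h1, h2⟩ := (((hlimc F hz hw hcase).eventually hVc).and hVF).exists
    exact absurd h1 h2
  rw [← Ultrafilter.eventually_not] at hcase
  refine h Ω D hΩo hDm ?_ hDκ ?_ ?_ F ?_ hdF hVF
  · rintro p ⟨h1, h2⟩
    refine ⟨_, hDA _ ?_ ?_ ?_, ex_log_chart p w₀⟩
    · simpa [Complex.log_im] using Complex.abs_arg_le_pi _
    · simp only [Matrix.cons_val_zero, Complex.log_re]
      exact (Real.log_lt_iff_lt_exp (norm_pos_iff.2 (zc B p).ne_zero)).2 (h2.trans hεA)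
    · simp only [Matrix.cons_val_zero, Complex.log_re, Matrix.cons_val_one,
        Matrix.cons_val_fin_one, add_sub_cancel_left]
      refine (norm_log_div_le w₀.ne_zero (hhalf p h1.le h2.le)).trans ?_
      gcongr
      refine (lt_of_pow_lt_pow_left₀ N (Real.exp_pos _).le (h1.trans_eq ?_)).le
      rw [← Real.exp_nat_mul, mul_div_cancel₀ _ (by exact_mod_cast hN.ne'),
        Real.exp_log (norm_pos_iff.2 (zc B p).ne_zero)]
  · intro G hG
    exact (hbox G (mem_of_superset hG subset_closure)).imp id fun ⟨c, hc⟩ => hc.1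
  · intro G hG hGd
    have hGcl : closure Ω ∈ G := mem_of_superset hG frontier_subset_closure
    rcases hbox G hGcl with ⟨t, ht⟩ | ⟨c', hz', hw'⟩
    · refine .inl ⟨t, fun hb => ?_, ht⟩
      have h1 := isClosed_iff_ultrafilter.1 isClosed_closure t G ht hGcl
      exact absurd (hcl t h1).2 (not_le.2 (hεb t hb))
    -- On the part of the boundary that approaches the pole there is equality, so `w → w₀` and
    -- `exists_pole_point` applies there.
    · have hev : ∀ᶠ p in (G : Filter Torus), ‖(wc B p : ℂ) - w₀‖ ^ N = ‖(zc B p : ℂ)‖ := by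
        filter_upwards [hG, hz'.norm.eventually (gt_mem_nhds (by simpa using hε0))] with p h1 h2
        refine le_antisymm (hcl p (frontier_subset_closure h1)).1 (not_lt.1 fun h3 => ?_)
        exact h1.2 (by rw [hΩo.interior_eq]; exact ⟨h3, h2⟩)
      have hpow : Tendsto (fun p => ‖(wc B p : ℂ) - w₀‖ ^ N) G (𝓝 0) :=
        (tendsto_congr' hev).2 (by simpa using hz'.norm)
      have hw'' : Tendsto (fun p => ‖(wc B p : ℂ) - w₀‖ ^ N) G (𝓝 (‖(c' : ℂ) - w₀‖ ^ N)) :=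
        ((((Units.continuous_val.tendsto _).comp hw').sub_const _).norm).pow N
      have h0 := tendsto_nhds_unique hw'' hpow
      rw [pow_eq_zero_iff hN.ne', norm_eq_zero, sub_eq_zero] at h0
      obtain rfl : c' = w₀ := Units.ext h0
      refine .inr ⟨_, .inl rfl, hlimc G hz' hw' ?_⟩
      filter_upwards [hev] with p hp
      refine ⟨?_, hp.symm.le⟩
      rintro h1
      rw [h1, sub_self, norm_zero, zero_pow hN.ne'] at hp
      exact (zc B p).ne_zero (norm_eq_zero.1 hp.symm)
  · filter_upwards [hcase, hz.norm.eventually (gt_mem_nhds (by simpa using hε0))] with p h1 h2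
    refine ⟨not_le.1 fun h3 => h1 ⟨?_, h3⟩, h2⟩
    rintro h4
    rw [h4, sub_self, norm_zero, zero_pow hN.ne'] at h3
    exact (zc B p).ne_zero (norm_le_zero_iff.1 h3)

end ToricSurface

/-! ### The maximum principle on fibers of a coordinate of the map -/

namespace ToricSurface

open Filter MvPolynomial

variable {f : RatMap} {B B' : Matrix.SpecialLinearGroup (Fin 2) ℤ}

/-- A toric map can be inverted holomorphically along the slices of a toric chart. -/
theorem RatMap.IsToric.exists_local_section (hf : f.IsToric)
    (B B' : Matrix.SpecialLinearGroup (Fin 2) ℤ) {p : Torus} (hp : p ∈ f.dom) :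
    ∃ g : ℂ → Torus, Tendsto g (𝓝 (wc B' (f.map p) : ℂ)) (𝓝 p) ∧ g (wc B' (f.map p)) = p ∧
      (∀ᶠ s in 𝓝 (wc B' (f.map p) : ℂ), g s ∈ f.dom ∧
        zc B' (f.map (g s)) = zc B' (f.map p) ∧ (wc B' (f.map (g s)) : ℂ) = s) ∧
      ∀ᶠ s in 𝓝 (wc B' (f.map p) : ℂ), DifferentiableAt ℂ (fun s => (zc B (g s) : ℂ)) s := by
  obtain ⟨ρ, hρ, hder⟩ := hf.exists_hasStrictFDerivAt
  set u₀ : Fin 2 → ℂ := ![Complex.log (zc B p), Complex.log 1 + Complex.log (wc B p / 1)] with hu₀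
  have hex : ex B u₀ = p := ex_log_chart p 1
  have hev : ∀ u, ex B u ∈ f.dom → f.expMap B B' 1 u =
      ![(zc B' (f.map (ex B u)) : ℂ), (wc B' (f.map (ex B u)) : ℂ)] := by
    intro u hu
    simp [RatMap.expMap_eq B' hu]
  have hequiv : ∀ u, ex B u ∈ f.dom → ∃ e : (Fin 2 → ℂ) ≃L[ℂ] (Fin 2 → ℂ),
      HasStrictFDerivAt (f.expMap B B' 1) (e : (Fin 2 → ℂ) →L[ℂ] (Fin 2 → ℂ)) u := by
    intro u hu
    obtain ⟨M, hM, hd⟩ := hder B B' 1 u hu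
    have hdet : (Matrix.toLin' M).toContinuousLinearMap.det ≠ 0 := by
      have h1 : (Matrix.toLin' M).toContinuousLinearMap.det = M.det := by
        rw [ContinuousLinearMap.det]
        exact LinearMap.det_toLin' M
      rw [h1, hM, hev u hu]
      exact mul_ne_zero hρ (mul_ne_zero (Units.ne_zero _) (Units.ne_zero _))
    refine ⟨ContinuousLinearMap.toContinuousLinearEquivOfDetNeZero _ hdet, ?_⟩
    rw [ContinuousLinearMap.coe_toContinuousLinearEquivOfDetNeZero]
    exact hd
  obtain ⟨e, he⟩ := hequiv u₀ (by rwa [hex])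
  -- The Jacobian is nonzero, so the inverse function theorem applies; the section fixes the first
  -- coordinate of the image and varies the second one, `s`.
  set Φ := he.toOpenPartialHomeomorph (f.expMap B B' 1) with hΦ
  have hu₀s : u₀ ∈ Φ.source := he.mem_toOpenPartialHomeomorph_source
  have hΦc : ∀ u, Φ u = f.expMap B B' 1 u := fun u => rfl
  set ζ : ℂ := (zc B' (f.map p) : ℂ) with hζ
  set s₀ : ℂ := (wc B' (f.map p) : ℂ) with hs₀
  have hΦu₀ : Φ u₀ = ![ζ, s₀] := by
    rw [hΦc, hev u₀ (by rwa [hex]), hex]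
  have hline : Continuous fun s : ℂ => (![ζ, s] : Fin 2 → ℂ) :=
    continuous_pi (Fin.forall_fin_two.2 ⟨continuous_const, continuous_id⟩)
  have htar : ![ζ, s₀] ∈ Φ.target := hΦu₀ ▸ Φ.map_source hu₀s
  have hsymm₀ : Φ.symm ![ζ, s₀] = u₀ := by rw [← hΦu₀, Φ.left_inv hu₀s]
  have hev_tar : ∀ᶠ s in 𝓝 s₀, ![ζ, s] ∈ Φ.target :=
    hline.continuousAt.eventually (Φ.open_target.mem_nhds htar)
  have hsymm : Tendsto (fun s => Φ.symm ![ζ, s]) (𝓝 s₀) (𝓝 u₀) := by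
    have h1 := (Φ.continuousAt_symm htar).tendsto.comp (hline.tendsto s₀)
    rwa [hsymm₀] at h1
  have hgt : Tendsto (fun s => ex B (Φ.symm ![ζ, s])) (𝓝 s₀) (𝓝 p) := by
    have h1 := ((continuous_ex B).tendsto u₀).comp hsymm
    rwa [hex] at h1
  have hgd : ∀ᶠ s in 𝓝 s₀, ex B (Φ.symm ![ζ, s]) ∈ f.dom :=
    hgt.eventually (f.isOpen_dom.mem_nhds hp)
  refine ⟨fun s => ex B (Φ.symm ![ζ, s]), hgt, ?_, ?_, ?_⟩
  · simp only [hsymm₀, hex]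
  · filter_upwards [hgd, hev_tar] with s h1 h2
    have h3 := Φ.right_inv h2
    rw [hΦc, hev _ h1] at h3
    refine ⟨h1, Units.ext ?_, ?_⟩
    · simpa using congrFun h3 0
    · simpa using congrFun h3 1
  · filter_upwards [hgd, hev_tar] with s h1 h2
    obtain ⟨e', he'⟩ := hequiv _ h1
    have h3 := (Φ.hasFDerivAt_symm h2 (f' := e') he'.hasFDerivAt).differentiableAt
    have h4 : DifferentiableAt ℂ (fun s : ℂ => (![ζ, s] : Fin 2 → ℂ)) s :=
      differentiableAt_pi.2 (Fin.forall_fin_two.2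
        ⟨differentiableAt_const _, differentiableAt_id⟩)
    have h5 : DifferentiableAt ℂ (fun s => Φ.symm ![ζ, s]) s := h3.comp s h4
    simp only [ex, zc_tor, expU, Units.val_mk0]
    exact (differentiableAt_pi.1 h5 0).cexp

/-- The maximum principle on the fibers of a coordinate of `f`. -/
theorem RatMap.IsToric.exists_extremal (hf : f.IsToric)
    (B B' : Matrix.SpecialLinearGroup (Fin 2) ℤ) {S : Set Torus} (hS : IsCompact S)
    (hne : S.Nonempty) (hSd : S ⊆ f.dom) (c : ℂ) :
    ∃ p ∈ S, (∀ q ∈ S, ‖(zc B q : ℂ)‖ ≤ ‖(zc B p : ℂ)‖) ∧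
      ¬ ∀ᶠ q in 𝓝 p, q ∈ f.dom → zc B' (f.map q) = zc B' (f.map p) →
        ‖(zc B p : ℂ)‖ ≤ ‖(zc B q : ℂ)‖ → q ∈ S := by
  have hcz : Continuous fun p => ‖(zc B p : ℂ)‖ :=
    (Units.continuous_val.comp (continuous_zc B)).norm
  obtain ⟨p₁, hp₁, hmax₁⟩ := hS.exists_isMaxOn hne hcz.continuousOn
  have hM : IsCompact (S ∩ {p | ‖(zc B p₁ : ℂ)‖ ≤ ‖(zc B p : ℂ)‖}) :=
    hS.inter_right (isClosed_le continuous_const hcz)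
  have hcw : ContinuousOn (fun p => ‖(wc B' (f.map p) : ℂ) - c‖)
      (S ∩ {p | ‖(zc B p₁ : ℂ)‖ ≤ ‖(zc B p : ℂ)‖}) := fun p hp =>
    ((((Units.continuous_val.comp (continuous_wc B')).continuousAt.comp
      (f.continuousAt_map (hSd hp.1))).sub continuousAt_const).norm).continuousWithinAt
  -- Among the maxima of `|z|` one is chosen with the largest `|w' - c|`. If it were interior, `z`
  -- would be constant on the fiber near it, and `|s - c|` would have a local maximum, which is
  -- impossible.
  obtain ⟨p, ⟨hpS, hp1⟩, hmax₂⟩ := hM.exists_isMaxOn ⟨p₁, hp₁, by simp⟩ hcw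
  have hmax : ∀ q ∈ S, ‖(zc B q : ℂ)‖ ≤ ‖(zc B p : ℂ)‖ := fun q hq => (hmax₁ hq).trans hp1
  refine ⟨p, hpS, hmax, fun hint => ?_⟩
  obtain ⟨g, hgt, hgp, hgs, hgdiff⟩ := hf.exists_local_section B B' (hSd hpS)
  have hgS : ∀ᶠ s in 𝓝 (wc B' (f.map p) : ℂ), ‖(zc B p : ℂ)‖ ≤ ‖(zc B (g s) : ℂ)‖ → g s ∈ S := by
    filter_upwards [hgt.eventually hint, hgs] with s h1 h2 h3
    exact h1 h2.1 h2.2.1 h3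
  have hloc : IsLocalMax (norm ∘ fun s => (zc B (g s) : ℂ)) (wc B' (f.map p) : ℂ) := by
    filter_upwards [hgS] with s h1
    simp only [Function.comp_apply, hgp]
    by_contra! h2
    exact absurd (hmax _ (h1 h2.le)) (not_le.2 h2)
  have hconst := Complex.eventually_eq_of_isLocalMax_norm hgdiff hloc
  have hloc₂ : IsLocalMax (norm ∘ fun s : ℂ => s - c) (wc B' (f.map p) : ℂ) := by
    filter_upwards [hgS, hconst, hgs] with s h1 h2 h3
    rw [hgp] at h2
    have h4 := hmax₂ (show g s ∈ S ∩ _ from ⟨h1 (by rw [h2]), by rw [Set.mem_ofPred_eq, h2]; exact hp1⟩)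
    simp only [Set.mem_ofPred_eq, h3.2.2] at h4
    exact h4
  have hconst₂ := Complex.eventually_eq_of_isLocalMax_norm
    (Eventually.of_forall fun s => differentiableAt_id.sub_const c) hloc₂
  obtain ⟨s, hs1, hs2⟩ := ((hconst₂.filter_mono nhdsWithin_le_nhds).and
    (self_mem_nhdsWithin (s := {(wc B' (f.map p) : ℂ)}ᶜ))).exists
  exact hs2 (sub_left_injective hs1)

end ToricSurface

namespace ToricSurface

open Filter MvPolynomial

variable {f : RatMap} {B B' : Matrix.SpecialLinearGroup (Fin 2) ℤ}

theorem exists_tendsto_of_forall_nhds {α X : Type*} [TopologicalSpace X] {F : Ultrafilter α}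
    {g : α → X} {E : Set X} (hE : E.Finite) {q : Prop}
    (h : ∀ V : Set X, (∀ y ∈ E, V ∈ 𝓝 y) → (∀ᶠ n in (F : Filter α), g n ∉ V) → q) :
    q ∨ ∃ y ∈ E, Tendsto g F (𝓝 y) := by
  by_contra! hcon
  obtain ⟨hq, hE'⟩ := hcon
  have h1 : ∀ y ∈ E, ∃ V ∈ 𝓝 y, ∀ᶠ n in (F : Filter α), g n ∉ V := by
    intro y hy
    have h2 := hE' y hy
    simp only [Tendsto, le_def, not_forall] at h2
    obtain ⟨V, hV, h3⟩ := h2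
    exact ⟨V, hV, Ultrafilter.eventually_not.2 h3⟩
  choose! V hV hV' using h1
  refine hq (h (⋃ y ∈ E, V y) (fun y hy => mem_of_superset (hV y hy)
    (Set.subset_biUnion_of_mem hy)) ?_)
  filter_upwards [hE.eventually_all.2 hV'] with n hn
  simpa using hn

theorem RatMap.IsToric.limits_of_le_nhds (hf : f.IsToric) (K : f.Contractions)
    {F : Ultrafilter Torus} {t : Torus} (ht : (F : Filter Torus) ≤ 𝓝 t) (hd : f.dom ∈ F) :
    (∃ s, Tendsto f.map F (𝓝 s)) ∨
      ∃ a, Tendsto (fun p => LimitSurface.torus (f.map p)) F (𝓝 (K.K a).point) := by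
  refine (exists_tendsto_of_forall_nhds K.finite_range_point fun V hV hVF =>
    hf.exists_tendsto_of_le_nhds K (fun a => hV _ ⟨a, rfl⟩) ht hd hVF).imp id ?_
  rintro ⟨-, ⟨a, rfl⟩, h⟩
  exact ⟨a, h⟩

/-- `c` is the value of `f` at the point `w₀` of a pole, in the sense that near this point
there are no other limit points of `f` than this value, the images of the contracted curves,
and points of the torus. -/
def RatMap.Contractions.IsPoleValue (K : f.Contractions) (B B' : Matrix.SpecialLinearGroup (Fin 2) ℤ)
    (w₀ c : ℂˣ) : Prop :=
  ∀ F : Ultrafilter Torus, Tendsto (fun p => (zc B p : ℂ)) F (𝓝 0) → Tendsto (wc B) F (𝓝 w₀) →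
    f.dom ∈ F → (∃ s, Tendsto f.map F (𝓝 s)) ∨
      (∃ a, Tendsto (fun p => LimitSurface.torus (f.map p)) F (𝓝 (K.K a).point)) ∨
      Tendsto (fun p => LimitSurface.torus (f.map p)) F (𝓝 (.pole (firstCol B') c))

theorem RatMap.IsToric.exists_isPoleValue (hf : f.IsToric) (K : f.Contractions) {r : ℕ}
    (hr0 : 0 < r) (hr : ∀ i, f.ord B i = r * B'.1 i 0) (w₀ : ℂˣ) :
    ∃ c : ℂˣ, K.IsPoleValue B B' w₀ c := by
  obtain ⟨c, h⟩ := hf.exists_tendsto_of_pole K hr0 hr w₀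
  refine ⟨c, fun F hz hw hd => ?_⟩
  refine (exists_tendsto_of_forall_nhds (K.finite_range_point.insert (.pole (firstCol B') c))
    fun V hV hVF => h V (fun a => hV _ (.inr ⟨a, rfl⟩)) (hV _ (.inl rfl)) F hz hw hd hVF).imp id ?_
  rintro ⟨y, rfl | ⟨a, rfl⟩, h⟩
  exacts [.inr h, .inl ⟨a, h⟩]

/-- The part of a fiber of a coordinate of `f` that belongs to a box. -/
def RatMap.fiberBox (f : RatMap) (B B' : Matrix.SpecialLinearGroup (Fin 2) ℤ) (ζ : ℂˣ)
    (w₀ c : ℂ) (m M ε δ : ℝ) : Set Torus :=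
  {p | p ∈ f.dom ∧ zc B' (f.map p) = ζ ∧ m ≤ ‖(zc B p : ℂ)‖ ∧ ‖(zc B p : ℂ)‖ ≤ M ∧
    ‖(wc B p : ℂ) - w₀‖ ≤ ε ∧ ‖(wc B' (f.map p) : ℂ) - c‖ ≤ δ}

/-- A limit outside `dom f` would be a good point of a contracted curve, where `f` tends to a pole;
but the first coordinate of `f` is fixed at `ζ` and the second stays away from zero. -/
theorem RatMap.Contractions.isCompact_fiberBox (K : f.Contractions) {ζ : ℂˣ} {w₀ c : ℂ}
    {m M ε δ : ℝ} (hm : 0 < m) (hM : ∀ b ∈ K.bad, M < ‖(zc B b : ℂ)‖) (hε : ε < ‖w₀‖)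
    (hδ : δ < ‖c‖) : IsCompact (f.fiberBox B B' ζ w₀ c m M ε δ) := by
  rw [isCompact_iff_ultrafilter_le_nhds]
  intro F hF
  have hF' : ∀ᶠ p in (F : Filter Torus), p ∈ f.fiberBox B B' ζ w₀ c m M ε δ := le_principal_iff.1 hF
  have hcz : Continuous fun p => ‖(zc B p : ℂ)‖ :=
    (Units.continuous_val.comp (continuous_zc B)).norm
  have hcw : Continuous fun p => ‖(wc B p : ℂ) - w₀‖ :=
    ((Units.continuous_val.comp (continuous_wc B)).sub continuous_const).norm
  have hcw' : Continuous fun p => ‖(wc B' p : ℂ) - c‖ :=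
    ((Units.continuous_val.comp (continuous_wc B')).sub continuous_const).norm
  rcases exists_limit_of_box (B := B) (p := id) (F := F) hε
    (hF'.mono fun p hp => ⟨hp.2.2.2.1, hp.2.2.2.2.1⟩) with ⟨t, ht⟩ | ⟨w, hz, -⟩
  · have ht1 : m ≤ ‖(zc B t : ℂ)‖ :=
      ge_of_tendsto ((hcz.tendsto t).comp ht) (hF'.mono fun p hp => hp.2.2.1)
    have ht2 : ‖(zc B t : ℂ)‖ ≤ M :=
      le_of_tendsto ((hcz.tendsto t).comp ht) (hF'.mono fun p hp => hp.2.2.2.1)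
    have ht3 : ‖(wc B t : ℂ) - w₀‖ ≤ ε :=
      le_of_tendsto ((hcw.tendsto t).comp ht) (hF'.mono fun p hp => hp.2.2.2.2.1)
    have htd : t ∈ f.dom := by
      by_contra htd
      obtain ⟨a, ha⟩ := K.exists_isGood htd fun hb => absurd ht2 (not_le.2 (hM t hb))
      have h1 : Tendsto (fun p => LimitSurface.torus (f.map p)) F (𝓝 (K.K a).point) :=
        ha.tendsto_map ht (hF'.mono fun p hp => hp.1)
      have h2 : Tendsto (fun p => (zc B' (f.map p) : ℂ)) F (𝓝 ζ) :=
        tendsto_const_nhds.congr' (hF'.mono fun p hp => by simp only [hp.2.1])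
      rcases exists_limit_of_box (B := B') (p := f.map) (F := F) (A := ‖(ζ : ℂ)‖) hδ
        (hF'.mono fun p hp => ⟨by rw [hp.2.1], hp.2.2.2.2.2⟩) with ⟨s, hs⟩ | ⟨w, hz, -⟩
      · have h3 : LimitSurface.pole (firstCol (K.K a).B) (K.K a).c = .torus s :=
          tendsto_nhds_unique h1 (tendsto_torus_iff.2 hs)
        cases h3
      · exact ζ.ne_zero (tendsto_nhds_unique h2 hz)
    have hft : Tendsto f.map F (𝓝 (f.map t)) := (f.continuousAt_map htd).tendsto.comp ht
    refine ⟨t, ⟨htd, ?_, ht1, ht2, ht3, ?_⟩, ht⟩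
    · refine tendsto_nhds_unique (((continuous_zc B').tendsto _).comp hft) ?_
      exact tendsto_const_nhds.congr' (hF'.mono fun p hp => hp.2.1.symm)
    · exact le_of_tendsto ((hcw'.tendsto _).comp hft) (hF'.mono fun p hp => hp.2.2.2.2.2)
  · exfalso
    have h1 : m ≤ ‖(0 : ℂ)‖ := ge_of_tendsto hz.norm (hF'.mono fun p hp => hp.2.2.1)
    rw [norm_zero] at h1
    linarith

/-- A point that maximizes `|z|` cannot be interior, so it lies on one of the three outer walls.
Only the wall of minimal `|z|` plays no role. -/
theorem RatMap.IsToric.exists_mem_fiberBox (hf : f.IsToric) (K : f.Contractions) {p : Torus}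
    {w₀ c : ℂ} {M ε δ : ℝ} (hM : ∀ b ∈ K.bad, M < ‖(zc B b : ℂ)‖) (hε : ε < ‖w₀‖) (hδ : δ < ‖c‖)
    (hp : p ∈ f.fiberBox B B' (zc B' (f.map p)) w₀ c ‖(zc B p : ℂ)‖ M ε δ) :
    ∃ q ∈ f.fiberBox B B' (zc B' (f.map p)) w₀ c ‖(zc B p : ℂ)‖ M ε δ,
      ‖(zc B q : ℂ)‖ = M ∨ ‖(wc B q : ℂ) - w₀‖ = ε ∨ ‖(wc B' (f.map q) : ℂ) - c‖ = δ := by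
  have hpos : 0 < ‖(zc B p : ℂ)‖ := norm_pos_iff.2 (zc B p).ne_zero
  obtain ⟨q, hq, -, hint⟩ := hf.exists_extremal B B' (K.isCompact_fiberBox hpos hM hε hδ) ⟨p, hp⟩
    (fun q hq => hq.1) c
  refine ⟨q, hq, ?_⟩
  by_contra! hcon
  have hcz : Continuous fun p => ‖(zc B p : ℂ)‖ :=
    (Units.continuous_val.comp (continuous_zc B)).norm
  have hcw : Continuous fun p => ‖(wc B p : ℂ) - w₀‖ :=
    ((Units.continuous_val.comp (continuous_wc B)).sub continuous_const).norm
  have hcw' : ContinuousAt (fun p => ‖(wc B' (f.map p) : ℂ) - c‖) q :=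
    (((Units.continuous_val.comp (continuous_wc B')).continuousAt.comp
      (f.continuousAt_map hq.1)).sub continuousAt_const).norm
  apply hint
  filter_upwards [hcz.continuousAt.eventually (gt_mem_nhds (lt_of_le_of_ne hq.2.2.2.1 hcon.1)),
    hcw.continuousAt.eventually (gt_mem_nhds (lt_of_le_of_ne hq.2.2.2.2.1 hcon.2.1)),
    hcw'.eventually (gt_mem_nhds (lt_of_le_of_ne hq.2.2.2.2.2 hcon.2.2))] with s h1 h2 h3 h4 h5 h6
  exact ⟨h4, h5.trans hq.2.1, hq.2.2.1.trans h6, h1.le, h2.le, h3.le⟩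

end ToricSurface

/-! ### The rate of approach and the third estimate -/

namespace ToricSurface

open Filter MvPolynomial

variable {f : RatMap} {B B' : Matrix.SpecialLinearGroup (Fin 2) ℤ}

/-- Where `f` converges to a point of the image pole that is not the image of a contracted
curve, it does so at the rate given by the ramification index. -/
theorem RatMap.IsToric.exists_neg_log_zc_map_le (hf : f.IsToric) (K : f.Contractions) {r : ℕ}
    (hr : ∀ i, f.ord B i = r * B'.1 i 0) {w₀ c : ℂˣ} (hc : K.IsPoleValue B B' w₀ c)
    (hK : ∀ a, (K.K a).point ≠ .pole (firstCol B') c) {F : Ultrafilter Torus}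
    (hz : Tendsto (fun p => (zc B p : ℂ)) F (𝓝 0)) (hw : Tendsto (wc B) F (𝓝 w₀)) (hd : f.dom ∈ F)
    (hfF : Tendsto (fun p => LimitSurface.torus (f.map p)) F (𝓝 (.pole (firstCol B') c))) :
    ∃ C, ∀ᶠ p in (F : Filter Torus),
      -Real.log ‖(zc B' (f.map p) : ℂ)‖ ≤ r * -Real.log ‖(zc B p : ℂ)‖ + C := by
  obtain ⟨hfz, hfw⟩ := tendsto_torus_pole_iff.1 hfF
  have hw₀ : 0 < ‖(w₀ : ℂ)‖ := norm_pos_iff.2 w₀.ne_zero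
  have hc₀ : 0 < ‖(c : ℂ)‖ := norm_pos_iff.2 c.ne_zero
  -- The box has `|z| ≤ M` free of bad points, radius `ε` for which the pole is regular except
  -- perhaps at `w₀`, and radius `δ` for which the disc about `c` contains no image of a contracted
  -- curve.
  have hbad : ∀ᶠ M in 𝓝[>] (0 : ℝ), ∀ b ∈ K.bad, M < ‖(zc B b : ℂ)‖ :=
    K.finite_bad.eventually_all.2 fun b _ =>
      mem_nhdsWithin_of_mem_nhds (gt_mem_nhds (norm_pos_iff.2 (zc B b).ne_zero))
  obtain ⟨M, hM, hM0⟩ := (hbad.and self_mem_nhdsWithin).exists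
  have hM0 : 0 < M := hM0
  obtain ⟨ε, hε0, hεw, hεreg⟩ : ∃ ε > 0, ε < ‖(w₀ : ℂ)‖ ∧
      ∀ w : ℂ, ‖w - w₀‖ ≤ ε → w ≠ w₀ → f.Regular B 0 w := by
    obtain ⟨ε, hε, h⟩ := Metric.eventually_nhds_iff.1
      (eventually_nhdsWithin_iff.1 (f.eventually_regular_zero B w₀.ne_zero))
    refine ⟨min (ε / 2) (‖(w₀ : ℂ)‖ / 2), by positivity,
      (min_le_right _ _).trans_lt (half_lt_self hw₀), fun w hw hne => h ?_ hne⟩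
    rw [dist_eq_norm]
    exact (hw.trans (min_le_left _ _)).trans_lt (half_lt_self hε)
  have hpts : ∀ᶠ δ in 𝓝[>] (0 : ℝ), ∀ y ∈ Set.range fun a => (K.K a).point,
      ∀ c' : ℂˣ, ‖(c' : ℂ) - c‖ ≤ δ → y ≠ .pole (firstCol B') c' := by
    refine K.finite_range_point.eventually_all.2 ?_
    rintro _ ⟨a, rfl⟩
    by_cases h : ∃ c₁, (K.K a).point = .pole (firstCol B') c₁
    · obtain ⟨c₁, hc₁⟩ := h
      have hne : (c₁ : ℂ) - c ≠ 0 := by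
        rw [sub_ne_zero]
        intro h0
        exact hK a (by rw [hc₁, Units.ext h0])
      filter_upwards [mem_nhdsWithin_of_mem_nhds (gt_mem_nhds (norm_pos_iff.2 hne))] with δ hδ c' hc' h1
      have h2 : LimitSurface.pole (firstCol B') c₁ = .pole (firstCol B') c' := hc₁.symm.trans h1
      injection h2 with _ h3
      rw [h3] at hδ
      exact absurd hc' (not_le.2 hδ)
    · push Not at h
      exact Eventually.of_forall fun δ c' _ => h c'
  obtain ⟨δ, ⟨hδK, hδc⟩, hδ0⟩ := ((hpts.and
    (mem_nhdsWithin_of_mem_nhds (gt_mem_nhds hc₀))).and self_mem_nhdsWithin).exists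
  have hδ0 : 0 < δ := hδ0
  have hbox : ∀ᶠ p in (F : Filter Torus),
      p ∈ f.fiberBox B B' (zc B' (f.map p)) w₀ c ‖(zc B p : ℂ)‖ M ε δ := by
    have h1 : Tendsto (fun p => ‖(wc B p : ℂ) - w₀‖) F (𝓝 0) := by
      simpa using ((((Units.continuous_val.tendsto _).comp hw).sub_const (w₀ : ℂ)).norm)
    have h2 : Tendsto (fun p => ‖(wc B' (f.map p) : ℂ) - c‖) F (𝓝 0) := by
      simpa using ((((Units.continuous_val.tendsto _).comp hfw).sub_const (c : ℂ)).norm)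
    filter_upwards [hd, hz.norm.eventually (gt_mem_nhds (by simpa using hM0)),
      h1.eventually (gt_mem_nhds hε0), h2.eventually (gt_mem_nhds hδ0)] with p a1 a2 a3 a4
    exact ⟨a1, rfl, le_rfl, a2.le, a3.le, a4.le⟩
  -- `g p` lies on the fiber of `p` and on a wall of the box, with `|z (g p)| ≥ |z p|`. A lower
  -- bound for the first coordinate of `f` at `g p` is therefore one at `p`.
  choose! g hg hgb using fun p => hf.exists_mem_fiberBox K (p := p) hM hεw hδc
  have hg' : ∀ᶠ p in (F : Filter Torus),
      g p ∈ f.fiberBox B B' (zc B' (f.map p)) w₀ c ‖(zc B p : ℂ)‖ M ε δ := hbox.mono hg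
  have hgd : ∀ᶠ p in (F : Filter Torus), g p ∈ f.dom := hg'.mono fun p hp => hp.1
  have hgz : Tendsto (fun p => (zc B' (f.map (g p)) : ℂ)) F (𝓝 0) :=
    hfz.congr' (hg'.mono fun p hp => by simp only [hp.2.1])
  have hnt : ∀ s, ¬ Tendsto (fun p => f.map (g p)) F (𝓝 s) := by
    intro s hs
    have h1 : Tendsto (fun p => (zc B' (f.map (g p)) : ℂ)) F (𝓝 (zc B' s)) :=
      ((Units.continuous_val.comp (continuous_zc B')).tendsto s).comp hs
    exact (zc B' s).ne_zero (tendsto_nhds_unique h1 hgz)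
  obtain ⟨c', hgw⟩ : ∃ c', Tendsto (fun p => wc B' (f.map (g p))) F (𝓝 c') := by
    rcases exists_limit_of_box (B := B') (p := fun p => f.map (g p)) (F := F) (A := 1) hδc (by
      filter_upwards [hg', hgz.norm.eventually (gt_mem_nhds (by simp : ‖(0 : ℂ)‖ < 1))] with p h1 h2
      exact ⟨h2.le, h1.2.2.2.2.2⟩) with ⟨s, hs⟩ | ⟨c', -, h⟩
    exacts [absurd hs (hnt s), ⟨c', h⟩]
  have hglim := tendsto_torus_pole_iff.2 ⟨hgz, hgw⟩
  have hgn : Tendsto (fun p => ‖(wc B' (f.map (g p)) : ℂ) - c‖) F (𝓝 ‖(c' : ℂ) - c‖) :=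
    (((Units.continuous_val.tendsto _).comp hgw).sub_const (c : ℂ)).norm
  have hc'δ : ‖(c' : ℂ) - c‖ ≤ δ := le_of_tendsto hgn (hg'.mono fun p hp => hp.2.2.2.2.2)
  have hc'K : ∀ a, (K.K a).point ≠ .pole (firstCol B') c' := fun a => hδK _ ⟨a, rfl⟩ c' hc'δ
  have hcz : Continuous fun p => ‖(zc B p : ℂ)‖ :=
    (Units.continuous_val.comp (continuous_zc B)).norm
  rcases exists_limit_of_box (B := B) (p := g) (F := F) hεw
    (hg'.mono fun p hp => ⟨hp.2.2.2.1, hp.2.2.2.2.1⟩) with ⟨x, hx⟩ | ⟨w₁, hz₁, hw₁⟩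
  · exfalso
    have hxd : x ∉ f.dom := fun hxd => hnt _ ((f.continuousAt_map hxd).tendsto.comp hx)
    have hxM : ‖(zc B x : ℂ)‖ ≤ M :=
      le_of_tendsto ((hcz.tendsto x).comp hx) (hg'.mono fun p hp => hp.2.2.2.1)
    obtain ⟨a, ha⟩ := K.exists_isGood hxd fun hb => absurd hxM (not_le.2 (hM x hb))
    exact hc'K a (tendsto_nhds_unique (ha.tendsto_map hx hgd) hglim)
  have hw₁' : Tendsto (fun p => (wc B (g p) : ℂ)) F (𝓝 w₁) :=
    (Units.continuous_val.tendsto _).comp hw₁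
  have hw₁n : Tendsto (fun p => ‖(wc B (g p) : ℂ) - w₀‖) F (𝓝 ‖(w₁ : ℂ) - w₀‖) :=
    (hw₁'.sub_const (w₀ : ℂ)).norm
  by_cases hww : w₁ = w₀
  -- If `g` tended to `w₀`, the wall would have to be `|w' - c| = δ`. Yet `c` is the pole value, and
  -- limits in `𝕋` or at images of contracted curves are excluded.
  · exfalso
    subst hww
    rw [sub_self, norm_zero] at hw₁n
    have hcδ : ∀ᶠ p in (F : Filter Torus), ‖(wc B' (f.map (g p)) : ℂ) - c‖ = δ := by
      filter_upwards [hbox, hz₁.norm.eventually (gt_mem_nhds (by simpa using hM0)),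
        hw₁n.eventually (gt_mem_nhds hε0)] with p h1 h2 h3
      rcases hgb p h1 with h | h | h
      exacts [absurd h h2.ne, absurd h h3.ne, h]
    have hc'eq : ‖(c' : ℂ) - c‖ = δ :=
      tendsto_nhds_unique hgn (tendsto_const_nhds.congr' (hcδ.mono fun p hp => hp.symm))
    rcases hc (F.map g) hz₁ hw₁ hgd with ⟨s, hs⟩ | ⟨a, ha⟩ | h
    · exact hnt s hs
    · exact hc'K a (tendsto_nhds_unique hglim ha).symm
    · have h2 : LimitSurface.pole (firstCol B') c = .pole (firstCol B') c' :=
        (tendsto_nhds_unique hglim h).symm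
      injection h2 with _ h3
      rw [h3, sub_self, norm_zero] at hc'eq
      exact hδ0.ne hc'eq
  -- At the regular limit the first coordinate of `f` is `z ^ r` times a function bounded away from
  -- zero.
  · have hreg : f.Regular B 0 w₁ := hεreg w₁
      (le_of_tendsto hw₁n (hg'.mono fun p hp => hp.2.2.2.2.1)) fun h0 => hww (Units.ext h0)
    have h1 := (hreg.tendsto_zRed w₁.ne_zero hz₁ hw₁' B').norm
    have hpos : 0 < ‖f.zRed B B' 0 w₁‖ := norm_pos_iff.2 (hreg.zRed_ne_zero B')
    refine ⟨-Real.log (‖f.zRed B B' 0 w₁‖ / 2), ?_⟩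
    filter_upwards [hg', h1.eventually (lt_mem_nhds (half_lt_self hpos))] with p h2 h3
    have hzp : 0 < ‖(zc B p : ℂ)‖ := norm_pos_iff.2 (zc B p).ne_zero
    have h4 : ‖(zc B p : ℂ)‖ ^ r * (‖f.zRed B B' 0 w₁‖ / 2) ≤ ‖(zc B' (f.map p) : ℂ)‖ := by
      rw [← h2.2.1, RatMap.coe_zc_map hr h2.1, norm_mul, norm_pow]
      gcongr
      exact h2.2.2.1
    have h5 := Real.log_le_log (by positivity) h4
    rw [Real.log_mul (by positivity) (by positivity), Real.log_pow] at h5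
    linarith

theorem exists_bound_of_tendsto_Log (nrm : Seminorm ℝ (Fin 2 → ℝ)) {l : Filter Torus}
    {g : Torus → Torus} {t : Torus} (h : Tendsto g l (𝓝 t)) (v : Torus → Fin 2 → ℝ) :
    ∃ C, ∀ᶠ p in l, nrm (Log (g p)) - nrm (v p) ≤ C := by
  obtain ⟨C, hC⟩ := exists_seminorm_le_of_isBigO nrm
    (((continuous_Log.tendsto t).comp h).isBigO_one ℝ)
  refine ⟨C, hC.mono fun p hp => ?_⟩
  have := apply_nonneg nrm (v p)
  simp only [Function.comp_apply] at hp
  linarith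

/-- Avoiding `V` excludes the images of contracted curves. What remains is a limit in `𝕋`, where
`Log f` is bounded, or the pole value, where the rate estimate applies. -/
theorem RatMap.IsToric.exists_bound_off_excImage (hf : f.IsToric) (K : f.Contractions)
    (nrm : Seminorm ℝ (Fin 2 → ℝ)) {V : Set LimitSurface} (hV : ∀ a, V ∈ 𝓝 (K.K a).point) :
    ∃ C, ∀ p ∈ {p : Torus | p ∈ f.dom ∧ .torus (f.map p) ∉ V},
      nrm (Log (f.map p)) - nrm (f.trop (Log p)) ≤ C := by
  refine exists_bound_of_ultrafilter fun F hF => ?_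
  have hd : f.dom ∈ F := mem_of_superset hF fun p hp => hp.1
  have hVF : ∀ᶠ p in (F : Filter Torus), .torus (f.map p) ∉ V :=
    mem_of_superset hF fun p hp => hp.2
  have hno : ∀ a, ¬ Tendsto (fun p => LimitSurface.torus (f.map p)) F (𝓝 (K.K a).point) := by
    intro a ha
    obtain ⟨p, h1, h2⟩ := ((ha.eventually (hV a)).and hVF).exists
    exact h2 h1
  rcases trichotomy F id with ⟨t, ht⟩ | ⟨B, w₀, hz, hw⟩ | hgen
  · rcases hf.limits_of_le_nhds K ht hd with ⟨s, hs⟩ | ⟨a, ha⟩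
    · exact exists_bound_of_tendsto_Log nrm hs _
    · exact absurd ha (hno a)
  · obtain ⟨B', r, hr0, hr⟩ := hf.exists_pole_image B
    obtain ⟨c, hc⟩ := hf.exists_isPoleValue K hr0 hr w₀
    rcases hc F hz hw hd with ⟨s, hs⟩ | ⟨a, ha⟩ | h
    · exact exists_bound_of_tendsto_Log nrm hs _
    · exact absurd ha (hno a)
    · have hK : ∀ a, (K.K a).point ≠ .pole (firstCol B') c := fun a ha => hno a (by rw [ha]; exact h)
      obtain ⟨C, hC⟩ := hf.exists_neg_log_zc_map_le K hr hc hK hz hw hd h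
      obtain ⟨hfz, hfw⟩ := tendsto_torus_pole_iff.1 h
      refine exists_seminorm_sub_le nrm (isBigO_Log_sub hfw) (f.isBigO_trop_sub_smul hr hz hw) (C := C) ?_
      filter_upwards [hC, (tendsto_neg_log_norm_atTop hfz).eventually_ge_atTop 0] with p h1 h2
      exact ⟨h2, h1⟩
  · obtain ⟨C, hC⟩ := exists_seminorm_le_of_isBigO nrm (f.isBigO_of_generic hgen)
    exact ⟨C, hC.mono fun p hp => ((le_abs_self _).trans (abs_sub_map_le_sub nrm _ _)).trans hp⟩

end ToricSurface

/-! ### Passage to all values of the meromorphic map, and the conclusion -/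

namespace ToricSurface

open Filter MvPolynomial

variable {f : RatMap} {B B' : Matrix.SpecialLinearGroup (Fin 2) ℤ}

theorem exists_isClosed_subset {y : LimitSurface} {V : Set LimitSurface} (hV : V ∈ 𝓝 y) :
    ∃ W ∈ 𝓝 y, IsClosed W ∧ W ⊆ V := by
  obtain ⟨B, y₀, rfl⟩ := exists_chart_eq y
  obtain ⟨Q, hQ, hQV, hQc⟩ :=
    local_compact_nhds ((continuous_chart B).continuousAt.preimage_mem_nhds hV)
  exact ⟨chart B '' Q, (isOpenEmbedding_chart B).isOpenMap.image_mem_nhds hQ,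
    (hQc.image (continuous_chart B)).isClosed, Set.image_subset_iff.2 hQV⟩

theorem continuous_seminorm (nrm : Seminorm ℝ (Fin 2 → ℝ)) : Continuous nrm := by
  obtain ⟨C, hC0, hC⟩ := exists_seminorm_le nrm
  refine (LipschitzWith.of_dist_le_mul (K := ⟨C, hC0.le⟩) fun u v => ?_).continuous
  rw [Real.dist_eq, dist_eq_norm]
  exact (abs_sub_map_le_sub nrm u v).trans (hC _)

theorem exists_norm_le_mul_seminorm (nrm : Seminorm ℝ (Fin 2 → ℝ))
    (hnrm : ∀ w, nrm w = 0 → w = 0) : ∃ C, 0 ≤ C ∧ ∀ w, ‖w‖ ≤ C * nrm w := by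
  obtain ⟨w₀, hw₀, hmin⟩ := (isCompact_sphere (0 : Fin 2 → ℝ) 1).exists_isMinOn
    (NormedSpace.sphere_nonempty.2 zero_le_one) (continuous_seminorm nrm).continuousOn
  have hpos : 0 < nrm w₀ := by
    refine (apply_nonneg nrm w₀).lt_of_ne fun h0 => ?_
    rw [hnrm w₀ h0.symm] at hw₀
    simp at hw₀
  refine ⟨(nrm w₀)⁻¹, (inv_pos.2 hpos).le, fun w => ?_⟩
  by_cases hw : w = 0
  · simp [hw]
  have hw' : 0 < ‖w‖ := norm_pos_iff.2 hw
  have h1 : nrm w₀ ≤ nrm (‖w‖⁻¹ • w) := hmin (by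
    rw [mem_sphere_zero_iff_norm, norm_smul, norm_inv, norm_norm, inv_mul_cancel₀ hw'.ne'])
  rw [map_smul_eq_mul, norm_inv, norm_norm, inv_mul_eq_div, le_div_iff₀ hw'] at h1
  rw [inv_mul_eq_div, le_div_iff₀ hpos]
  linarith

theorem exists_tendsto_of_bounded_Log {ι : Type*} {F : Ultrafilter ι} {t : ι → Torus} {C : ℝ}
    (h : ∀ᶠ n in (F : Filter ι), ‖Log (t n)‖ ≤ C) : ∃ t₀, Tendsto t F (𝓝 t₀) := by
  have hi : ∀ i, ∃ c, Tendsto (fun n => t n i) F (𝓝 c) := fun i =>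
    exists_tendsto_of_bounded_log (h.mono fun n hn => by
      have := (norm_le_pi_norm (Log (t n)) i).trans hn
      simpa [Log] using this)
  choose c hc using hi
  exact ⟨c, tendsto_pi_nhds.2 hc⟩

/-- The bound for the values in the torus carries over to all values of the meromorphic map. -/
theorem RatMap.exists_eq_torus_of_mem_image {nrm : Seminorm ℝ (Fin 2 → ℝ)}
    (hnrm : ∀ w, nrm w = 0 → w = 0) {W : Set LimitSurface} (hW : IsClosed W) {C : ℝ}
    (h : ∀ p ∈ {p : Torus | p ∈ f.dom ∧ .torus (f.map p) ∉ W},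
      nrm (Log (f.map p)) - nrm (f.trop (Log p)) ≤ C) {p : Torus} {q : LimitSurface}
    (hq : q ∈ f.image (.torus p)) (hqW : q ∉ W) :
    ∃ t : Torus, q = .torus t ∧ nrm (Log t) ≤ nrm (f.trop (Log p)) + C := by
  obtain ⟨F, hd, hp, hfq⟩ := f.mem_image_iff.1 hq
  have hp' : Tendsto id (F : Filter Torus) (𝓝 p) := tendsto_torus_iff.1 hp
  have htrop : Tendsto (fun p' => nrm (f.trop (Log p')) + C) F (𝓝 (nrm (f.trop (Log p)) + C)) :=
    ((((continuous_seminorm nrm).comp (f.continuous_trop.comp continuous_Log)).tendsto p).comp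
      hp').add_const C
  have hle : ∀ᶠ p' in (F : Filter Torus), nrm (Log (f.map p')) ≤ nrm (f.trop (Log p')) + C := by
    filter_upwards [hd, hfq.eventually (hW.isOpen_compl.mem_nhds hqW)] with p' h1 h2
    linarith [h p' ⟨h1, h2⟩]
  obtain ⟨A, hA0, hA⟩ := exists_norm_le_mul_seminorm nrm hnrm
  -- Definiteness of the norm enters here: the bound keeps nearby values of `f` in a compact part of
  -- `𝕋`, so the limit `q` is in `𝕋` as well.
  obtain ⟨t, ht⟩ := exists_tendsto_of_bounded_Log (F := F) (t := f.map)
    (C := A * (nrm (f.trop (Log p)) + C + 1)) (by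
      filter_upwards [hle, htrop.eventually (gt_mem_nhds (lt_add_one _))] with p' h1 h2
      exact (hA _).trans (mul_le_mul_of_nonneg_left (h1.trans h2.le) hA0))
  refine ⟨t, tendsto_nhds_unique hfq (tendsto_torus_iff.2 ht), ?_⟩
  exact le_of_tendsto_of_tendsto
    ((((continuous_seminorm nrm).comp continuous_Log).tendsto t).comp ht) htrop hle

end ToricSurface

theorem mainTheorem8 (f : ToricSurface.RatMap) (hf : f.IsToric)
    (nrm : Seminorm ℝ (Fin 2 → ℝ)) (hnrm : ∀ w, nrm w = 0 → w = 0)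
    (U U' V : Set ToricSurface.LimitSurface)
    (hU : U ∈ 𝓝ˢ f.Exc) (hU' : U' ∈ 𝓝ˢ f.Ind) (hV : V ∈ 𝓝ˢ f.excImage) :
    ∃ C : ℝ, 0 < C ∧ ∀ p : ToricSurface.Torus,
      (.torus p ∉ U →
        ∃ t : ToricSurface.Torus, f.image (.torus p) = {.torus t} ∧
          nrm (ToricSurface.Log t - f.trop (ToricSurface.Log p)) ≤ C) ∧
      (.torus p ∉ U' →
        ∀ t : ToricSurface.Torus, .torus t ∈ f.image (.torus p) →
          nrm (f.trop (ToricSurface.Log p)) - C ≤ nrm (ToricSurface.Log t)) ∧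
      (∀ q ∈ f.image (.torus p), ¬ (.torus p ∈ U ∧ q ∈ V) →
        ∃ t : ToricSurface.Torus, q = .torus t ∧
          nrm (ToricSurface.Log t) ≤ nrm (f.trop (ToricSurface.Log p)) + C) := by
  obtain ⟨K⟩ := hf.nonempty_contractions
  obtain ⟨C₁, hC₁⟩ := hf.exists_bound_off_Exc nrm hU
  obtain ⟨C₂, hC₂⟩ := hf.exists_bound_off_Ind nrm hU'
  -- Closed neighborhoods inside `V` are used because the bound passes to a limit value `q` only if
  -- being outside is an open condition.
  choose W hW hWc hWV using fun a => ToricSurface.exists_isClosed_subset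
    (mem_nhdsSet_iff_forall.1 hV _ (K.point_mem_excImage a))
  have := K.finite
  obtain ⟨C₃, hC₃⟩ := hf.exists_bound_off_excImage K nrm (V := ⋃ a, W a)
    fun a => Filter.mem_of_superset (hW a) (Set.subset_iUnion W a)
  have h1 : C₁ ≤ max (max C₁ C₂) (max C₃ 1) := (le_max_left _ _).trans (le_max_left _ _)
  have h2 : C₂ ≤ max (max C₁ C₂) (max C₃ 1) := (le_max_right _ _).trans (le_max_left _ _)
  have h3 : C₃ ≤ max (max C₁ C₂) (max C₃ 1) := (le_max_left _ _).trans (le_max_right _ _)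
  have h4 : 1 ≤ max (max C₁ C₂) (max C₃ 1) := (le_max_right _ _).trans (le_max_right _ _)
  refine ⟨max (max C₁ C₂) (max C₃ 1), zero_lt_one.trans_le h4, fun p => ⟨fun hp => ?_,
    fun hp t ht => ?_, fun q hq hpq => ?_⟩⟩
  · obtain ⟨hpd, hle⟩ := hC₁ p hp
    exact ⟨f.map p, f.image_torus_of_mem_dom hpd, hle.trans h1⟩
  · have hpd : p ∈ f.dom := K.mem_dom_of_notMem_Ind
      (fun h => hp (subset_of_mem_nhdsSet hU' h)) ht
    rw [f.image_torus_of_mem_dom hpd, Set.mem_singleton_iff] at ht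
    obtain rfl := ToricSurface.torus_injective ht
    linarith [hC₂ p ⟨hpd, hp⟩]
  -- For `p ∈ U` the value `q` avoids `V`, and the bound off the image points applies; for `p ∉ U`
  -- the first estimate is stronger.
  · by_cases hp : .torus p ∈ U
    · have hqW : q ∉ ⋃ a, W a := by
        rw [Set.mem_iUnion]
        rintro ⟨a, ha⟩
        exact hpq ⟨hp, hWV a ha⟩
      obtain ⟨t, rfl, ht⟩ := f.exists_eq_torus_of_mem_image hnrm
        (isClosed_iUnion_of_finite hWc) hC₃ hq hqW
      exact ⟨t, rfl, by linarith⟩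
    · obtain ⟨hpd, hle⟩ := hC₁ p hp
      rw [f.image_torus_of_mem_dom hpd, Set.mem_singleton_iff] at hq
      refine ⟨f.map p, hq, ?_⟩
      linarith [(le_abs_self _).trans (abs_sub_map_le_sub nrm (ToricSurface.Log (f.map p)) (f.trop (ToricSurface.Log p)))]
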